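/- Let $f\in\mathbb{C}[[x_0,x_1]]$ be irreducible, let $\mathcal{C}=\{f=0\}$ be the germ of plane curve it defines, and for $h\in\mathbb{C}[[x_0,x_1]]\setminus (f)$ put $\nu(h)=\dim_{\mathbb{C}}\mathbb{C}[[x_0,x_1]]/(f,h)$. Let $\bar\beta_0<\cdots<\bar\beta_g$ be the minimal system of generators of the semigroup $\Gamma(\mathcal{C})=\{\nu(h): h\notin (f)\}$, let $e_i=\gcd(\bar\beta_0,\dots,\bar\beta_i)$ and $n_i=e_{i-1}/e_i$ for $1\le i\le g$, and assume $\nu(x_0)=\bar\beta_0$, $\nu(x_1)=\bar\beta_1$ (when $g\ge 1$). For $1\le i\le g$ let $b_{ij}\ge 0$ $(0\le j<i)$ be the integers with $n_i\bar\beta_i=\sum_{j<i}b_{ij}\bar\beta_j$ and $b_{ij}<n_j$ for $j\ne 0$. Let $x_0,x_1,x_2,\dots,x_g\in\mathbb{C}[[x_0,x_1]]$ be a minimal generating sequence, $\nu(x_i)=\bar\beta_i$, satisfying in $\mathbb{C}[[x_0,x_1]]/(f)$, for $i=1,\dots,g$ and with $x_{g+1}=0$, identities $$x_{i+1}=x_i^{n_i}-c_i\,x_0^{b_{i0}}\cdots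 x_{i-1}^{b_{i(i-1)}}-\sum_{\gamma}c_{i,\gamma}\,x_0^{\gamma_0}\cdots x_i^{\gamma_i},$$ where $c_i\in\mathbb{C}\setminus\{0\}$, $c_{i,\gamma}\in\mathbb{C}$, and the sum is over $\gamma=(\gamma_0,\dots,\gamma_i)$ with $0\le\gamma_j<n_j$ for $1\le j\le i$ and $\sum_j\gamma_j\bar\beta_j>n_i\bar\beta_i$. Let $\eta:(\chi,0)\to(\mathbb{C},0)$ be the family of germs of curves in $(\mathbb{C}^{g+1},0)$ with coordinates $x_0,\dots,x_g$ (now independent variables) and parameter $v$ defined by $$v\,x_{i+1}=x_i^{n_i}-c_i\,x_0^{b_{i0}}\cdots x_{i-1}^{b_{i(i-1)}}-\sum_{\gamma}c_{i,\gamma}\,v\,x_0^{\gamma_0}\cdots x_i^{\gamma_i},\qquad i=1,\dots,g,\quad x_{g+1}=0,$$ whose special fiber $v=0$ is the monomial curve associated with $\mathcal{C}$. For $m\in\mathbb{N}$ let $\chi_m$ be the relative $m$-th jet scheme of $\chi$ over the $v$-line: writing $F_i(v,x)$ for the difference of the two sides of the $i$-th equation and $F_i\big(v,\sum_{j=0}^m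 x^{(j)}t^j\big)\equiv\sum_{l=0}^m F_i^{(l)}t^l \bmod t^{m+1}$, its formal germ at the zero jet has ring $$\mathbb{C}[[v]]\,[[x_k^{(j)}:0\le k\le g,\ 0\le j\le m]]\,/\,\big(F_i^{(l)}:1\le i\le g,\ 0\le l\le m\big).$$ Theorem. (1) If $g\ge 3$, then for every $m\ge 1$ the family $(\chi_m,0)\to(\mathbb{C},0)$ is not flat, i.e. the above ring is not flat over $\mathbb{C}[[v]]$. (2) If $g=2$, then there is $M$ (possibly depending on the family) such that for all $m\ge M$ the family $(\chi_m,0)\to(\mathbb{C},0)$ is not flat. -/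

import Mathlib

/-- The intersection multiplicity `(f, h)₀ = dim_ℂ ℂ⟦x₀, x₁⟧ / (f, h)` of two plane curve germs
(only used where this dimension is finite). -/
noncomputable def intersectionMult (f h : MvPowerSeries (Fin 2) ℂ) : ℕ :=
  Module.finrank ℂ (MvPowerSeries (Fin 2) ℂ ⧸ Ideal.span {f, h})

/-- The semigroup `Γ(C)` of the plane branch `C = {f = 0}`: all values `(f, h)₀` for `h` not
divisible by `f`. -/
def branchSemigroup (f : MvPowerSeries (Fin 2) ℂ) : Set ℕ :=
  {n | ∃ h : MvPowerSeries (Fin 2) ℂ, ¬ f ∣ h ∧ n = intersectionMult f h}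

/-- `β₀ < ⋯ < β_g` is the minimal system of generators of the semigroup `Γ`. -/
structure IsMinimalGenerators {g : ℕ} (Γ : Set ℕ) (β : Fin (g + 1) → ℕ) : Prop where
  strictMono : StrictMono β
  closure_eq : (AddSubmonoid.closure (Set.range β) : Set ℕ) = Γ
  notMem_closure : ∀ i, β i ∉ AddSubmonoid.closure (β '' {j | j ≠ i})

/-- `e_i = gcd (β₀, …, β_i)`. -/
def gcdSeq {g : ℕ} (β : Fin (g + 1) → ℕ) (i : Fin (g + 1)) : ℕ :=
  (Finset.univ.filter (fun j => j ≤ i)).gcd β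

/-- `n_{k+1} = e_k / e_{k+1}` for `k = 0, …, g - 1` (an exact division). -/
def ratioSeq {g : ℕ} (β : Fin (g + 1) → ℕ) (k : Fin g) : ℕ :=
  gcdSeq β k.castSucc / gcdSeq β k.succ

/-- For `z = (z₀, …, z_g)` and `k = 0, …, g - 1`, the element `z_{k+2}`, with the convention
`z_{g+1} = 0`. -/
def nextEntry {A : Type*} [Zero A] {g : ℕ} (z : Fin (g + 1) → A) (k : Fin g) : A :=
  if h : (k : ℕ) + 2 < g + 1 then z ⟨(k : ℕ) + 2, h⟩ else 0

/-- A minimal generating sequence `z₀, …, z_g` of the plane branch `C = {f = 0}` together with the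
identities it satisfies. The identities are numbered by `i = 1, …, g`; the index `k : Fin g` stands
for `i = k + 1`, so that `z k.succ` is `z_i` and `ratioSeq β k` is `n_i`. -/
structure BranchExpansion (f : MvPowerSeries (Fin 2) ℂ) (g : ℕ) where
  /-- the minimal generators of the semigroup of the branch -/
  β : Fin (g + 1) → ℕ
  isMinimalGenerators : IsMinimalGenerators (branchSemigroup f) β
  /-- the minimal generating sequence -/
  z : Fin (g + 1) → MvPowerSeries (Fin 2) ℂ
  z_zero : ∀ j : Fin (g + 1), (j : ℕ) = 0 → z j = MvPowerSeries.X 0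
  z_one : ∀ j : Fin (g + 1), (j : ℕ) = 1 → z j = MvPowerSeries.X 1
  intersectionMult_z : ∀ j, intersectionMult f (z j) = β j
  /-- the exponents in `n_i β_i = b_{i0} β₀ + ⋯ + b_{i(i-1)} β_{i-1}` -/
  b : Fin g → Fin (g + 1) → ℕ
  b_eq_zero : ∀ k j, k.castSucc < j → b k j = 0
  b_lt : ∀ k j : Fin g, j < k → b k j.succ < ratioSeq β j
  b_sum : ∀ k, ratioSeq β k * β k.succ = ∑ j, b k j * β j
  /-- the coefficients `c_i` -/
  c : Fin g → ℂ
  c_ne_zero : ∀ k, c k ≠ 0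
  /-- the series `∑ c_{i,γ} x₀^γ₀ ⋯ x_i^γ_i` of terms of higher weight -/
  P : Fin g → MvPowerSeries (Fin (g + 1)) ℂ
  P_support : ∀ k (γ : Fin (g + 1) →₀ ℕ), MvPowerSeries.coeff γ (P k) ≠ 0 →
    (∀ j, k.succ < j → γ j = 0) ∧
    (∀ j : Fin g, j ≤ k → γ j.succ < ratioSeq β j) ∧
    ratioSeq β k * β k.succ < ∑ j, γ j * β j
  /-- `z_{i+1} = z_i ^ n_i - c_i ∏ z_j ^ b_{ij} - ∑ c_{i,γ} z ^ γ` in `ℂ⟦x₀, x₁⟧ / (f)` -/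
  identity : ∀ k,
    nextEntry z k - (z k.succ ^ ratioSeq β k - MvPowerSeries.C (c k) * ∏ j, z j ^ b k j
      - MvPowerSeries.subst z (P k)) ∈ Ideal.span {f}

/-- The universal `m`-jet `x_i(t) = x_i^(0) + x_i^(1) t + ⋯ + x_i^(m) t^m`, where `none` is the
variable `t` and `some (i, j)` is the variable `x_i^(j)`. -/
noncomputable def universalJet {σ R : Type*} [CommRing R] (m : ℕ) (i : σ) :
    MvPowerSeries (Option (σ × Fin (m + 1))) R :=
  ∑ j : Fin (m + 1), MvPowerSeries.X (some (i, j)) * MvPowerSeries.X none ^ (j : ℕ)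

/-- The coefficient `F^(l)` of `t^l` in `F (x(t))`. -/
noncomputable def jetCoeff {σ R : Type*} [CommRing R] (m : ℕ) (F : MvPowerSeries σ R) (l : ℕ) :
    MvPowerSeries (σ × Fin (m + 1)) R :=
  PowerSeries.coeff l (MvPowerSeries.optionEquivLeft (σ × Fin (m + 1)) R
    (MvPowerSeries.subst (universalJet m : σ → MvPowerSeries (Option (σ × Fin (m + 1))) R) F))

/-- The formal (completed) local ring, at the zero jet, of the `m`-th jet scheme relative to `R` of
the formal germ defined by the equations `F k = 0`: the power series ring over `R` in all jet
coordinates `x_i^(j)`, modulo the coefficients of `t^0, …, t^m` in the `F k (x(t))`. -/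
abbrev JetRing {σ κ R : Type*} [CommRing R] (m : ℕ) (F : κ → MvPowerSeries σ R) : Type _ :=
  MvPowerSeries (σ × Fin (m + 1)) R ⧸
    Ideal.span (Set.range (fun p : κ × Fin (m + 1) => jetCoeff m (F p.1) (p.2 : ℕ)))

namespace BranchExpansion

variable {f : MvPowerSeries (Fin 2) ℂ} {g : ℕ}

/-- The equations, over `ℂ⟦v⟧`, of the family `χ`:
`x_i ^ n_i - c_i ∏ x_j ^ b_{ij} - v ∑ c_{i,γ} x ^ γ - v x_{i+1} = 0`, with `x_{g+1} = 0`. -/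
noncomputable def familyEquation (E : BranchExpansion f g) (k : Fin g) :
    MvPowerSeries (Fin (g + 1)) (PowerSeries ℂ) :=
  MvPowerSeries.X k.succ ^ ratioSeq E.β k
    - MvPowerSeries.C (PowerSeries.C (E.c k)) * ∏ j, MvPowerSeries.X j ^ E.b k j
    - MvPowerSeries.C PowerSeries.X * MvPowerSeries.map (PowerSeries.C (R := ℂ)) (E.P k)
    - MvPowerSeries.C PowerSeries.X * nextEntry MvPowerSeries.X k

/-- The formal local ring of `(χ_m, 0)`, an algebra over the formal local ring `ℂ⟦v⟧` of the base
through the family `η ∘ φ_m : (χ_m, 0) → (ℂ, 0)`. -/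
abbrev FamilyJetRing (E : BranchExpansion f g) (m : ℕ) : Type :=
  JetRing m E.familyEquation

end BranchExpansion

/-! Non-flatness comes from comparing two codimensions inside the space with coordinates `x_i^(j)`.
Write `N = m + 1`, `n_i = ratioSeq`, `q = b 0 0`.

Upper bound. In the special fibre only binomials survive, so all jets with `ord x_i ≥ a_i` lie on it
as soon as both monomials of each binomial get order at least `N`. This is a linear space of
codimension `∑ min(a_i, N)` in the fibre. If the family is flat, `v` is a nonzerodivisor, and
Krull's height theorem produces a prime `P` of height at most that number which contains the jet
equations but not `v` (`Ideal.exists_isPrime_height_le_card`, `exists_isPrime_of_flat`).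

Lower bound for every such `P`. By the Jacobian criterion (`Ideal.card_le_height_of_derivations`)
the height of `P` is at least the size of any set of coordinates such that no nonzero tangent vector
at `P` is supported there. Tangent vectors are studied over the local domain `T = A / P`, where the
universal jet is a tuple of power series solving the equations modulo `X ^ N`. A valuation on `T⟦X⟧`
refining the `X`-adic order gives the alternative `WeightData.jet_alternative`: either the orders of
all `x_i` are large, or the valuations of the `x_i` are exactly proportional to the weights `β_i`.
In the second case the linearised equations determine the high coefficients of `ξ_1, …, ξ_g` once
`ξ_0 = 0`. Moreover `v ≠ 0` in `T`, so the equation containing `v x_{i+1}` eliminates `ξ_{i+1}`: the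
generic fibre is a plane curve. Both mechanisms rest on `n_i β_i < β_{i+1}`, which is deduced from
the valuation property of intersection multiplicities (`lt_next`).

Comparison. For `g ≥ 3` the lower bound `(g - 1) N + 2` exceeds the upper bound, about `(g + 1) N /
2`, obtained from jets of order about `N / 2` in every coordinate. For `g = 2` the lower bound is `N
(1 + (1/q + 1/n_1) / n_2)` and the upper bound is `N (1/q + 1/n_1 + 1/n_2) + O(1)`; the difference
of the leading coefficients is `(1 - 1/n_2)(1 - 1/q - 1/n_1)`, which is at least `1/12` since `q ≥
3` and `n_i ≥ 2`. -/

/-! ### Lower bounds for heights of primes from derivations -/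

/-- The largest ideal contained in `P` that is stable under the derivation `D`. -/
def Ideal.stableCore {A : Type*} [CommRing A] (P : Ideal A) (D : Derivation ℤ A A) : Ideal A where
  carrier := {a | ∀ n : ℕ, (D^[n]) a ∈ P}
  zero_mem' n := by simp [iterate_map_zero]
  add_mem' {a b} ha hb n := by
    rw [iterate_map_add]
    exact P.add_mem (ha n) (hb n)
  smul_mem' c x hx := by
    have key : ∀ (n : ℕ) (c x : A), (∀ k, (D^[k]) x ∈ P) → (D^[n]) (c * x) ∈ P := by
      intro n
      induction n with
      | zero => intro c x hx; exact P.mul_mem_left c (hx 0)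
      | succ n ih =>
        intro c x hx
        rw [Function.iterate_succ_apply, Derivation.leibniz, smul_eq_mul, smul_eq_mul,
          iterate_map_add, mul_comm x]
        exact P.add_mem (ih c (D x) fun k => hx (k + 1)) (ih (D c) x hx)
    intro n
    exact key n c x hx

theorem Ideal.mem_stableCore {A : Type*} [CommRing A] {P : Ideal A} {D : Derivation ℤ A A}
    {a : A} : a ∈ P.stableCore D ↔ ∀ n : ℕ, (D^[n]) a ∈ P := Iff.rfl

theorem Ideal.stableCore_le {A : Type*} [CommRing A] (P : Ideal A) (D : Derivation ℤ A A) :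
    P.stableCore D ≤ P := fun _ ha => ha 0

theorem Derivation.iterate_mul {A : Type*} [CommRing A] (D : Derivation ℤ A A) (n : ℕ) (a b : A) :
    (D^[n]) (a * b) = ∑ ij ∈ Finset.HasAntidiagonal.antidiagonal n,
      n.choose ij.1 • ((D^[ij.1]) a * (D^[ij.2]) b) := by
  induction n generalizing a b with
  | zero => simp
  | succ n ih =>
    rw [Function.iterate_succ_apply, Derivation.leibniz, smul_eq_mul, smul_eq_mul,
      iterate_map_add, ih, mul_comm b, ih, Finset.sum_antidiagonal_choose_succ_nsmul
        (fun i j => (D^[i]) a * (D^[j]) b)]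
    congr 1
    refine Finset.sum_congr rfl fun ij hij => ?_
    rw [← Function.iterate_succ_apply, Nat.choose_symm_of_eq_add
      (Finset.HasAntidiagonal.mem_antidiagonal.mp hij).symm]

/-- If `p` and `q` are minimal with `D^p a ∉ P` and `D^q b ∉ P`, then every term of the Leibniz
expansion of `D^(p+q) (a b)` lies in `P` except the one indexed by `(p, q)`, whose binomial
coefficient is a unit in characteristic zero. -/
theorem Ideal.isPrime_stableCore {A : Type*} [CommRing A] [Algebra ℚ A] (P : Ideal A)
    [hP : P.IsPrime] (D : Derivation ℤ A A) : (P.stableCore D).IsPrime := by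
  classical
  refine ⟨fun h => hP.ne_top (top_le_iff.mp (h ▸ P.stableCore_le D)), fun {a b} hab => ?_⟩
  by_contra! hc
  have ha : ∃ n, (D^[n]) a ∉ P := by simpa [Ideal.mem_stableCore] using hc.1
  have hb : ∃ n, (D^[n]) b ∉ P := by simpa [Ideal.mem_stableCore] using hc.2
  set p := Nat.find ha with hp
  set q := Nat.find hb with hq
  have h := hab (p + q)
  rw [Derivation.iterate_mul, ← Finset.add_sum_erase _ _
    (show (p, q) ∈ Finset.HasAntidiagonal.antidiagonal (p + q) by simp)] at h
  have hrest : ∑ ij ∈ (Finset.HasAntidiagonal.antidiagonal (p + q)).erase (p, q),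
      (p + q).choose ij.1 • ((D^[ij.1]) a * (D^[ij.2]) b) ∈ P := by
    refine P.sum_mem fun ij hij => ?_
    obtain ⟨h1, h2⟩ := Finset.mem_erase.mp hij
    rw [Finset.HasAntidiagonal.mem_antidiagonal] at h2
    refine P.nsmul_mem ?_ _
    rcases lt_or_ge ij.1 p with h3 | h3
    · exact P.mul_mem_right _ (not_not.mp (Nat.find_min ha h3))
    · have h4 : ij.2 < q := by
        rcases lt_or_ge ij.2 q with h4 | h4
        · exact h4
        · exact absurd (Prod.ext (by simp; omega) (by simp; omega)) h1
      exact P.mul_mem_left _ (not_not.mp (Nat.find_min hb h4))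
  have h5 := (P.add_mem_iff_left hrest).mp h
  have h6 : ((p + q).choose p : A) * ((D^[p]) a * (D^[q]) b) ∈ P := by
    simpa [nsmul_eq_mul] using h5
  have hu : IsUnit (((p + q).choose p : ℕ) : A) := by
    have : ((((p + q).choose p : ℕ) : ℚ)) ≠ 0 := by
      exact_mod_cast (Nat.choose_pos (Nat.le_add_right p q)).ne'
    simpa using (this.isUnit.map (algebraMap ℚ A))
  rcases hP.mem_or_mem ((P.unit_mul_mem_iff_mem hu).mp h6) with h7 | h7
  · exact Nat.find_spec ha h7
  · exact Nat.find_spec hb h7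

/-- If derivations `D i` and elements `f i` of a prime ideal `P` satisfy `D i (f j) = Δ δ_{ij}`
with `Δ ∉ P`, then the height of `P` is at least the number of the `f i`. -/
theorem Ideal.le_height_of_derivation_diagonal {A : Type*} [CommRing A] [Algebra ℚ A] (Δ : A) :
    ∀ (r : ℕ) (P : Ideal A) [P.IsPrime] (D : Fin r → Derivation ℤ A A) (f : Fin r → A),
      (∀ i, f i ∈ P) → Δ ∉ P → (∀ i j, D i (f j) = if i = j then Δ else 0) →
      (r : ℕ∞) ≤ P.height := by
  intro r
  induction r with
  | zero => intros; simp
  | succ r ih =>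
    intro P _ D f hf hΔ hD
    have hprime := P.isPrime_stableCore (D 0)
    have hle := P.stableCore_le (D 0)
    -- The element `f 0` leaves `P` after one application of `D 0`, so it is not in the stable core;
    -- the other `f i` are killed by `D 0` and stay in it. The core is thus a smaller prime to which
    -- induction applies, and no commutation of the derivations is needed.
    have hlt : P.stableCore (D 0) < P := by
      refine lt_of_le_of_ne hle fun h => hΔ ?_
      have h1 : f 0 ∈ P.stableCore (D 0) := by rw [h]; exact hf 0
      simpa [hD] using h1 1
    have h2 : (r : ℕ∞) ≤ (P.stableCore (D 0)).height := by
      refine ih _ (fun i => D i.succ) (fun i => f i.succ) (fun i n => ?_) (fun h => hΔ (hle h))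
        fun i j => by simp [hD]
      cases n with
      | zero => exact hf _
      | succ n =>
        rw [Function.iterate_succ_apply, hD, if_neg (Fin.succ_ne_zero i).symm, iterate_map_zero]
        exact P.zero_mem
    calc ((r + 1 : ℕ) : ℕ∞) = r + 1 := by push_cast; rfl
      _ ≤ (P.stableCore (D 0)).height + 1 := by gcongr
      _ ≤ P.height := Ideal.height_add_one_le_of_lt_of_isPrime hlt

/-- Jacobian criterion: if the matrix of the values modulo `P` of the derivations `D s` at the
elements of the prime ideal `P` has trivial kernel, then `P` has height at least `|S|`. -/
theorem Ideal.card_le_height_of_derivations {A S : Type*} [CommRing A] [Algebra ℚ A] [Fintype S]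
    (P : Ideal A) [P.IsPrime] (D : S → Derivation ℤ A A)
    (h : ∀ ξ : S → A ⧸ P,
      (∀ f ∈ P, ∑ s, ξ s * Ideal.Quotient.mk P (D s f) = 0) → ξ = 0) :
    (Fintype.card S : ℕ∞) ≤ P.height := by
  classical
  let K := FractionRing (A ⧸ P)
  let row : P → S → K := fun f s => algebraMap (A ⧸ P) K (Ideal.Quotient.mk P (D s f))
  -- A linear functional vanishing on all rows would, after clearing denominators, give a nonzero
  -- `ξ` excluded by `h`.
  have hspan : Submodule.span K (Set.range row) = ⊤ := by
    by_contra hne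
    obtain ⟨φ, hφ0, hφ⟩ := Submodule.exists_le_ker_of_lt_top _ (lt_top_iff_ne_top.mpr hne)
    obtain ⟨b, hb⟩ := IsLocalization.exist_integer_multiples_of_finset (nonZeroDivisors (A ⧸ P))
      (Finset.univ.image fun s => φ (Pi.single s 1))
    have hb' : ∀ s, ∃ c : A ⧸ P, algebraMap _ K c = algebraMap _ K (b : A ⧸ P) * φ (Pi.single s 1) := by
      intro s
      obtain ⟨c, hc⟩ := hb _ (Finset.mem_image_of_mem _ (Finset.mem_univ s))
      exact ⟨c, by rw [hc, Algebra.smul_def]⟩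
    choose ξ hξ using hb'
    have hφv : ∀ v : S → K, φ v = ∑ s, v s * φ (Pi.single s 1) := by
      intro v
      conv_lhs => rw [← Finset.univ_sum_single v]
      rw [map_sum]
      refine Finset.sum_congr rfl fun s _ => ?_
      rw [← smul_eq_mul, ← map_smul]
      congr 1
      ext t
      by_cases hst : t = s
      · subst hst; simp
      · simp [hst]
    have hξ0 := h ξ fun f hf => by
      apply IsFractionRing.injective (A ⧸ P) K
      have h1 : φ (row ⟨f, hf⟩) = 0 := hφ (Submodule.subset_span ⟨_, rfl⟩)
      rw [hφv] at h1
      rw [map_sum, map_zero, ← mul_zero (algebraMap (A ⧸ P) K (b : A ⧸ P)), ← h1, Finset.mul_sum]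
      refine Finset.sum_congr rfl fun s _ => ?_
      rw [map_mul, hξ]
      ring
    apply hφ0
    refine LinearMap.ext fun v => ?_
    rw [hφv, LinearMap.zero_apply]
    refine Finset.sum_eq_zero fun s _ => ?_
    have h2 := hξ s
    rw [hξ0] at h2
    have h3 : algebraMap (A ⧸ P) K (b : A ⧸ P) ≠ 0 :=
      IsFractionRing.to_map_ne_zero_of_mem_nonZeroDivisors b.2
    rw [Pi.zero_apply, map_zero, eq_comm, mul_eq_zero] at h2
    rw [h2.resolve_left h3, mul_zero]
  obtain ⟨κ, a, ha, hsp, hli⟩ := exists_linearIndependent' K row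
  let bas : Module.Basis κ K (S → K) := Module.Basis.mk hli (by rw [hsp, hspan])
  have : Fintype κ := FiniteDimensional.fintypeBasisIndex bas
  have hcard : Fintype.card S = Fintype.card κ := by
    rw [← Module.finrank_eq_card_basis bas, Module.finrank_fintype_fun_eq_card]
  let e : S ≃ κ := Fintype.equivOfCardEq hcard
  let e' := Fintype.equivFin S
  let F : S → A := fun s => (a (e s) : P)
  let M : Matrix S S A := fun i j => D i (F j)
  have hM : M.det ∉ P := by
    intro hdet
    have h1 : ((M.map (Ideal.Quotient.mk P)).map (algebraMap (A ⧸ P) K)).det = 0 := by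
      have h4 : (algebraMap (A ⧸ P) K) ((Ideal.Quotient.mk P) M.det) = 0 := by
        rw [Ideal.Quotient.eq_zero_iff_mem.mpr hdet, map_zero]
      rw [RingHom.map_det, RingHom.map_det] at h4
      exact h4
    rw [← Matrix.det_transpose] at h1
    have h2 : LinearIndependent K (fun j : S => row (a (e j))) := hli.comp e e.injective
    have h3 := Matrix.linearIndependent_rows_iff_isUnit
      (A := ((M.map (Ideal.Quotient.mk P)).map (algebraMap (A ⧸ P) K)).transpose)
    have h5 := (Matrix.isUnit_iff_isUnit_det _).mp (h3.mp h2)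
    rw [h1] at h5
    exact not_isUnit_zero h5
  -- Multiplying by the adjugate of a nonsingular square minor `M` diagonalises the derivations,
  -- with `M.det ∉ P` on the diagonal.
  refine Ideal.le_height_of_derivation_diagonal M.det (Fintype.card S) P
    (fun i => ∑ s, M.adjugate (e'.symm i) s • D s) (fun j => F (e'.symm j))
    (fun i => (a (e _)).2) hM fun i j => ?_
  have h1 : (∑ s, M.adjugate (e'.symm i) s • D s) (F (e'.symm j))
      = (M.adjugate * M) (e'.symm i) (e'.symm j) := by
    rw [Matrix.mul_apply, ← Derivation.coeFnAddMonoidHom_apply, map_sum, Finset.sum_apply]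
    rfl
  rw [h1, Matrix.adjugate_mul, Matrix.smul_apply, Matrix.one_apply, smul_eq_mul]
  simp [e'.symm.injective.eq_iff]

/-! ### Primes missing `v` and their heights -/

/-- If `v` is a nonzerodivisor modulo `I` and `I` is contained in the proper ideal generated by `v`
and a finite set `B`, then some prime ideal over `I` missing `v` has height at most `|B|`. -/
theorem Ideal.exists_isPrime_height_le_card {A : Type*} [CommRing A] [IsNoetherianRing A]
    (I : Ideal A) (v : A) (hv : ∀ a, v * a ∈ I → a ∈ I) (B : Finset A)
    (hB : Ideal.span (insert v (B : Set A)) ≠ ⊤) (hI : I ≤ Ideal.span (insert v (B : Set A))) :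
    ∃ P : Ideal A, P.IsPrime ∧ I ≤ P ∧ v ∉ P ∧ P.height ≤ B.card := by
  classical
  obtain ⟨q, hq⟩ := Ideal.nonempty_minimalPrimes hB
  have hqp : q.IsPrime := hq.1.1
  have hJq : Ideal.span (insert v (B : Set A)) ≤ q := hq.1.2
  have hvq : v ∈ q := hJq (Ideal.subset_span (Set.mem_insert _ _))
  have hpow : ∀ (n : ℕ) (a : A), v ^ n * a ∈ I → a ∈ I := by
    intro n
    induction n with
    | zero => intro a ha; simpa using ha
    | succ n ih => intro a ha; exact ih a (hv _ (by rwa [← mul_assoc, ← pow_succ']))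
  -- Avoiding both the powers of `v` and the complement of `q` yields a prime `P` contained in `q`
  -- that misses `v`. As `v ∈ q`, the inclusion is strict, which saves one in Krull's bound `|B| +
  -- 1` for the height of `q`.
  have hdisj : Disjoint (I : Set A) (Submonoid.powers v ⊔ q.primeCompl : Submonoid A) := by
    rw [Set.disjoint_left]
    intro a haI ha
    obtain ⟨x, ⟨n, rfl⟩, u, hu, rfl⟩ := Submonoid.mem_sup.mp ha
    exact hu (hJq (hI (hpow n u haI)))
  obtain ⟨P, hP, hIP, hPd⟩ := Ideal.exists_le_prime_disjoint I _ hdisj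
  rw [Set.disjoint_left] at hPd
  have hvP : v ∉ P := fun h => hPd h (Submonoid.mem_sup_left (Submonoid.mem_powers v))
  have hPq : P ≤ q := fun a ha => by
    by_contra hc
    exact hPd ha (Submonoid.mem_sup_right hc)
  have hlt : P < q := lt_of_le_of_ne hPq fun h => hvP (h ▸ hvq)
  refine ⟨P, hP, hIP, hvP, ?_⟩
  have h1 := Ideal.height_add_one_le_of_lt_of_isPrime hlt
  have h2 : q.height ≤ (insert v B).card := by
    refine Ideal.height_le_card_of_mem_minimalPrimes_span_finset ?_
    simpa using hq
  have h3 : P.height + 1 ≤ B.card + 1 := by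
    refine (h1.trans h2).trans ?_
    exact_mod_cast Finset.card_insert_le v B
  exact (ENat.add_le_add_iff_right ENat.one_ne_top).mp h3

/-! ### Weights and balanced points over a valued field -/

/-- The numerical data of a plane branch: generators `β`, the `n_{k+1}` and the exponents `b`. -/
structure WeightData (g : ℕ) where
  /-- the weights -/
  β : Fin (g + 1) → ℕ
  /-- the exponents of the leading powers -/
  n : Fin g → ℕ
  /-- the exponents of the leading monomials -/
  b : Fin g → Fin (g + 1) → ℕ
  pos : ∀ i, 0 < β i
  two_le : ∀ k, 2 ≤ n k
  b_eq_zero : ∀ k j, k.castSucc < j → b k j = 0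
  b_sum : ∀ k, n k * β k.succ = ∑ j, b k j * β j
  lt_next : ∀ k k' : Fin g, (k' : ℕ) = k + 1 → n k * β k.succ < β k'.succ

/-- The monomial `x ^ γ`. -/
def monomialEval {ι R : Type*} [Fintype ι] [CommMonoid R] (x : ι → R) (γ : ι → ℕ) : R :=
  ∏ j, x j ^ γ j

/-- The weight of an exponent. -/
def WeightData.wt {g : ℕ} (W : WeightData g) (γ : Fin (g + 1) → ℕ) : ℕ := ∑ j, γ j * W.β j

theorem Finset.prod_pow_le_pow_sum {Γ₀ ι : Type*} [LinearOrderedCommGroupWithZero Γ₀]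
    (s : Finset ι) (y : ι → Γ₀) (w : ι → ℕ) {θ : Γ₀} (h : ∀ j ∈ s, y j ≤ θ) :
    ∏ j ∈ s, y j ^ w j ≤ θ ^ ∑ j ∈ s, w j := by
  rw [← Finset.prod_pow_eq_pow_sum]
  exact Finset.prod_le_prod' fun j hj => pow_le_pow_left' (h j hj) _

theorem Finset.eq_of_prod_pow_eq_pow_sum {Γ₀ ι : Type*} [LinearOrderedCommGroupWithZero Γ₀]
    (s : Finset ι) (y : ι → Γ₀) (w : ι → ℕ) {θ : Γ₀} (h0 : θ ≠ 0) (h : ∀ j ∈ s, y j ≤ θ)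
    (he : ∏ j ∈ s, y j ^ w j = θ ^ ∑ j ∈ s, w j) {i : ι} (hi : i ∈ s) (hw : w i ≠ 0) :
    y i = θ := by
  classical
  refine le_antisymm (h i hi) ?_
  by_contra! hlt
  refine absurd he (ne_of_lt ?_)
  rw [← Finset.mul_prod_erase _ _ hi, ← Finset.add_sum_erase _ _ hi, pow_add]
  have h1 : y i ^ w i < θ ^ w i := pow_lt_pow_left₀ hlt zero_le hw
  have h2 := Finset.prod_pow_le_pow_sum (s.erase i) y w
    fun j hj => h j (Finset.mem_of_mem_erase hj)
  have h3 : 0 < θ ^ ∑ j ∈ s.erase i, w j := zero_lt_iff.mpr (pow_ne_zero _ h0)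
  calc _ ≤ y i ^ w i * θ ^ ∑ j ∈ s.erase i, w j := by gcongr
    _ < _ := by gcongr

theorem Valuation.map_monomialEval {Γ₀ ι L : Type*} [Fintype ι] [LinearOrderedCommGroupWithZero Γ₀]
    [CommRing L] (ν : Valuation L Γ₀) (x : ι → L) (γ : ι → ℕ) :
    ν (monomialEval x γ) = ∏ j, ν (x j) ^ γ j := by
  simp [monomialEval]

section Balance

variable {g : ℕ} (W : WeightData g) {L Γ₀ : Type*} [CommRing L]
  [LinearOrderedCommGroupWithZero Γ₀] (ν : Valuation L Γ₀)

/-- All `x_i` have valuation exactly proportional to their weight. -/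
structure IsBalanced (x : Fin (g + 1) → L) : Prop where
  ne_zero : ∀ i, ν (x i) ≠ 0
  pow_eq : ∀ i j, ν (x i) ^ W.β j = ν (x j) ^ W.β i
  lead_eq : ∀ k, ν (monomialEval x (W.b k)) = ν (x k.succ) ^ W.n k
  lt_of_wt : ∀ k γ, W.n k * W.β k.succ < W.wt γ → ν (monomialEval x γ) < ν (x k.succ) ^ W.n k

/-- The right-hand sides of the equations: the terms of higher weight. -/
def higherTerms (x : Fin (g + 1) → L) (v : L) (Γ : Fin g → Finset (Fin (g + 1) → ℕ))
    (h : Fin g → (Fin (g + 1) → ℕ) → L) (k : Fin g) : L :=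
  ∑ γ ∈ Γ k, h k γ * monomialEval x γ + v * nextEntry x k

/-- Balancing: elements satisfying equations with leading binomials
`x_{k+1} ^ n_k - c_k x ^ b_k` up to an error `ε` are balanced or small. -/
theorem isBalanced_or_le (hg : 0 < g) (x : Fin (g + 1) → L) (hx : ∀ i, ν (x i) < 1)
    (c : Fin g → L) (hc : ∀ k, ν (c k) = 1) (v : L) (hv : ν v ≤ 1)
    (Γ : Fin g → Finset (Fin (g + 1) → ℕ)) (hΓ : ∀ k, ∀ γ ∈ Γ k, W.n k * W.β k.succ < W.wt γ)
    (h : Fin g → (Fin (g + 1) → ℕ) → L) (hh : ∀ k γ, ν (h k γ) ≤ 1) (ε : Γ₀)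
    (heq : ∀ k, ν (x k.succ ^ W.n k - c k * monomialEval x (W.b k) - higherTerms x v Γ h k) ≤ ε) :
    (∃ k, ∀ i, ν (x i) ^ (W.n k * W.β k.succ) ≤ ε ^ W.β i) ∨
    (IsBalanced W ν x ∧ ∀ k, ε < ν (x k.succ) ^ W.n k) := by
  classical
  set B := ∏ j, W.β j with hB
  have hBpos : 0 < B := Finset.prod_pos fun j _ => W.pos j
  -- Raising to `C i = B / β i` replaces the root `ν (x i) ^ (1 / β i)`, which need not exist. The
  -- maximum `θ` of the `y i` then belongs to the coordinate of smallest order relative to its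
  -- weight, and a monomial of weight `d` satisfies `ν ^ B ≤ θ ^ d`.
  set C : Fin (g + 1) → ℕ := fun i => ∏ j ∈ Finset.univ.erase i, W.β j with hC
  have hCB : ∀ i, C i * W.β i = B := fun i =>
    (Finset.prod_erase_mul _ _ (Finset.mem_univ i))
  have hCpos : ∀ i, 0 < C i := fun i => Finset.prod_pos fun j _ => W.pos j
  set y : Fin (g + 1) → Γ₀ := fun i => ν (x i) ^ C i with hy
  have hyB : ∀ i, ν (x i) ^ B = y i ^ W.β i := fun i => by rw [hy, ← pow_mul, hCB]
  obtain ⟨i0, -, hi0⟩ := Finset.exists_max_image Finset.univ y Finset.univ_nonempty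
  set θ := y i0 with hθ
  have hle : ∀ i, y i ≤ θ := fun i => hi0 i (Finset.mem_univ i)
  have hθ1 : θ < 1 := pow_lt_one₀ zero_le (hx i0) (hCpos i0).ne'
  clear_value θ y
  have hmonB : ∀ γ : Fin (g + 1) → ℕ,
      ν (monomialEval x γ) ^ B = ∏ j, y j ^ (γ j * W.β j) := by
    intro γ
    rw [Valuation.map_monomialEval, ← Finset.prod_pow]
    refine Finset.prod_congr rfl fun j _ => ?_
    rw [← pow_mul, mul_comm, pow_mul, hyB, ← pow_mul, mul_comm]
  have hmonle : ∀ γ : Fin (g + 1) → ℕ, ν (monomialEval x γ) ^ B ≤ θ ^ W.wt γ := fun γ => by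
    rw [hmonB]
    exact Finset.prod_pow_le_pow_sum _ _ _ fun j _ => hle j
  by_cases hA : ∃ k, θ ^ (W.n k * W.β k.succ) ≤ ε ^ B
  · obtain ⟨k, hk⟩ := hA
    refine Or.inl ⟨k, fun i => ?_⟩
    refine le_of_pow_le_pow_left₀ hBpos.ne' zero_le ?_
    calc (ν (x i) ^ (W.n k * W.β k.succ)) ^ B
        = (y i ^ (W.n k * W.β k.succ)) ^ W.β i := by
          rw [← pow_mul, mul_comm _ B, pow_mul, hyB, ← pow_mul, ← pow_mul, mul_comm (W.β i)]
      _ ≤ (θ ^ (W.n k * W.β k.succ)) ^ W.β i := by gcongr; exact hle i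
      _ ≤ (ε ^ B) ^ W.β i := by gcongr
      _ = (ε ^ W.β i) ^ B := by rw [← pow_mul, ← pow_mul, mul_comm]
  -- From here the error `ε` is negligible against terms of weight `n_k β_{k+1}` at scale `θ`. So
  -- are the higher terms, including `v x_{k+2}` because `n_k β_{k+1} < β_{k+2}`.
  push Not at hA
  have hθ0 : θ ≠ 0 := by
    intro h0
    have h1 := hA ⟨0, hg⟩
    rw [h0, zero_pow (by have := W.two_le ⟨0, hg⟩; have := W.pos (Fin.succ ⟨0, hg⟩); positivity)] at h1
    exact not_lt_zero h1
  have hθpow : ∀ {a b : ℕ}, a < b → θ ^ b < θ ^ a := fun hab =>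
    pow_lt_pow_right_of_lt_one₀ (zero_lt_iff.mpr hθ0) hθ1 hab
  have hmonlt : ∀ (γ : Fin (g + 1) → ℕ) {N : ℕ}, N < W.wt γ →
      ν (monomialEval x γ) ^ B < θ ^ N := fun γ N hN => (hmonle γ).trans_lt (hθpow hN)
  have hrest : ∀ k, ν (higherTerms x v Γ h k) ^ B < θ ^ (W.n k * W.β k.succ) := by
    intro k
    have hT : ∀ a b : L, ν a ^ B < θ ^ (W.n k * W.β k.succ) →
        ν b ^ B < θ ^ (W.n k * W.β k.succ) → ν (a + b) ^ B < θ ^ (W.n k * W.β k.succ) := by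
      intro a b ha hb
      rcases le_max_iff.mp (ν.map_add a b) with h1 | h1
      · exact (pow_le_pow_left' h1 _).trans_lt ha
      · exact (pow_le_pow_left' h1 _).trans_lt hb
    have h0 : ν 0 ^ B < θ ^ (W.n k * W.β k.succ) := by
      rw [map_zero, zero_pow hBpos.ne']
      exact zero_lt_iff.mpr (pow_ne_zero _ hθ0)
    have hs : ∀ a b : L, ν a ≤ 1 → ν b ^ B < θ ^ (W.n k * W.β k.succ) →
        ν (a * b) ^ B < θ ^ (W.n k * W.β k.succ) := by
      intro a b ha hb
      refine lt_of_le_of_lt (pow_le_pow_left' ?_ _) hb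
      rw [map_mul]
      exact mul_le_of_le_one_left' ha
    refine hT _ _ ?_ (hs _ _ hv ?_)
    · exact Finset.sum_induction _ (fun a => ν a ^ B < θ ^ (W.n k * W.β k.succ)) hT h0
        fun γ hγ => hs _ _ (hh k γ) (hmonlt γ (hΓ k γ hγ))
    · unfold nextEntry
      split_ifs with hk
      · rw [hyB]
        refine (pow_le_pow_left' (hle _) _).trans_lt (hθpow ?_)
        exact W.lt_next k ⟨k + 1, by omega⟩ rfl
      · exact h0
  have hdiff : ∀ k, ν (x k.succ ^ W.n k - c k * monomialEval x (W.b k)) ^ B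
      < θ ^ (W.n k * W.β k.succ) := by
    intro k
    have h1 := heq k
    have h2 : x k.succ ^ W.n k - c k * monomialEval x (W.b k) =
      (x k.succ ^ W.n k - c k * monomialEval x (W.b k) - higherTerms x v Γ h k) +
        higherTerms x v Γ h k := by ring
    rw [h2]
    rcases le_max_iff.mp (ν.map_add (x k.succ ^ W.n k - c k * monomialEval x (W.b k)
      - higherTerms x v Γ h k) (higherTerms x v Γ h k)) with h3 | h3
    · exact (pow_le_pow_left' (h3.trans h1) _).trans_lt (hA k)
    · exact (pow_le_pow_left' h3 _).trans_lt (hrest k)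
  have hcm : ∀ k, ν (c k * monomialEval x (W.b k)) = ν (monomialEval x (W.b k)) := fun k => by
    rw [map_mul, hc, one_mul]
  have hlead : ∀ k, ν (x k.succ ^ W.n k) ^ B = y k.succ ^ (W.n k * W.β k.succ) := fun k => by
    rw [map_pow, ← pow_mul, mul_comm, pow_mul, hyB, ← pow_mul, mul_comm]
  -- As their difference is strictly below the maximal possible size, the two monomials of the
  -- binomial have the same valuation as soon as one of them attains it.
  have hiff : ∀ k, ν (x k.succ ^ W.n k) ^ B = θ ^ (W.n k * W.β k.succ) ∨
      ν (monomialEval x (W.b k)) ^ B = θ ^ (W.n k * W.β k.succ) →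
      ν (x k.succ ^ W.n k) = ν (monomialEval x (W.b k)) := by
    intro k hk
    rw [← hcm k] at hk ⊢
    have h1 := hdiff k
    rcases hk with hk | hk <;> rw [← hk] at h1
    · have h2 := lt_of_pow_lt_pow_left₀ B zero_le h1
      rw [Valuation.map_sub_swap] at h2
      exact (Valuation.map_eq_of_sub_lt _ h2).symm
    · exact Valuation.map_eq_of_sub_lt _ (lt_of_pow_lt_pow_left₀ B zero_le h1)
  -- Extremality passes from `x_{k+1}` to every variable of the monomial `b k`, all of smaller
  -- index, hence down to `x_0`; `hup` then carries it back up to all coordinates.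
  have hdown : ∀ k, y k.succ = θ → ∀ j, W.b k j ≠ 0 → y j = θ := by
    intro k hk j hj
    have h1 := hiff k (Or.inl (by rw [hlead, hk]))
    have h2 : ν (monomialEval x (W.b k)) ^ B = θ ^ (W.n k * W.β k.succ) := by
      rw [← h1, hlead, hk]
    rw [hmonB, W.b_sum] at h2
    exact Finset.eq_of_prod_pow_eq_pow_sum _ _ _ hθ0 (fun j _ => hle j) h2 (Finset.mem_univ j)
      (mul_ne_zero hj (W.pos j).ne')
  have hpow_inj : ∀ {a b : Γ₀} {N : ℕ}, N ≠ 0 → a ^ N = b ^ N → a = b := fun hN he =>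
    (pow_left_inj₀ zero_le zero_le hN).mp he
  have hup : ∀ k, (∀ j, W.b k j ≠ 0 → y j = θ) → y k.succ = θ := by
    intro k hk
    have h2 : ν (monomialEval x (W.b k)) ^ B = θ ^ (W.n k * W.β k.succ) := by
      rw [hmonB, W.b_sum, ← Finset.prod_pow_eq_pow_sum]
      refine Finset.prod_congr rfl fun j _ => ?_
      by_cases hj : W.b k j = 0
      · simp [hj]
      · rw [hk j hj]
    have h1 := hiff k (Or.inr h2)
    have h3 : y k.succ ^ (W.n k * W.β k.succ) = θ ^ (W.n k * W.β k.succ) := by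
      rw [← hlead, h1, h2]
    refine hpow_inj ?_ h3
    have := W.two_le k
    have := W.pos k.succ
    positivity
  have hexists : ∀ k, ∃ j, W.b k j ≠ 0 := by
    intro k
    by_contra! hc
    have h1 := W.b_sum k
    simp only [hc, zero_mul, Finset.sum_const_zero] at h1
    have := W.two_le k
    have := W.pos k.succ
    have : 0 < W.n k * W.β k.succ := by positivity
    omega
  have hzero : ∀ (N : ℕ) (i : Fin (g + 1)), (i : ℕ) ≤ N → y i = θ → y 0 = θ := by
    intro N
    induction N with
    | zero => intro i hi h1; rwa [show i = 0 from Fin.ext (by simpa using hi)] at h1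
    | succ N ih =>
      intro i hi h1
      rcases Fin.eq_zero_or_eq_succ i with rfl | ⟨k, rfl⟩
      · exact h1
      · obtain ⟨j, hj⟩ := hexists k
        refine ih j ?_ (hdown k h1 j hj)
        have h2 : ¬ k.castSucc < j := fun h2 => hj (W.b_eq_zero k j h2)
        rw [Fin.lt_def] at h2
        simp at h2 hi
        omega
  have h0 : y 0 = θ := hzero _ i0 le_rfl hθ.symm
  have hall : ∀ (N : ℕ) (i : Fin (g + 1)), (i : ℕ) ≤ N → y i = θ := by
    intro N
    induction N with
    | zero => intro i hi; rwa [show i = 0 from Fin.ext (by simpa using hi)]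
    | succ N ih =>
      intro i hi
      rcases Fin.eq_zero_or_eq_succ i with rfl | ⟨k, rfl⟩
      · exact h0
      · refine hup k fun j hj => ih j ?_
        have h2 : ¬ k.castSucc < j := fun h2 => hj (W.b_eq_zero k j h2)
        rw [Fin.lt_def] at h2
        simp at h2 hi
        omega
  have hy' : ∀ i, y i = θ := fun i => hall _ i le_rfl
  have hxB : ∀ i, ν (x i) ^ B = θ ^ W.β i := fun i => by rw [hyB, hy']
  have hxn : ∀ k, (ν (x k.succ) ^ W.n k) ^ B = θ ^ (W.n k * W.β k.succ) := fun k => by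
    rw [← map_pow, hlead, hy']
  refine Or.inr ⟨⟨fun i h0 => ?_, fun i j => ?_, fun k => ?_, fun k γ hγ => ?_⟩, fun k => ?_⟩
  · have h1 := hxB i
    rw [h0, zero_pow hBpos.ne'] at h1
    exact pow_ne_zero _ hθ0 h1.symm
  · refine hpow_inj hBpos.ne' ?_
    rw [← pow_mul, mul_comm _ B, pow_mul, hxB, ← pow_mul, ← pow_mul, mul_comm _ B,
      pow_mul (ν (x j)), hxB, ← pow_mul, mul_comm (W.β i)]
  · rw [← map_pow]
    exact (hiff k (Or.inl (by rw [hlead, hy']))).symm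
  · exact lt_of_pow_lt_pow_left₀ B zero_le (by rw [hxn]; exact hmonlt γ hγ)
  · exact lt_of_pow_lt_pow_left₀ B zero_le (by rw [hxn]; exact hA k)

end Balance

/-- The derivative `x ^ γ ∑ γ_j ξ_j / x_j` of the monomial `x ^ γ` in the direction `ξ`. -/
noncomputable def monomialDeriv {ι L : Type*} [Fintype ι] [Field L] (x ξ : ι → L) (γ : ι → ℕ) : L :=
  monomialEval x γ * ∑ j, (γ j : L) * (ξ j / x j)

/-- At a balanced point the linearised equations are nondegenerate: the smallest direction of
maximal relative valuation dominates its row. -/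
theorem IsBalanced.exists_row_eq {g : ℕ} {W : WeightData g} {L Γ₀ : Type*} [Field L]
    [LinearOrderedCommGroupWithZero Γ₀] {ν : Valuation L Γ₀} {x : Fin (g + 1) → L}
    (hx : IsBalanced W ν x) (hν : ∀ m : ℕ, m ≠ 0 → ν (m : L) = 1)
    (c : Fin g → L) (hc : ∀ k, ν (c k) = 1) (v : L) (hv : ν v ≤ 1)
    (Γ : Fin g → Finset (Fin (g + 1) → ℕ)) (hΓ : ∀ k, ∀ γ ∈ Γ k, W.n k * W.β k.succ < W.wt γ)
    (h : Fin g → (Fin (g + 1) → ℕ) → L) (hh : ∀ k γ, ν (h k γ) ≤ 1)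
    (ξ : Fin (g + 1) → L) (hξ0 : ξ 0 = 0) (hξ : ξ ≠ 0) :
    ∃ k : Fin g, ξ k.succ ≠ 0 ∧
      ν ((W.n k : L) * x k.succ ^ (W.n k - 1) * ξ k.succ - c k * monomialDeriv x ξ (W.b k)
        - (∑ γ ∈ Γ k, h k γ * monomialDeriv x ξ γ + v * nextEntry ξ k))
      = ν (x k.succ ^ (W.n k - 1) * ξ k.succ) := by
  classical
  have hx0 : ∀ i, x i ≠ 0 := fun i h0 => hx.ne_zero i (by rw [h0, map_zero])
  set η : Fin (g + 1) → L := fun j => ξ j / x j with hη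
  have hξη : ∀ j, ξ j = x j * η j := fun j => by rw [hη]; field_simp [hx0 j]
  obtain ⟨i0, -, hi0⟩ := Finset.exists_max_image Finset.univ (fun j => ν (η j))
    Finset.univ_nonempty
  set ρ := ν (η i0) with hρ
  have hle : ∀ j, ν (η j) ≤ ρ := fun j => hi0 j (Finset.mem_univ j)
  have hρ0 : ρ ≠ 0 := by
    intro h0
    apply hξ
    ext j
    have h1 := hle j
    rw [h0] at h1
    have h2 : η j = 0 := (map_eq_zero ν).mp (le_zero_iff.mp h1)
    rw [hξη, h2, mul_zero, Pi.zero_apply]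
  -- Among the relative directions `ξ j / x j` of maximal valuation the least index `i = k + 1` is
  -- chosen: the monomial `b k` involves only smaller indices, so its derivative is strictly
  -- dominated. Higher terms are dominated because their monomials are. The index is not `0` since
  -- `ξ 0 = 0`.
  obtain ⟨i, hi, hmin⟩ := Finset.exists_min_image
    (Finset.univ.filter fun j => ν (η j) = ρ) id ⟨i0, by simp [hρ]⟩
  have hi' : ν (η i) = ρ := by simpa using hi
  have hlt : ∀ j, j < i → ν (η j) < ρ := fun j hj =>
    lt_of_le_of_ne (hle j) fun he => absurd (hmin j (by simpa using he)) (not_le.mpr hj)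
  have hine : i ≠ 0 := by
    rintro rfl
    apply hρ0
    rw [← hi', hη]
    simp [hξ0]
  obtain ⟨k, rfl⟩ := Fin.exists_succ_eq.mpr hine
  have hnat : ∀ m : ℕ, ν (m : L) ≤ 1 := fun m => by
    rcases eq_or_ne m 0 with rfl | hm
    · simp
    · exact (hν m hm).le
  have hηk : η k.succ ≠ 0 := fun h0 => hρ0 (by rw [← hi', h0, map_zero])
  have hn0 : W.n k ≠ 0 := by have := W.two_le k; omega
  set r := ν (x k.succ) ^ W.n k * ρ with hr
  have hr0 : r ≠ 0 := mul_ne_zero (pow_ne_zero _ (hx.ne_zero _)) hρ0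
  have hmain : ν (x k.succ ^ (W.n k - 1) * ξ k.succ) = r := by
    rw [hξη, ← mul_assoc, ← pow_succ, Nat.sub_add_cancel (Nat.one_le_iff_ne_zero.mpr hn0), map_mul,
      map_pow, hi']
  have hmain' : ν ((W.n k : L) * x k.succ ^ (W.n k - 1) * ξ k.succ) = r := by
    rw [mul_assoc, map_mul, hν _ hn0, one_mul, hmain]
  have hsum : ∀ γ : Fin (g + 1) → ℕ, ν (∑ j, (γ j : L) * (ξ j / x j)) ≤ ρ := by
    intro γ
    refine ν.map_sum_le fun j _ => ?_
    rw [map_mul]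
    exact (mul_le_of_le_one_left' (hnat _)).trans (hle j)
  have h1 : ν (c k * monomialDeriv x ξ (W.b k)) < r := by
    rw [map_mul, hc, one_mul, monomialDeriv, map_mul, hx.lead_eq]
    refine mul_lt_mul_of_pos_left ?_ (zero_lt_iff.mpr (pow_ne_zero _ (hx.ne_zero _)))
    refine ν.map_sum_lt hρ0 fun j _ => ?_
    rcases eq_or_ne (W.b k j) 0 with hb | hb
    · rw [hb]; simpa using zero_lt_iff.mpr hρ0
    · have h2 : ¬ k.castSucc < j := fun h2 => hb (W.b_eq_zero k j h2)
      rw [map_mul, hν _ hb, one_mul]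
      refine hlt j ?_
      rw [Fin.lt_def] at h2 ⊢
      simp at h2 ⊢
      omega
  have h2 : ν (∑ γ ∈ Γ k, h k γ * monomialDeriv x ξ γ) < r := by
    refine ν.map_sum_lt hr0 fun γ hγ => ?_
    rw [map_mul, monomialDeriv, map_mul]
    refine (mul_le_of_le_one_left' (hh k γ)).trans_lt ?_
    calc _ ≤ ν (monomialEval x γ) * ρ := mul_le_mul_right (hsum γ) _
      _ < r := mul_lt_mul_of_pos_right (hx.lt_of_wt k γ (hΓ k γ hγ)) (zero_lt_iff.mpr hρ0)
  have h3 : ν (v * nextEntry ξ k) < r := by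
    rw [map_mul]
    refine (mul_le_of_le_one_left' hv).trans_lt ?_
    unfold nextEntry
    split_ifs with hk
    · rw [hξη, map_mul]
      have h4 := hx.lt_of_wt k (Pi.single ⟨(k : ℕ) + 2, hk⟩ 1) (by
        rw [WeightData.wt, Finset.sum_eq_single ⟨(k : ℕ) + 2, hk⟩]
        · rw [Pi.single_eq_same, one_mul]
          exact W.lt_next k ⟨k + 1, by omega⟩ rfl
        · intro j _ hj
          rw [Pi.single_eq_of_ne hj, zero_mul]
        · simp)
      have h5 : monomialEval x (Pi.single ⟨(k : ℕ) + 2, hk⟩ 1) = x ⟨(k : ℕ) + 2, hk⟩ := by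
        rw [monomialEval, Finset.prod_eq_single ⟨(k : ℕ) + 2, hk⟩]
        · simp
        · intro j _ hj
          rw [Pi.single_eq_of_ne hj, pow_zero]
        · simp
      rw [h5] at h4
      calc _ ≤ ν (x ⟨(k : ℕ) + 2, hk⟩) * ρ := mul_le_mul_right (hle _) _
        _ < r := mul_lt_mul_of_pos_right h4 (zero_lt_iff.mpr hρ0)
    · rw [map_zero]
      exact zero_lt_iff.mpr hr0
  refine ⟨k, by rw [hξη]; exact mul_ne_zero (hx0 _) hηk, ?_⟩
  rw [hmain, sub_sub, ← hmain']
  refine Valuation.map_sub_eq_of_lt_left _ ?_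
  rw [hmain']
  exact ν.map_add_lt h1 (ν.map_add_lt h2 h3)

/-! ### A valuation on power series over a local domain -/

/-- The composite of the valuation ring `V` of `K` with the valuation ring `K⟦X⟧`. -/
def ValuationSubring.compPowerSeries {K : Type*} [Field K] (V : ValuationSubring K) :
    ValuationSubring (FractionRing (PowerSeries K)) where
  carrier := {z | ∃ p : PowerSeries K, PowerSeries.constantCoeff p ∈ V ∧
    algebraMap (PowerSeries K) (FractionRing (PowerSeries K)) p = z}
  zero_mem' := ⟨0, by simp, by simp⟩
  one_mem' := ⟨1, by simp, by simp⟩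
  add_mem' := by
    rintro _ _ ⟨p, hp, rfl⟩ ⟨q, hq, rfl⟩
    exact ⟨p + q, by rw [map_add]; exact V.add_mem _ _ hp hq, map_add _ _ _⟩
  mul_mem' := by
    rintro _ _ ⟨p, hp, rfl⟩ ⟨q, hq, rfl⟩
    exact ⟨p * q, by rw [map_mul]; exact V.mul_mem _ _ hp hq, map_mul _ _ _⟩
  neg_mem' := by
    rintro _ ⟨p, hp, rfl⟩
    exact ⟨-p, by rw [map_neg]; exact V.neg_mem _ hp, map_neg _ _⟩
  -- One of `z`, `z⁻¹` lies in `K⟦X⟧`. If its constant coefficient is not in `V`, that coefficient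
  -- is nonzero with inverse in `V`, so the series is invertible and its inverse lies in the ring.
  mem_or_inv_mem' := by
    have key : ∀ p : PowerSeries K, PowerSeries.constantCoeff p ∈ V ∨
        ∃ q : PowerSeries K, PowerSeries.constantCoeff q ∈ V ∧ p * q = 1 := by
      intro p
      rcases V.mem_or_inv_mem (PowerSeries.constantCoeff p) with h | h
      · exact Or.inl h
      · by_cases h0 : PowerSeries.constantCoeff p = 0
        · exact Or.inl (by rw [h0]; exact V.zero_mem)
        · exact Or.inr ⟨p⁻¹, by rwa [PowerSeries.constantCoeff_inv],
            PowerSeries.mul_inv_cancel p h0⟩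
    intro z
    rcases ValuationRing.isInteger_or_isInteger (PowerSeries K) z with ⟨p, hp⟩ | ⟨p, hp⟩
    · rcases key p with h | ⟨q, hq, hpq⟩
      · exact Or.inl ⟨p, h, hp⟩
      · refine Or.inr ⟨q, hq, ?_⟩
        rw [← hp]
        exact eq_inv_of_mul_eq_one_right (by rw [← map_mul, hpq, map_one])
    · rcases key p with h | ⟨q, hq, hpq⟩
      · exact Or.inr ⟨p, h, hp⟩
      · refine Or.inl ⟨q, hq, ?_⟩
        rw [← inv_inv z, ← hp]
        exact eq_inv_of_mul_eq_one_right (by rw [← map_mul, hpq, map_one])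

/-- A power series ring over a local domain `T` carries a valuation that is centred at its maximal
ideal and for which the variable is infinitely small compared to `T`. -/
theorem exists_valuation_powerSeries (T : Type) [CommRing T] [IsDomain T] [IsLocalRing T] :
    ∃ (L : Type) (_ : Field L) (Γ₀ : Type) (_ : LinearOrderedCommGroupWithZero Γ₀)
      (ν : Valuation L Γ₀) (ι : PowerSeries T →+* L), Function.Injective ι ∧
      (∀ p, ν (ι p) ≤ 1) ∧
      (∀ p, PowerSeries.constantCoeff p ∈ IsLocalRing.maximalIdeal T → ν (ι p) < 1) ∧
      (∀ (p : PowerSeries T) (k : ℕ), ν (ι p) ≤ ν (ι PowerSeries.X) ^ k →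
        PowerSeries.X ^ k ∣ p) := by
  -- `V` dominates `T`, which centres the composite valuation at the maximal ideal. This makes the
  -- values of the `x i` strictly less than `1` even when their constant terms are nonzero in `T`.
  obtain ⟨V, hV, hloc⟩ := IsLocalRing.exists_factor_valuationRing
    (algebraMap T (FractionRing T))
  let K := FractionRing T
  let W := V.compPowerSeries
  let ι : PowerSeries T →+* FractionRing (PowerSeries K) :=
    (algebraMap (PowerSeries K) (FractionRing (PowerSeries K))).comp
      (PowerSeries.map (algebraMap T K))
  have hinj : Function.Injective ι := by
    rw [RingHom.coe_comp]
    exact (IsFractionRing.injective (PowerSeries K) _).comp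
      (PowerSeries.map_injective _ (IsFractionRing.injective T K))
  have hmem : ∀ p, ι p ∈ W := fun p => ⟨PowerSeries.map (algebraMap T K) p, by
    rw [← PowerSeries.coeff_zero_eq_constantCoeff_apply, PowerSeries.coeff_map]
    exact hV _, rfl⟩
  refine ⟨FractionRing (PowerSeries K), inferInstance, W.ValueGroup, inferInstance, W.valuation,
    ι, hinj, fun p => (W.valuation_le_one_iff _).mpr (hmem p), fun p hp => ?_, fun p k hp => ?_⟩
  · refine lt_of_le_of_ne ((W.valuation_le_one_iff _).mpr (hmem p)) fun h1 => ?_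
    have h2 : (ι p)⁻¹ ∈ W := by
      rw [← W.valuation_le_one_iff, map_inv₀, h1, inv_one]
    obtain ⟨q, hq, hqp⟩ := h2
    have h0 : ι p ≠ 0 := by
      intro h0
      rw [h0, map_zero] at h1
      exact zero_ne_one h1
    have h3 : PowerSeries.map (algebraMap T K) p * q = 1 := by
      apply IsFractionRing.injective (PowerSeries K) (FractionRing (PowerSeries K))
      rw [map_mul, hqp, map_one]
      exact mul_inv_cancel₀ h0
    have h4 := congrArg PowerSeries.constantCoeff h3
    rw [map_mul, map_one, ← PowerSeries.coeff_zero_eq_constantCoeff_apply, PowerSeries.coeff_map,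
      PowerSeries.coeff_zero_eq_constantCoeff_apply] at h4
    have h5 : IsUnit ((algebraMap T K).codRestrict V.toSubring hV (PowerSeries.constantCoeff p)) :=
      IsUnit.of_mul_eq_one ⟨_, hq⟩ (Subtype.ext h4)
    exact (IsLocalRing.mem_maximalIdeal _).mp hp (hloc.map_nonunit _ h5)
  · have hX : ι PowerSeries.X ≠ 0 := by
      rw [Ne, map_eq_zero_iff ι hinj]
      exact PowerSeries.X_ne_zero
    have h1 : ι p / ι PowerSeries.X ^ k ∈ W := by
      rw [← W.valuation_le_one_iff, map_div₀, map_pow]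
      exact div_le_one_of_le₀ hp zero_le
    obtain ⟨q, hq, hqp⟩ := h1
    have h2 : PowerSeries.map (algebraMap T K) p = q * PowerSeries.X ^ k := by
      apply IsFractionRing.injective (PowerSeries K) (FractionRing (PowerSeries K))
      rw [map_mul, hqp, map_pow]
      have h3 : algebraMap (PowerSeries K) (FractionRing (PowerSeries K)) PowerSeries.X
          = ι PowerSeries.X := by
        simp [ι]
      rw [h3, div_mul_cancel₀ _ (pow_ne_zero _ hX)]
      rfl
    rw [PowerSeries.X_pow_dvd_iff]
    intro j hj
    apply IsFractionRing.injective T K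
    rw [← PowerSeries.coeff_map, h2, map_zero, PowerSeries.coeff_mul_X_pow', if_neg (by omega)]

/-! ### Linearised equations and the alternative for jets -/

/-- The derivative of the monomial `x ^ γ` in the direction `ξ`. -/
def monomialDirDeriv {ι R : Type*} [Fintype ι] [DecidableEq ι] [CommRing R] (x ξ : ι → R)
    (γ : ι → ℕ) : R :=
  ∑ j, (γ j : R) * (monomialEval x (Function.update γ j (γ j - 1)) * ξ j)

theorem map_monomialEval {ι R S : Type*} [Fintype ι] [CommRing R] [CommRing S] (φ : R →+* S)
    (x : ι → R) (γ : ι → ℕ) : φ (monomialEval x γ) = monomialEval (fun i => φ (x i)) γ := by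
  simp [monomialEval]

theorem map_monomialDirDeriv {ι R S : Type*} [Fintype ι] [DecidableEq ι] [CommRing R] [CommRing S]
    (φ : R →+* S) (x ξ : ι → R) (γ : ι → ℕ) :
    φ (monomialDirDeriv x ξ γ) = monomialDirDeriv (fun i => φ (x i)) (fun i => φ (ξ i)) γ := by
  simp [monomialDirDeriv, map_monomialEval]

theorem monomialDirDeriv_eq_zero {ι R : Type*} [Fintype ι] [DecidableEq ι] [CommRing R]
    (x ξ : ι → R) (γ : ι → ℕ) (h : ∀ j, γ j ≠ 0 → ξ j = 0) : monomialDirDeriv x ξ γ = 0 := by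
  refine Finset.sum_eq_zero fun j _ => ?_
  rcases eq_or_ne (γ j) 0 with h0 | h0
  · simp [h0]
  · simp [h j h0]

theorem monomialEval_update_mul {ι R : Type*} [Fintype ι] [DecidableEq ι] [CommRing R]
    (x : ι → R) (γ : ι → ℕ) (j : ι) (hj : γ j ≠ 0) :
    monomialEval x (Function.update γ j (γ j - 1)) * x j = monomialEval x γ := by
  unfold monomialEval
  rw [← Finset.mul_prod_erase _ _ (Finset.mem_univ j), ← Finset.mul_prod_erase _ _ (Finset.mem_univ j),
    Function.update_self, Finset.prod_congr rfl (g := fun i => x i ^ γ i) fun i hi => by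
      rw [Function.update_of_ne (Finset.ne_of_mem_erase hi)], mul_right_comm, ← pow_succ,
    Nat.sub_add_cancel (Nat.one_le_iff_ne_zero.mpr hj)]

theorem monomialDirDeriv_eq_monomialDeriv {ι L : Type*} [Fintype ι] [DecidableEq ι] [Field L]
    (x ξ : ι → L) (hx : ∀ i, x i ≠ 0) (γ : ι → ℕ) :
    monomialDirDeriv x ξ γ = monomialDeriv x ξ γ := by
  unfold monomialDirDeriv monomialDeriv
  rw [Finset.mul_sum]
  refine Finset.sum_congr rfl fun j _ => ?_
  rcases eq_or_ne (γ j) 0 with h0 | h0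
  · simp [h0]
  · rw [← monomialEval_update_mul x γ j h0]
    field_simp [hx j]

theorem Derivation.map_monomialEval {ι k R : Type*} [Fintype ι] [DecidableEq ι] [CommRing k]
    [CommRing R] [Algebra k R] (D : Derivation k R R) (x : ι → R) (γ : ι → ℕ) :
    D (monomialEval x γ) = monomialDirDeriv x (fun i => D (x i)) γ := by
  have key : ∀ s : Finset ι, D (∏ i ∈ s, x i ^ γ i) =
      ∑ j ∈ s, (γ j : R) * ((∏ i ∈ s, x i ^ Function.update γ j (γ j - 1) i) * D (x j)) := by
    intro s
    induction s using Finset.induction_on with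
    | empty => simp
    | insert a s ha ih =>
      rw [Finset.prod_insert ha, Derivation.leibniz, ih, Finset.sum_insert ha, Finset.prod_insert ha,
        Function.update_self, Derivation.leibniz_pow, smul_eq_mul, smul_eq_mul, Finset.mul_sum,
        add_comm]
      have hprod : ∏ i ∈ s, x i ^ Function.update γ a (γ a - 1) i = ∏ i ∈ s, x i ^ γ i :=
        Finset.prod_congr rfl fun i hi => by
          rw [Function.update_of_ne (ne_of_mem_of_not_mem hi ha)]
      rw [hprod]
      congr 1
      · simp only [nsmul_eq_mul, smul_eq_mul]
        ring
      · refine Finset.sum_congr rfl fun j hj => ?_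
        rw [Finset.prod_insert ha, Function.update_of_ne (ne_of_mem_of_not_mem hj ha).symm]
        ring
  exact key Finset.univ

namespace WeightData

variable {g : ℕ} (W : WeightData g) {R : Type*} [CommRing R]

/-- The equations with leading binomials. -/
def eqn (x : Fin (g + 1) → R) (c : Fin g → R) (v : R) (Γ : Fin g → Finset (Fin (g + 1) → ℕ))
    (h : Fin g → (Fin (g + 1) → ℕ) → R) (k : Fin g) : R :=
  x k.succ ^ W.n k - c k * monomialEval x (W.b k) - higherTerms x v Γ h k

/-- The linearised equations, with the coefficients kept constant. -/
def linearEqn (x ξ : Fin (g + 1) → R) (c : Fin g → R) (v : R)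
    (Γ : Fin g → Finset (Fin (g + 1) → ℕ)) (h : Fin g → (Fin (g + 1) → ℕ) → R) (k : Fin g) : R :=
  (W.n k : R) * x k.succ ^ (W.n k - 1) * ξ k.succ - c k * monomialDirDeriv x ξ (W.b k)
    - (∑ γ ∈ Γ k, h k γ * monomialDirDeriv x ξ γ + v * nextEntry ξ k)

end WeightData

theorem map_nextEntry {g : ℕ} {R S : Type*} [CommRing R] [CommRing S] (φ : R →+* S)
    (x : Fin (g + 1) → R) (k : Fin g) : φ (nextEntry x k) = nextEntry (fun i => φ (x i)) k := by
  unfold nextEntry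
  split_ifs <;> simp

/-- Jets of the family over a local domain `T`, with equations holding modulo `X ^ N`: either all
coordinates are small, or the orders are proportional to the weights and the linearised equations
are nondegenerate. -/
theorem WeightData.jet_alternative {g : ℕ} (W : WeightData g) (hg : 0 < g) {T : Type} [CommRing T]
    [IsDomain T] [IsLocalRing T] [Algebra ℚ T] (N : ℕ) (x : Fin (g + 1) → PowerSeries T)
    (hx : ∀ i, PowerSeries.constantCoeff (x i) ∈ IsLocalRing.maximalIdeal T)
    (c : Fin g → PowerSeries T) (hc : ∀ k, IsUnit (c k)) (v : PowerSeries T)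
    (Γ : Fin g → Finset (Fin (g + 1) → ℕ)) (hΓ : ∀ k, ∀ γ ∈ Γ k, W.n k * W.β k.succ < W.wt γ)
    (h : Fin g → (Fin (g + 1) → ℕ) → PowerSeries T)
    (heq : ∀ k, PowerSeries.X ^ N ∣ W.eqn x c v Γ h k) :
    (∃ k, ∀ i, PowerSeries.X ^ (N * W.β i) ∣ x i ^ (W.n k * W.β k.succ)) ∨
    ((∀ i, x i ≠ 0) ∧ (∀ i j r, PowerSeries.X ^ r ∣ x i ^ W.β j → PowerSeries.X ^ r ∣ x j ^ W.β i) ∧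
      (∀ k, ¬ PowerSeries.X ^ N ∣ x k.succ ^ W.n k) ∧
      ∀ ξ : Fin (g + 1) → PowerSeries T, ξ 0 = 0 → ξ ≠ 0 →
        (∀ k, PowerSeries.X ^ N ∣ W.linearEqn x ξ c v Γ h k) →
        ∃ k, ξ k.succ ≠ 0 ∧ PowerSeries.X ^ N ∣ x k.succ ^ (W.n k - 1) * ξ k.succ) := by
  obtain ⟨L, _, Γ₀, _, ν, ι, hinj, hle, hlt, hdvd⟩ := exists_valuation_powerSeries T
  have hdvd' : ∀ (p : PowerSeries T) (k : ℕ), PowerSeries.X ^ k ∣ p →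
      ν (ι p) ≤ ν (ι PowerSeries.X) ^ k := by
    rintro _ k ⟨q, rfl⟩
    rw [map_mul, map_mul, map_pow, map_pow]
    exact mul_le_of_le_one_right' (hle q)
  have hunit : ∀ p, IsUnit p → ν (ι p) = 1 := by
    rintro p ⟨u, rfl⟩
    refine le_antisymm (hle _) ?_
    have h1 : ν (ι (u : PowerSeries T)) * ν (ι ((u⁻¹ : (PowerSeries T)ˣ) : PowerSeries T)) = 1 := by
      rw [← map_mul, ← map_mul, Units.mul_inv, map_one, map_one]
    rw [← h1]
    exact mul_le_of_le_one_right' (hle _)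
  have hnat : ∀ n : ℕ, n ≠ 0 → ν (n : L) = 1 := by
    intro n hn
    have h1 : IsUnit ((n : ℕ) : PowerSeries T) := by
      have : ((n : ℚ)) ≠ 0 := by exact_mod_cast hn
      simpa using (this.isUnit.map (algebraMap ℚ (PowerSeries T)))
    simpa using hunit _ h1
  have heqL : ∀ k, ι (W.eqn x c v Γ h k) = ι (x k.succ) ^ W.n k
      - ι (c k) * monomialEval (fun i => ι (x i)) (W.b k)
      - higherTerms (fun i => ι (x i)) (ι v) Γ (fun k γ => ι (h k γ)) k := fun k => by
    simp [WeightData.eqn, higherTerms, map_monomialEval, map_nextEntry]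
  -- Congruences modulo `X ^ N` become estimates with `ε = ν(X) ^ N`, and the resulting estimates
  -- return to divisibility by powers of `X` through `hdvd`.
  rcases isBalanced_or_le W ν hg (fun i => ι (x i)) (fun i => hlt _ (hx i)) (fun k => ι (c k))
    (fun k => hunit _ (hc k)) (ι v) (hle v) Γ hΓ (fun k γ => ι (h k γ)) (fun k γ => hle _)
    (ν (ι PowerSeries.X) ^ N) (fun k => by rw [← heqL]; exact hdvd' _ _ (heq k)) with
    ⟨k, hk⟩ | ⟨hbal, hN⟩
  · refine Or.inl ⟨k, fun i => hdvd _ _ ?_⟩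
    rw [map_pow, map_pow, pow_mul _ N]
    exact hk i
  · refine Or.inr ⟨fun i h0 => hbal.ne_zero i (by simp [h0]), fun i j r hr => hdvd _ _ ?_,
      fun k hk => ?_, fun ξ hξ0 hξ hlin => ?_⟩
    · rw [map_pow, map_pow, ← hbal.pow_eq i j, ← map_pow, ← map_pow]
      exact hdvd' _ _ hr
    · refine absurd (hN k) (not_lt.mpr ?_)
      rw [← map_pow, ← map_pow]
      exact hdvd' _ _ hk
    · obtain ⟨k, hk0, hk⟩ := hbal.exists_row_eq hnat (fun k => ι (c k))
        (fun k => hunit _ (hc k)) (ι v) (hle v) Γ hΓ (fun k γ => ι (h k γ)) (fun k γ => hle _)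
        (fun i => ι (ξ i)) (by simp [hξ0]) (fun h0 => hξ (by
          ext1 i
          exact (map_eq_zero_iff ι hinj).mp (congrFun h0 i)))
      refine ⟨k, fun h0 => hk0 (by simp [h0]), hdvd _ _ ?_⟩
      have hx0 : ∀ i, ι (x i) ≠ 0 := fun i h0 => hbal.ne_zero i (by simp [h0])
      have h2 : ι (W.linearEqn x ξ c v Γ h k) = (W.n k : L) * ι (x k.succ) ^ (W.n k - 1) * ι (ξ k.succ)
          - ι (c k) * monomialDeriv (fun i => ι (x i)) (fun i => ι (ξ i)) (W.b k)
          - (∑ γ ∈ Γ k, ι (h k γ) * monomialDeriv (fun i => ι (x i)) (fun i => ι (ξ i)) γ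
            + ι v * nextEntry (fun i => ι (ξ i)) k) := by
        simp [WeightData.linearEqn, map_monomialDirDeriv, map_nextEntry,
          monomialDirDeriv_eq_monomialDeriv _ _ hx0]
      rw [map_mul, map_pow, ← hk, ← h2]
      exact hdvd' _ _ (hlin k)

/-! ### Derivations on coefficients and the universal jet -/

/-- An additive map acting on the coefficients of power series. -/
noncomputable def PowerSeries.mapAddHom {A : Type*} [CommRing A] (D : A →+ A) :
    PowerSeries A →+ PowerSeries A where
  toFun p := PowerSeries.mk fun n => D (PowerSeries.coeff n p)
  map_zero' := by ext; simp
  map_add' p q := by ext; simp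

theorem PowerSeries.coeff_mapAddHom {A : Type*} [CommRing A] (D : A →+ A) (p : PowerSeries A)
    (n : ℕ) : PowerSeries.coeff n (PowerSeries.mapAddHom D p) = D (PowerSeries.coeff n p) := by
  simp [PowerSeries.mapAddHom]

theorem PowerSeries.mapAddHom_mul {A : Type*} [CommRing A] (D : Derivation ℤ A A)
    (p q : PowerSeries A) : PowerSeries.mapAddHom (D : A →+ A) (p * q) =
      p * PowerSeries.mapAddHom (D : A →+ A) q + q * PowerSeries.mapAddHom (D : A →+ A) p := by
  ext n
  simp only [PowerSeries.coeff_mapAddHom, PowerSeries.coeff_mul, map_sum, map_add,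
    AddMonoidHom.coe_coe, Derivation.leibniz, smul_eq_mul, Finset.sum_add_distrib]
  congr 1
  rw [← Finset.Nat.sum_antidiagonal_swap]
  rfl

/-- A derivation acting on the coefficients of power series. -/
noncomputable def Derivation.mapPowerSeries {A : Type*} [CommRing A] (D : Derivation ℤ A A) :
    Derivation ℤ (PowerSeries A) (PowerSeries A) where
  toFun p := PowerSeries.mapAddHom (D : A →+ A) p
  map_add' := map_add _
  map_smul' r p := map_zsmul (PowerSeries.mapAddHom (D : A →+ A)) r p
  map_one_eq_zero' := by
    have h := PowerSeries.mapAddHom_mul D 1 1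
    change PowerSeries.mapAddHom (D : A →+ A) 1 = 0
    simpa using h
  leibniz' := PowerSeries.mapAddHom_mul D

@[simp]
theorem Derivation.coeff_mapPowerSeries {A : Type*} [CommRing A] (D : Derivation ℤ A A)
    (p : PowerSeries A) (n : ℕ) :
    PowerSeries.coeff n (D.mapPowerSeries p) = D (PowerSeries.coeff n p) :=
  PowerSeries.coeff_mapAddHom (D : A →+ A) p n

theorem Derivation.mapPowerSeries_monomialEval {ι A : Type*} [Fintype ι] [DecidableEq ι]
    [CommRing A] (D : Derivation ℤ A A) (x : ι → PowerSeries A) (γ : ι → ℕ) :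
    D.mapPowerSeries (monomialEval x γ) = monomialDirDeriv x (fun i => D.mapPowerSeries (x i)) γ :=
  Derivation.map_monomialEval _ _ _

/-- A linear combination of derivations, as a derivation over the integers. -/
def Derivation.intCombination {R A S : Type*} [CommRing R] [CommRing A] [Algebra R A]
    [Fintype S] (a : S → A) (D : S → Derivation R A A) : Derivation ℤ A A :=
  (∑ s, a s • D s).restrictScalars ℤ

theorem Derivation.intCombination_apply {R A S : Type*} [CommRing R] [CommRing A] [Algebra R A]
    [Fintype S] (a : S → A) (D : S → Derivation R A A) (x : A) :
    Derivation.intCombination a D x = ∑ s, a s * D s x := by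
  change (∑ s, a s • D s) x = _
  rw [← Derivation.coeFnAddMonoidHom_apply, map_sum, Finset.sum_apply]
  rfl

/-- The truncated power series with prescribed coefficients. -/
noncomputable def jetSeries {σ T : Type*} [CommRing T] {m : ℕ} (a : σ × Fin (m + 1) → T) (i : σ) :
    PowerSeries T :=
  PowerSeries.mk fun l => if h : l < m + 1 then a (i, ⟨l, h⟩) else 0

theorem coeff_jetSeries {σ T : Type*} [CommRing T] {m : ℕ} (a : σ × Fin (m + 1) → T) (i : σ)
    (l : ℕ) : PowerSeries.coeff l (jetSeries a i) = if h : l < m + 1 then a (i, ⟨l, h⟩) else 0 := by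
  simp [jetSeries]

theorem hasSubst_universalJet {σ R : Type*} [Finite σ] [CommRing R] (m : ℕ) :
    MvPowerSeries.HasSubst
      (universalJet m : σ → MvPowerSeries (Option (σ × Fin (m + 1))) R) := by
  refine MvPowerSeries.hasSubst_of_constantCoeff_zero fun i => ?_
  simp [universalJet]

/-- The substitution `F ↦ F (x(t))`. -/
noncomputable def jetHom {σ : Type*} (R : Type*) [Finite σ] [CommRing R] (m : ℕ) :
    MvPowerSeries σ R →+* PowerSeries (MvPowerSeries (σ × Fin (m + 1)) R) :=
  ((MvPowerSeries.optionEquivLeft (σ × Fin (m + 1)) R).toAlgHom.comp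
    (MvPowerSeries.substAlgHom (hasSubst_universalJet m))).toRingHom

theorem jetCoeff_eq {σ R : Type*} [Finite σ] [CommRing R] (m : ℕ) (F : MvPowerSeries σ R) (l : ℕ) :
    jetCoeff m F l = PowerSeries.coeff l (jetHom R m F) := by
  simp [jetCoeff, jetHom]

theorem jetHom_X {σ R : Type*} [Finite σ] [CommRing R] (m : ℕ) (i : σ) :
    jetHom R m (MvPowerSeries.X i) = jetSeries MvPowerSeries.X i := by
  have h1 : jetHom R m (MvPowerSeries.X i) =
      ∑ j : Fin (m + 1), PowerSeries.C (MvPowerSeries.X (i, j)) * PowerSeries.X ^ (j : ℕ) := by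
    simp only [jetHom, AlgHom.toRingHom_eq_coe, RingHom.coe_coe, AlgHom.comp_apply,
      MvPowerSeries.substAlgHom_X]
    simp [universalJet, MvPowerSeries.optionEquivLeft_X_some, MvPowerSeries.optionEquivLeft_X_none]
  rw [h1]
  ext1 l
  rw [coeff_jetSeries, map_sum]
  simp only [PowerSeries.coeff_C_mul, PowerSeries.coeff_X_pow, mul_ite, mul_one, mul_zero]
  split_ifs with hl
  · rw [Finset.sum_eq_single ⟨l, hl⟩]
    · simp
    · intro j _ hj
      rw [if_neg fun h => hj (Fin.ext h.symm)]
    · simp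
  · refine Finset.sum_eq_zero fun j _ => if_neg ?_
    have := j.2
    omega

theorem jetHom_C {σ R : Type*} [Finite σ] [CommRing R] (m : ℕ) (r : R) :
    jetHom (σ := σ) R m (MvPowerSeries.C r) = PowerSeries.C (MvPowerSeries.C r) := by
  have h := ((MvPowerSeries.optionEquivLeft (σ × Fin (m + 1)) R).toAlgHom.comp
    (MvPowerSeries.substAlgHom (hasSubst_universalJet (σ := σ) m))).commutes r
  rw [MvPowerSeries.algebraMap_apply, PowerSeries.algebraMap_apply,
    MvPowerSeries.algebraMap_apply] at h
  exact h

theorem PowerSeries.map_jetSeries {σ A T : Type*} [CommRing A] [CommRing T] {m : ℕ} (φ : A →+* T)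
    (a : σ × Fin (m + 1) → A) (i : σ) :
    PowerSeries.map φ (jetSeries a i) = jetSeries (fun s => φ (a s)) i := by
  ext l
  rw [PowerSeries.coeff_map, coeff_jetSeries, coeff_jetSeries]
  split_ifs <;> simp

theorem Derivation.mapPowerSeries_jetSeries {σ A : Type*} [CommRing A] {m : ℕ}
    (D : Derivation ℤ A A) (a : σ × Fin (m + 1) → A) (i : σ) :
    D.mapPowerSeries (jetSeries a i) = jetSeries (fun s => D (a s)) i := by
  ext l
  rw [coeff_mapPowerSeries, coeff_jetSeries, coeff_jetSeries]
  split_ifs <;> simp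

/-- A derivation killing the constants and `X i` kills every power series in `X i`, as soon as it
takes values in a ring where the powers of the image of `X i` have trivial intersection. -/
theorem MvPowerSeries.derivation_eq_zero {σ k B : Type*} [CommRing k] [CommRing B]
    [IsNoetherianRing B] [IsDomain B] (ψ : MvPowerSeries σ k →+* B) (d : MvPowerSeries σ k →+ B)
    (hd : ∀ F G, d (F * G) = ψ F * d G + ψ G * d F) (hC : ∀ a, d (MvPowerSeries.C a) = 0) (i : σ)
    (hX : d (MvPowerSeries.X i) = 0) (hu : ¬ IsUnit (ψ (MvPowerSeries.X i)))
    (H : MvPowerSeries σ k) (hH : ∀ δ, MvPowerSeries.coeff δ H ≠ 0 → ∀ j, j ≠ i → δ j = 0) :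
    d H = 0 := by
  classical
  -- Splitting off the constant term, `H = C a + X i * H'` gives `d H = ψ (X i) * d H'`. Iterating
  -- puts `d H` in every power of a proper ideal, and Krull's intersection theorem finishes; no
  -- continuity of `d` is required.
  have key : ∀ (N : ℕ) (H : MvPowerSeries σ k),
      (∀ δ, MvPowerSeries.coeff δ H ≠ 0 → ∀ j, j ≠ i → δ j = 0) →
      d H ∈ Ideal.span {ψ (MvPowerSeries.X i)} ^ N := by
    intro N
    induction N with
    | zero => intro H _; simp
    | succ N ih =>
      intro H hH
      have h1 : (MvPowerSeries.X i : MvPowerSeries σ k) ∣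
          H - MvPowerSeries.C (MvPowerSeries.coeff 0 H) := by
        rw [MvPowerSeries.X_dvd_iff]
        intro δ hδ
        rw [map_sub, MvPowerSeries.coeff_C]
        split_ifs with h0
        · rw [h0, sub_self]
        · rw [sub_zero]
          by_contra hne
          apply h0
          ext j
          by_cases hj : j = i
          · rw [hj, hδ]; rfl
          · rw [hH δ hne j hj]; rfl
      obtain ⟨H', hH'⟩ := h1
      have h2 : d H = ψ (MvPowerSeries.X i) * d H' := by
        have h3 : H = MvPowerSeries.C (MvPowerSeries.coeff 0 H) + MvPowerSeries.X i * H' := by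
          rw [← hH']; ring
        rw [h3, map_add, hC, hd, hX, mul_zero, add_zero, zero_add]
      rw [h2, pow_succ']
      refine Ideal.mul_mem_mul (Ideal.mem_span_singleton_self _) (ih H' fun δ hδ j hj => ?_)
      have h4 := congrArg (MvPowerSeries.coeff (δ + Finsupp.single i 1)) hH'
      rw [MvPowerSeries.X, add_comm δ, MvPowerSeries.coeff_add_monomial_mul, one_mul, map_sub,
        MvPowerSeries.coeff_C, if_neg, sub_zero] at h4
      · have h5 := hH _ (by rw [h4]; exact hδ) j hj
        simpa [Finsupp.single_apply, Ne.symm hj] using h5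
      · intro h0
        have := DFunLike.congr_fun h0 i
        simp at this
  have h1 : d H ∈ ⨅ N : ℕ, Ideal.span {ψ (MvPowerSeries.X i)} ^ N := by
    rw [Ideal.mem_iInf]
    exact fun N => key N H hH
  rw [Ideal.iInf_pow_eq_bot_of_isDomain _ (by rwa [Ne, Ideal.span_singleton_eq_top])] at h1
  simpa using h1

/-- A power series all of whose monomials have weight greater than `N`, and bounded exponents in all
variables but the first, is a finite combination of such monomials with coefficients depending
only on the first variable. -/
theorem MvPowerSeries.exists_weight_decomposition {g : ℕ} {k : Type*} [CommRing k]
    (β : Fin (g + 1) → ℕ) (hβ : 0 < β 0) (N : ℕ) (M : Fin (g + 1) → ℕ)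
    (P : MvPowerSeries (Fin (g + 1)) k)
    (hP : ∀ γ, MvPowerSeries.coeff γ P ≠ 0 → (∀ j, j ≠ 0 → γ j < M j) ∧ N < ∑ j, γ j * β j) :
    ∃ (Γ : Finset (Fin (g + 1) → ℕ)) (H : (Fin (g + 1) → ℕ) → MvPowerSeries (Fin (g + 1)) k),
      (∀ γ ∈ Γ, (∀ j, j ≠ 0 → γ j < M j) ∧ N < ∑ j, γ j * β j) ∧
      (∀ γ δ, MvPowerSeries.coeff δ (H γ) ≠ 0 → ∀ j, j ≠ 0 → δ j = 0) ∧
      P = ∑ γ ∈ Γ, H γ * monomialEval MvPowerSeries.X γ := by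
  classical
  -- These are the exponents of weight above `N` for which `γ 0` is as small as possible. Each
  -- monomial `δ` of `P` is uniquely one of them times a power of the first variable: `γ` is `δ`
  -- with `δ 0` lowered to the least `n0` keeping the weight above `N`.
  let Γ : Finset (Fin (g + 1) → ℕ) :=
    (Fintype.piFinset fun j => Finset.range (if j = 0 then N + 2 else M j)).filter fun γ =>
      N < ∑ j, γ j * β j ∧ (γ 0 = 0 ∨ ∑ j, γ j * β j ≤ N + β 0)
  let toF : (Fin (g + 1) → ℕ) → (Fin (g + 1) →₀ ℕ) := Finsupp.equivFunOnFinite.symm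
  have htoF : ∀ γ j, toF γ j = γ j := fun γ j => rfl
  let H : (Fin (g + 1) → ℕ) → MvPowerSeries (Fin (g + 1)) k := fun γ δ =>
    if ∀ j, j ≠ 0 → δ j = 0 then MvPowerSeries.coeff (toF γ + δ) P else 0
  have hH : ∀ γ δ, MvPowerSeries.coeff δ (H γ) =
    if ∀ j, j ≠ 0 → δ j = 0 then MvPowerSeries.coeff (toF γ + δ) P else 0 := fun γ δ => rfl
  refine ⟨Γ, H, fun γ hγ => ?_, fun γ δ hδ => ?_, ?_⟩
  · obtain ⟨h1, h2, -⟩ := Finset.mem_filter.mp hγ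
    refine ⟨fun j hj => ?_, h2⟩
    have := Fintype.mem_piFinset.mp h1 j
    simpa [hj] using this
  · by_contra hc
    exact hδ (by rw [hH, if_neg hc])
  · ext δ
    have hmon : ∀ γ : Fin (g + 1) → ℕ,
        monomialEval (MvPowerSeries.X : Fin (g + 1) → MvPowerSeries (Fin (g + 1)) k) γ =
          MvPowerSeries.monomial (toF γ) 1 := fun γ => by
      rw [MvPowerSeries.monomial_one_eq, Finsupp.prod_fintype _ _ (fun _ => pow_zero _)]
      rfl
    have hterm : ∀ γ : Fin (g + 1) → ℕ,
        MvPowerSeries.coeff δ (H γ * monomialEval MvPowerSeries.X γ) =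
          if toF γ ≤ δ ∧ ∀ j, j ≠ 0 → δ j - γ j = 0 then MvPowerSeries.coeff δ P else 0 := by
      intro γ
      rw [hmon, MvPowerSeries.coeff_mul_monomial, mul_one, hH]
      by_cases h1 : toF γ ≤ δ
      · simp only [h1, if_true, true_and, add_tsub_cancel_of_le, Finsupp.tsub_apply, htoF]
      · simp [h1]
    rw [map_sum, Finset.sum_congr rfl fun γ _ => hterm γ]
    by_cases h0 : MvPowerSeries.coeff δ P = 0
    · simp [h0]
    obtain ⟨hM, hN⟩ := hP δ h0
    rw [Fin.sum_univ_succ] at hN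
    set s := ∑ i : Fin g, δ i.succ * β i.succ with hs
    have hex : ∃ n, N < n * β 0 + s := ⟨δ 0, hN⟩
    set n0 := Nat.find hex with hn0
    have hn0δ : n0 ≤ δ 0 := Nat.find_min' hex hN
    have hn0N : n0 ≤ N + 1 := Nat.find_min' hex (by nlinarith)
    have hn0s : N < n0 * β 0 + s := Nat.find_spec hex
    have hup : ∀ n, ∑ j, Function.update (δ : Fin (g + 1) → ℕ) 0 n j * β j = n * β 0 + s := by
      intro n
      rw [Fin.sum_univ_succ]
      simp [hs]
    have hγup : ∀ γ : Fin (g + 1) → ℕ, (toF γ ≤ δ ∧ ∀ j, j ≠ 0 → δ j - γ j = 0) →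
        γ = Function.update (δ : Fin (g + 1) → ℕ) 0 (γ 0) := by
      rintro γ ⟨h1, h2⟩
      ext j
      by_cases hj : j = 0
      · subst hj; simp
      · rw [Function.update_of_ne hj]
        have h3 := h1 j
        rw [htoF] at h3
        have h4 := h2 j hj
        omega
    rw [Finset.sum_eq_single (Function.update (δ : Fin (g + 1) → ℕ) 0 n0)]
    · rw [if_pos]
      refine ⟨fun j => ?_, fun j hj => by simp [Function.update_of_ne hj]⟩
      rw [htoF]
      by_cases hj : j = 0
      · subst hj; simpa using hn0δ
      · rw [Function.update_of_ne hj]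
    · intro γ hγ hne
      rw [if_neg]
      intro hc
      have h1 := hγup γ hc
      obtain ⟨-, h2, h3⟩ := Finset.mem_filter.mp hγ
      rw [h1, hup] at h2 h3
      simp only [Function.update_self] at h3
      apply hne
      rw [h1]
      congr 1
      have h4 : n0 ≤ γ 0 := Nat.find_min' hex h2
      rcases h3 with h3 | h3
      · omega
      · by_contra h5
        have h6 : n0 + 1 ≤ γ 0 := by omega
        have h7 : (n0 + 1) * β 0 ≤ γ 0 * β 0 := Nat.mul_le_mul_right _ h6
        rw [add_mul] at h7
        omega
    · intro hnot
      exfalso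
      apply hnot
      rw [Finset.mem_filter, Fintype.mem_piFinset, hup, Function.update_self]
      refine ⟨fun j => ?_, hn0s, ?_⟩
      · by_cases hj : j = 0
        · subst hj
          simp only [Function.update_self, if_true, Finset.mem_range]
          omega
        · rw [Function.update_of_ne hj, if_neg hj, Finset.mem_range]
          exact hM j hj
      · rcases Nat.eq_zero_or_pos n0 with h1 | h1
        · exact Or.inl h1
        · right
          have h2 := Nat.find_min hex (show n0 - 1 < n0 by omega)
          obtain ⟨n1, hn1⟩ : ∃ n1, n0 = n1 + 1 := ⟨n0 - 1, by omega⟩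
          rw [hn1] at h2 ⊢
          rw [Nat.add_sub_cancel] at h2
          rw [add_mul]
          omega

/-! ### Intersection multiplicity as a valuation -/

open Polynomial in
-- A form of Hensel's lemma. Clear denominators by the least power `ϖ ^ m`. If `m > 0`, the
-- reduction of the resulting polynomial `q` is nonzero but has vanishing constant and top
-- coefficients, so Weierstrass preparation splits off a monic factor of degree strictly between `0`
-- and `deg q`, against irreducibility.
theorem Polynomial.exists_monic_lift_of_irreducible {A F : Type*} [CommRing A] [IsDomain A]
    [IsDiscreteValuationRing A] [IsAdicComplete (IsLocalRing.maximalIdeal A) A] [Field F]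
    [Algebra A F] [IsFractionRing A F] {p : F[X]} (hm : p.Monic) (hp : Irreducible p)
    (h0 : p.coeff 0 ∈ (algebraMap A F).range) : ∃ q : A[X], q.Monic ∧ q.map (algebraMap A F) = p := by
  obtain ⟨ϖ, hϖ⟩ := IsDiscreteValuationRing.exists_irreducible A
  have hinj : Function.Injective (algebraMap A F) := IsFractionRing.injective A F
  have hϖ0 : algebraMap A F ϖ ≠ 0 := fun h => hϖ.ne_zero (hinj (by rw [h, map_zero]))
  have hex : ∃ m, ∃ q : A[X], q.map (algebraMap A F) = C (algebraMap A F (ϖ ^ m)) * p := by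
    obtain ⟨b, hbm, hb⟩ := IsLocalization.integerNormalization_spec (nonZeroDivisors A) p
    obtain ⟨m, u, hu⟩ := IsDiscreteValuationRing.eq_unit_mul_pow_irreducible
      (nonZeroDivisors.ne_zero hbm) hϖ
    refine ⟨m, C ((u⁻¹ : Aˣ) : A) * IsLocalization.integerNormalization (nonZeroDivisors A) p, ?_⟩
    rw [Polynomial.map_mul, hb, map_C, Algebra.smul_def, IsScalarTower.algebraMap_apply A F F[X],
      algebraMap_eq, ← mul_assoc, ← C_mul, ← map_mul, hu,
      ← mul_assoc, Units.inv_mul, one_mul]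
  classical
  obtain ⟨q, hq⟩ := Nat.find_spec hex
  set m := Nat.find hex with hmdef
  have hnd : q.natDegree = p.natDegree := by
    rw [← natDegree_map_eq_of_injective hinj, hq, natDegree_C_mul]
    rw [map_pow]
    exact pow_ne_zero _ hϖ0
  have hlead : q.coeff p.natDegree = ϖ ^ m := by
    apply hinj
    rw [← coeff_map, hq, coeff_C_mul, hm.coeff_natDegree, mul_one]
  rcases Nat.eq_zero_or_pos m with hm0 | hm0
  · refine ⟨q, ?_, by rw [hq, hm0, pow_zero, map_one, C_1, one_mul]⟩
    rw [Monic, leadingCoeff, hnd, hlead, hm0, pow_zero]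
  exfalso
  have hmax : IsLocalRing.maximalIdeal A = Ideal.span {ϖ} := hϖ.maximalIdeal_eq
  have hres : ∀ a, IsLocalRing.residue A a = 0 ↔ ϖ ∣ a := fun a => by
    rw [IsLocalRing.residue_eq_zero_iff, hmax, Ideal.mem_span_singleton]
  have hq0 : ϖ ∣ q.coeff 0 := by
    obtain ⟨a, ha⟩ := h0
    have h1 : q.coeff 0 = ϖ ^ m * a := by
      apply hinj
      rw [← coeff_map, hq, coeff_C_mul, ← ha, map_mul]
    rw [h1]
    exact (dvd_pow_self _ hm0.ne').mul_right _
  have hqd : ϖ ∣ q.coeff p.natDegree := by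
    rw [hlead]
    exact dvd_pow_self _ hm0.ne'
  have hne : (q : PowerSeries A).map (IsLocalRing.residue A) ≠ 0 := by
    intro h
    have h1 : C ϖ ∣ q := by
      rw [C_dvd_iff_dvd_coeff]
      intro i
      rw [← hres]
      have := congrArg (PowerSeries.coeff i) h
      simpa using this
    obtain ⟨q', rfl⟩ := h1
    refine Nat.find_min hex (m := m - 1) (by omega) ⟨q', ?_⟩
    have h2 : C (algebraMap A F ϖ) ≠ 0 := by simpa using hϖ.ne_zero
    refine mul_left_cancel₀ h2 ?_
    rw [Polynomial.map_mul, map_C] at hq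
    rw [hq, ← mul_assoc, ← C_mul, ← map_mul, ← pow_succ', Nat.sub_add_cancel hm0]
  obtain ⟨D, h, H⟩ := PowerSeries.exists_isWeierstrassFactorization hne
  have hdeg := H.natDegree_eq_toNat_order_map
  have hDm := H.isDistinguishedAt.monic
  have hcoe : ∀ i, PowerSeries.coeff i ((q : PowerSeries A).map (IsLocalRing.residue A)) =
      IsLocalRing.residue A (q.coeff i) := fun i => by simp
  have hDpos : 0 < D.natDegree := by
    rw [hdeg]
    refine Nat.pos_of_ne_zero fun h1 => ?_
    have h2 := PowerSeries.coeff_order hne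
    rw [h1, hcoe, ne_eq, hres] at h2
    exact h2 hq0
  have hDlt : D.natDegree < q.natDegree := by
    have h2 := PowerSeries.coeff_order hne
    rw [← hdeg, hcoe, ne_eq, hres] at h2
    refine lt_of_le_of_ne (le_natDegree_of_ne_zero fun h3 => h2 (h3 ▸ dvd_zero _)) fun h3 => ?_
    rw [h3, hnd] at h2
    exact h2 hqd
  have hmod : q %ₘ D = 0 := by
    have hW : (D : PowerSeries A).IsWeierstrassDivisorAt (IsLocalRing.maximalIdeal A) :=
      H.isDistinguishedAt.isWeierstrassDivisorAt'
    have hDord : (((D : PowerSeries A).map (Ideal.Quotient.mk (IsLocalRing.maximalIdeal A))).order.toNat) =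
        D.natDegree := by
      have h4 : (D : PowerSeries A).IsWeierstrassFactorizationAt D 1 (IsLocalRing.maximalIdeal A) :=
        ⟨H.isDistinguishedAt, isUnit_one, by simp⟩
      exact (h4.natDegree_eq_toNat_order_map_of_ne_top (Ideal.IsPrime.ne_top inferInstance)).symm
    refine (hW.eq_of_mul_add_eq_mul_add (q := ((q /ₘ D : A[X]) : PowerSeries A)) (q' := h)
      (r' := 0) ?_ ?_ ?_).2
    · rw [hDord]
      exact (degree_modByMonic_lt q hDm).trans_le degree_le_natDegree
    · simp
    · rw [Polynomial.coe_zero, add_zero, ← H.eq_mul, ← Polynomial.coe_mul, ← Polynomial.coe_add,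
        add_comm, modByMonic_add_div]
  obtain ⟨s, hs⟩ := (modByMonic_eq_zero_iff_dvd hDm).mp hmod
  have hs0 : s ≠ 0 := by
    rintro rfl
    rw [mul_zero] at hs
    rw [hs] at hDlt
    simp at hDlt
  have hsdeg : q.natDegree = D.natDegree + s.natDegree := by
    rw [hs, hDm.natDegree_mul' hs0]
  have hirr : Irreducible (q.map (algebraMap A F)) := by
    rw [hq]
    have hu : IsUnit (C (algebraMap A F (ϖ ^ m))) := by
      rw [isUnit_C, map_pow]
      exact (pow_ne_zero _ hϖ0).isUnit
    exact (associated_unit_mul_left p _ hu).symm.irreducible hp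
  rw [hs, Polynomial.map_mul] at hirr
  rcases hirr.isUnit_or_isUnit rfl with hu | hu
  · have := natDegree_eq_zero_of_isUnit hu
    rw [natDegree_map_eq_of_injective hinj] at this
    omega
  · have := natDegree_eq_zero_of_isUnit hu
    rw [natDegree_map_eq_of_injective hinj] at this
    omega

/-- Up to sign, the norm is a power of the constant term of the minimal polynomial, so that term is
integral and the whole minimal polynomial lifts to `A`. -/
theorem isIntegral_of_norm_mem_range {A F K : Type*} [CommRing A] [IsDomain A]
    [IsDiscreteValuationRing A] [IsAdicComplete (IsLocalRing.maximalIdeal A) A] [Field F]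
    [Algebra A F] [IsFractionRing A F] [Field K] [Algebra F K] [FiniteDimensional F K] [Algebra A K]
    [IsScalarTower A F K] {u : K} (hu : Algebra.norm F u ∈ (algebraMap A F).range) :
    IsIntegral A u := by
  have hint : IsIntegral F u := Algebra.IsIntegral.isIntegral u
  have h1 : Algebra.norm F u = ((-1) ^ (minpoly F u).natDegree * (minpoly F u).coeff 0) ^
      Module.finrank (IntermediateField.adjoin F {u}) K := by
    have h2 := Algebra.PowerBasis.norm_gen_eq_coeff_zero_minpoly
      (IntermediateField.adjoin.powerBasis hint)
    rw [IntermediateField.adjoin.powerBasis_gen, IntermediateField.adjoin.powerBasis_dim,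
      IntermediateField.minpoly_gen] at h2
    rw [Algebra.norm_eq_norm_adjoin, h2]
  have h2 : (minpoly F u).coeff 0 ∈ (algebraMap A F).range := by
    have h3 : IsIntegral A ((-1) ^ (minpoly F u).natDegree * (minpoly F u).coeff 0) := by
      refine IsIntegral.of_pow (n := Module.finrank (IntermediateField.adjoin F {u}) K)
        Module.finrank_pos ?_
      rw [← h1]
      obtain ⟨a, ha⟩ := hu
      rw [← ha]
      exact isIntegral_algebraMap
    obtain ⟨a, ha⟩ := IsIntegrallyClosed.isIntegral_iff.mp h3
    refine ⟨(-1) ^ (minpoly F u).natDegree * a, ?_⟩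
    rw [map_mul, ha, ← mul_assoc, map_pow, map_neg, map_one, ← mul_pow]
    simp
  obtain ⟨q, hq, hqm⟩ := Polynomial.exists_monic_lift_of_irreducible (minpoly.monic hint)
    (minpoly.irreducible hint) h2
  refine ⟨q, hq, ?_⟩
  rw [IsScalarTower.algebraMap_eq A F K, ← Polynomial.eval₂_map, hqm]
  exact minpoly.aeval F u

namespace PowerSeries

variable {k : Type*} [Field k]

theorem associated_X_pow_order {p : PowerSeries k} (hp : p ≠ 0) : Associated (X ^ p.order.toNat) p := by
  have h1 : IsUnit p.divXPowOrder := isUnit_divided_by_X_pow_order hp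
  exact ⟨h1.unit, X_pow_order_mul_divXPowOrder⟩

theorem nonempty_quotient_linearEquiv {p : PowerSeries k} (hp : p ≠ 0) :
    Nonempty ((PowerSeries k ⧸ Ideal.span {p}) ≃ₗ[k] (Fin p.order.toNat → k)) := by
  set n := p.order.toNat
  have hspan : Ideal.span {p} = Ideal.span {(X : PowerSeries k) ^ n} :=
    Ideal.span_singleton_eq_span_singleton.mpr (associated_X_pow_order hp).symm
  let φ : PowerSeries k →ₗ[k] (Fin n → k) := LinearMap.pi fun i => coeff (i : ℕ)
  have hsurj : Function.Surjective φ := fun a =>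
    ⟨mk fun i => if h : i < n then a ⟨i, h⟩ else 0, by ext i; simp [φ]⟩
  have hker : LinearMap.ker φ = (Ideal.span {p}).restrictScalars k := by
    ext q
    rw [Submodule.restrictScalars_mem, hspan, Ideal.mem_span_singleton, X_pow_dvd_iff,
      LinearMap.mem_ker, funext_iff, Fin.forall_iff]
    rfl
  exact ⟨(Submodule.Quotient.restrictScalarsEquiv k (Ideal.span {p})).symm.trans
    ((Submodule.quotEquivOfEq _ _ hker.symm).trans (φ.quotKerEquivOfSurjective hsurj))⟩

theorem order_eq_of_associated {p q : PowerSeries k} (h : Associated p q) : p.order = q.order := by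
  obtain ⟨u, rfl⟩ := h
  rw [order_mul, order_zero_of_unit u.isUnit, add_zero]

/-- Smith normal form: the quotient is a sum of the `k⟦X⟧ / (a_i)`, and the norm is associated to
the product of the `a_i`. -/
theorem finrank_quotient_span_eq_order_norm {S : Type*} [CommRing S] [IsDomain S]
    [Algebra (PowerSeries k) S] [Algebra k S] [IsScalarTower k (PowerSeries k) S]
    [Module.Free (PowerSeries k) S] [Module.Finite (PowerSeries k) S] {f : S} (hf : f ≠ 0) :
    (Module.finrank k (S ⧸ Ideal.span {f}) : ℕ∞) = (Algebra.norm (PowerSeries k) f).order := by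
  have b := Module.Free.chooseBasis (PowerSeries k) S
  have h := Ideal.span_singleton_eq_bot.not.2 hf
  have e := fun i => (nonempty_quotient_linearEquiv (Ideal.smithCoeffs_ne_zero b _ h i)).some
  have := fun i => Module.Finite.equiv (e i).symm
  have := fun i => Module.Free.of_equiv (e i).symm
  rw [order_eq_of_associated (associated_norm_prod_smith b hf), order_prod,
    Ideal.finrank_quotient_eq_sum k h b, Nat.cast_sum]
  refine Finset.sum_congr rfl fun i _ => ?_
  rw [(e i).finrank_eq, Module.finrank_fin_fun]
  exact coe_toNat_order (Ideal.smithCoeffs_ne_zero b _ h i)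

end PowerSeries

section

variable {k : Type*} [Field k]

instance : IsAdicComplete (IsLocalRing.maximalIdeal (PowerSeries k)) (PowerSeries k) := by
  rw [PowerSeries.maximalIdeal_eq_span_X]
  infer_instance

theorem PowerSeries.dvd_iff_order_le {p q : PowerSeries k} (hp : p ≠ 0) :
    p ∣ q ↔ p.order ≤ q.order := by
  rw [← (associated_X_pow_order hp).dvd_iff_dvd_left, order_eq_emultiplicity_X q,
    ← coe_toNat_order hp, pow_dvd_iff_le_emultiplicity]
  rfl

theorem PowerSeries.not_finite_self : ¬ Module.Finite k (PowerSeries k) := fun _ => by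
  obtain ⟨c, hc⟩ := (isField_of_isIntegral_of_isField' (R := k) (S := PowerSeries k)
    (Field.toIsField k)).mul_inv_cancel PowerSeries.X_ne_zero
  exact PowerSeries.X_prime.not_isUnit (.of_mul_eq_one c hc)

variable {R : Type*} [CommRing R] [IsDomain R] [Algebra (PowerSeries k) R] [Algebra k R]
  [IsScalarTower k (PowerSeries k) R] [Module.Free (PowerSeries k) R] [Module.Finite (PowerSeries k) R]

theorem finrank_quotient_span_mul {a b : R} (ha : a ≠ 0) (hb : b ≠ 0) :
    Module.finrank k (R ⧸ Ideal.span {a * b}) =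
      Module.finrank k (R ⧸ Ideal.span {a}) + Module.finrank k (R ⧸ Ideal.span {b}) := by
  have h : ((Module.finrank k (R ⧸ Ideal.span {a * b}) : ℕ) : ℕ∞) =
      (Module.finrank k (R ⧸ Ideal.span {a}) + Module.finrank k (R ⧸ Ideal.span {b}) : ℕ) := by
    rw [Nat.cast_add, PowerSeries.finrank_quotient_span_eq_order_norm ha,
      PowerSeries.finrank_quotient_span_eq_order_norm hb,
      PowerSeries.finrank_quotient_span_eq_order_norm (mul_ne_zero ha hb), map_mul,
      PowerSeries.order_mul]
  exact_mod_cast h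

variable (k) in
/-- Over a complete discrete valuation ring, the colength of principal ideals in a finite domain
comes from a valuation. -/
theorem exists_ideal_mem_iff_finrank_le {b : R} (hb : b ≠ 0) :
    ∃ I : Ideal R, ∀ a, a ≠ 0 → (a ∈ I ↔
      Module.finrank k (R ⧸ Ideal.span {b}) ≤ Module.finrank k (R ⧸ Ideal.span {a})) := by
  have : FaithfulSMul (PowerSeries k) R := inferInstance
  let A := PowerSeries k
  let F := FractionRing A
  let K := FractionRing R
  have : FaithfulSMul A K := FaithfulSMul.trans A R K
  let : Algebra F K := FractionRing.liftAlgebra A K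
  have : IsScalarTower A F K := FractionRing.isScalarTower_liftAlgebra A K
  have hloc : IsLocalization (Algebra.algebraMapSubmonoid R (nonZeroDivisors A)) K := inferInstance
  have : FiniteDimensional F K := Module.Finite.of_isLocalization A R (nonZeroDivisors A)
  have hbK : algebraMap R K b ≠ 0 := by
    simpa using hb
  have hnorm : ∀ a : R, Algebra.norm F (algebraMap R K a) = algebraMap A F (Algebra.norm A a) :=
    fun a => Algebra.norm_localization A (nonZeroDivisors A) a
  have hnb : Algebra.norm A b ≠ 0 := Algebra.norm_ne_zero_iff.mpr hb
  -- The ideal consists of the `a` with `a / b` integral over `k⟦X⟧`. By completeness this is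
  -- equivalent to the norm of `b` dividing that of `a`, which compares the colengths. Closure under
  -- addition is the ultrametric inequality, obtained without normalising the curve.
  refine ⟨{ carrier := {a | IsIntegral A (algebraMap R K a / algebraMap R K b)}
            add_mem' := fun {a a'} ha ha' => ?_
            zero_mem' := ?_
            smul_mem' := fun r a ha => ?_ }, fun a ha => ?_⟩
  · change IsIntegral A _
    rw [map_add, add_div]
    exact IsIntegral.add ha ha'
  · change IsIntegral A _
    rw [map_zero, zero_div]
    exact isIntegral_zero
  · change IsIntegral A _
    rw [smul_eq_mul, map_mul, mul_div_assoc]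
    exact ((Algebra.IsIntegral.isIntegral (R := A) r).algebraMap).mul ha
  · rw [← Nat.cast_le (α := ℕ∞), PowerSeries.finrank_quotient_span_eq_order_norm ha,
      PowerSeries.finrank_quotient_span_eq_order_norm hb, ← PowerSeries.dvd_iff_order_le hnb]
    change IsIntegral A _ ↔ _
    have hdiv : Algebra.norm F (algebraMap R K a / algebraMap R K b) * algebraMap A F (Algebra.norm A b) =
        algebraMap A F (Algebra.norm A a) := by
      rw [← hnorm, ← hnorm, ← map_mul, div_mul_cancel₀ _ hbK]
    constructor
    · intro h
      obtain ⟨c, hc⟩ := IsIntegrallyClosed.isIntegral_iff.mp (Algebra.isIntegral_norm F h)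
      refine ⟨c, IsFractionRing.injective A F ?_⟩
      rw [← hdiv, ← hc, map_mul, mul_comm]
    · rintro ⟨c, hc⟩
      refine isIntegral_of_norm_mem_range (F := F) ⟨c, ?_⟩
      have h0 : algebraMap A F (Algebra.norm A b) ≠ 0 := by
        simpa using hnb
      refine mul_right_cancel₀ h0 ?_
      rw [hdiv, hc, map_mul, mul_comm]

variable (k) in
-- The quotient is infinite dimensional and `finrank` takes its default value `0`. Hence a positive
-- intersection multiplicity certifies that `f` does not divide the element.
theorem finrank_quotient_span_zero : Module.finrank k (R ⧸ Ideal.span {(0 : R)}) = 0 := by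
  refine Module.finrank_of_not_finite fun h => ?_
  have h1 : Module.Finite k R :=
    Module.Finite.equiv ((Submodule.quotEquivOfEqBot _ (by simp)).restrictScalars k :
      (R ⧸ Ideal.span {(0 : R)}) ≃ₗ[k] R)
  exact PowerSeries.not_finite_self (Module.Finite.of_injective
    ((IsScalarTower.toAlgHom k (PowerSeries k) R).toLinearMap) (FaithfulSMul.algebraMap_injective _ _))

end

/-- Power series in two variables as power series over the power series in the first variable. -/
noncomputable def MvPowerSeries.finTwoEquiv (k : Type*) [Field k] :
    MvPowerSeries (Fin 2) k ≃ₐ[k] PowerSeries (PowerSeries k) :=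
  (MvPowerSeries.renameEquiv k
    { toFun := ![some (), none]
      invFun := fun o => o.elim 1 fun _ => 0
      left_inv := fun i => by fin_cases i <;> rfl
      right_inv := fun o => by rcases o with _ | ⟨⟨⟩⟩ <;> rfl }).trans
    (MvPowerSeries.optionEquivLeft Unit k)

theorem MvPowerSeries.finTwoEquiv_X_zero (k : Type*) [Field k] :
    MvPowerSeries.finTwoEquiv k (MvPowerSeries.X 0) = PowerSeries.C PowerSeries.X := by
  exact (congrArg (MvPowerSeries.optionEquivLeft Unit k) (MvPowerSeries.rename_X _ _)).trans
    (MvPowerSeries.optionEquivLeft_X_some ())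

section

variable {k : Type*} [Field k] {f : MvPowerSeries (Fin 2) k}

/-- Otherwise `f` vanishes on `x_0 = 0` and the quotient by `(f, x_0)` surjects onto `k⟦x_1⟧`. The
conclusion is the hypothesis of Weierstrass preparation. -/
theorem finTwoEquiv_map_residue_ne_zero
    (h0 : Module.Finite k (MvPowerSeries (Fin 2) k ⧸ Ideal.span {f, MvPowerSeries.X 0})) :
    (MvPowerSeries.finTwoEquiv k f).map (IsLocalRing.residue (PowerSeries k)) ≠ 0 := by
  intro h
  let φ : MvPowerSeries (Fin 2) k →ₐ[k] PowerSeries k :=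
    (PowerSeries.mapAlgHom { PowerSeries.constantCoeff (R := k) with commutes' := fun r => by simp }).comp
      (MvPowerSeries.finTwoEquiv k).toAlgHom
  have hφ : ∀ a, φ a = (MvPowerSeries.finTwoEquiv k a).map PowerSeries.constantCoeff := fun a => rfl
  have hsurj : Function.Surjective φ := fun a => by
    refine ⟨(MvPowerSeries.finTwoEquiv k).symm (a.map PowerSeries.C), ?_⟩
    rw [hφ, AlgEquiv.apply_symm_apply]
    ext i
    simp
  have hker : ∀ a ∈ Ideal.span {f, MvPowerSeries.X 0}, φ a = 0 := by
    intro a ha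
    have h1 : Ideal.span {f, MvPowerSeries.X 0} ≤ RingHom.ker φ := by
      rw [Ideal.span_le]
      rintro a (rfl | rfl)
      · rw [SetLike.mem_coe, RingHom.mem_ker, hφ]
        ext i
        have h2 := congrArg (PowerSeries.coeff i) h
        rw [PowerSeries.coeff_map, map_zero, IsLocalRing.residue_eq_zero_iff,
          PowerSeries.maximalIdeal_eq_span_X, Ideal.mem_span_singleton, PowerSeries.X_dvd_iff] at h2
        rw [PowerSeries.coeff_map, h2, map_zero]
      · rw [SetLike.mem_coe, RingHom.mem_ker, hφ, MvPowerSeries.finTwoEquiv_X_zero]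
        simp
    exact h1 ha
  exact PowerSeries.not_finite_self (Module.Finite.of_surjective
    (Ideal.Quotient.liftₐ _ φ hker).toLinearMap (Ideal.Quotient.lift_surjective_of_surjective _ hker hsurj))

/-- By Weierstrass preparation the ring of the branch is a finite free `k⟦x_0⟧`-module, so
multiplicities are orders of norms: they are additive on products, and each lower bound on the
multiplicity cuts out an ideal. -/
theorem exists_ideal_mem_iff_intersection (hf : Irreducible f)
    (h0 : Module.Finite k (MvPowerSeries (Fin 2) k ⧸ Ideal.span {f, MvPowerSeries.X 0})) :
    Prime f ∧ (∀ a b, ¬ f ∣ a → ¬ f ∣ b →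
      Module.finrank k (MvPowerSeries (Fin 2) k ⧸ Ideal.span {f, a * b}) =
      Module.finrank k (MvPowerSeries (Fin 2) k ⧸ Ideal.span {f, a}) +
      Module.finrank k (MvPowerSeries (Fin 2) k ⧸ Ideal.span {f, b})) ∧
    (∀ a, f ∣ a → Module.finrank k (MvPowerSeries (Fin 2) k ⧸ Ideal.span {f, a}) = 0) ∧
    ∀ b, ¬ f ∣ b → ∃ I : Ideal (MvPowerSeries (Fin 2) k), f ∈ I ∧ ∀ a, ¬ f ∣ a → (a ∈ I ↔
      Module.finrank k (MvPowerSeries (Fin 2) k ⧸ Ideal.span {f, b}) ≤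
      Module.finrank k (MvPowerSeries (Fin 2) k ⧸ Ideal.span {f, a})) := by
  let B := PowerSeries (PowerSeries k)
  let e := MvPowerSeries.finTwoEquiv k
  have hirr : Irreducible (e f) := (MulEquiv.irreducible_iff e).mpr hf
  have hprime : (Ideal.span {e f} : Ideal B).IsPrime :=
    (Ideal.span_singleton_prime hirr.ne_zero).mpr hirr.prime
  let R := B ⧸ (Ideal.span {e f} : Ideal B)
  let algB : Algebra (PowerSeries k) B := MvPowerSeries.instAlgebra
  let algR : Algebra (PowerSeries k) R := Ideal.instAlgebraQuotient _ _
  have htower : @IsScalarTower k (PowerSeries k) R Algebra.toSMul algR.toSMul Algebra.toSMul :=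
    IsScalarTower.of_algebraMap_eq fun r =>
      congrArg (Ideal.Quotient.mk _) (MvPowerSeries.algebraMap_apply : algebraMap k B r = _)
  obtain ⟨D, h, H⟩ := PowerSeries.exists_isWeierstrassFactorization (finTwoEquiv_map_residue_ne_zero h0)
  have hDm := H.isDistinguishedAt.monic
  have : Module.Free (PowerSeries k) R := by
    have := hDm.free_quotient
    exact Module.Free.of_equiv H.algEquivQuotient.toLinearEquiv
  have : Module.Finite (PowerSeries k) R := by
    have := hDm.finite_quotient
    exact Module.Finite.equiv H.algEquivQuotient.toLinearEquiv
  let ρ : MvPowerSeries (Fin 2) k →ₐ[k] R := (Ideal.Quotient.mkₐ k (Ideal.span {e f})).comp e.toAlgHom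
  have hρ : Function.Surjective ρ := Ideal.Quotient.mk_surjective.comp e.surjective
  have hρ0 : ∀ a, ρ a = 0 ↔ f ∣ a := fun a => by
    change Ideal.Quotient.mk _ (e a) = 0 ↔ _
    rw [Ideal.Quotient.eq_zero_iff_mem, Ideal.mem_span_singleton]
    exact map_dvd_iff e
  have hker : RingHom.ker ρ = Ideal.span {f} := by
    ext a
    rw [RingHom.mem_ker, hρ0, Ideal.mem_span_singleton]
  have hrank : ∀ a, Module.finrank k (MvPowerSeries (Fin 2) k ⧸ Ideal.span {f, a}) =
      Module.finrank k (R ⧸ Ideal.span {ρ a}) := fun a => by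
    let θ : MvPowerSeries (Fin 2) k →ₐ[k] R ⧸ Ideal.span {ρ a} :=
      (Ideal.Quotient.mkₐ k (Ideal.span {ρ a})).comp ρ
    have hθ : Function.Surjective θ := Ideal.Quotient.mk_surjective.comp hρ
    have hθker : RingHom.ker θ = Ideal.span {f, a} := by
      have h1 := Ideal.comap_map_of_surjective ρ hρ (Ideal.span {a})
      rw [Ideal.map_span, Set.image_singleton] at h1
      have h2 : RingHom.ker θ = Ideal.comap ρ (Ideal.span {ρ a}) := by
        ext x
        rw [RingHom.mem_ker, Ideal.mem_comap, ← Ideal.Quotient.eq_zero_iff_mem]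
        rfl
      rw [h2, h1, Ideal.span_insert, sup_comm, ← hker]
      rfl
    rw [← hθker]
    exact (Ideal.quotientKerAlgEquivOfSurjective hθ).toLinearEquiv.finrank_eq
  simp only [hrank]
  refine ⟨(MulEquiv.prime_iff e).mp hirr.prime, fun a b ha hb => ?_, fun a ha => ?_, fun b hb => ?_⟩
  · rw [map_mul]
    exact finrank_quotient_span_mul (by rwa [ne_eq, hρ0]) (by rwa [ne_eq, hρ0])
  · rw [(hρ0 a).mpr ha]
    exact finrank_quotient_span_zero k
  · obtain ⟨I, hI⟩ := exists_ideal_mem_iff_finrank_le k (b := ρ b) (by rwa [ne_eq, hρ0])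
    refine ⟨I.comap ρ, ?_, fun a ha => hI (ρ a) (by rwa [ne_eq, hρ0])⟩
    rw [Ideal.mem_comap, (hρ0 f).mpr dvd_rfl]
    exact I.zero_mem

end

/-! ### Numerical data of the branch -/

namespace BranchExpansion

variable {f : MvPowerSeries (Fin 2) ℂ} {g : ℕ} (E : BranchExpansion f g)

theorem β_pos (i : Fin (g + 1)) : 0 < E.β i := by
  rcases Nat.eq_zero_or_pos (E.β i) with h | h
  · exact absurd (h ▸ AddSubmonoid.zero_mem _) (E.isMinimalGenerators.notMem_closure i)
  · exact h

theorem sum_b_mem_closure (k : Fin g) {i : Fin (g + 1)} (hi : k.castSucc < i) :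
    ∑ j, E.b k j * E.β j ∈ AddSubmonoid.closure (E.β '' {j | j ≠ i}) := by
  refine AddSubmonoid.sum_mem _ fun j _ => ?_
  rcases lt_or_ge k.castSucc j with hj | hj
  · rw [E.b_eq_zero k j hj, zero_mul]
    exact AddSubmonoid.zero_mem _
  · rw [← smul_eq_mul]
    exact AddSubmonoid.nsmul_mem _ (AddSubmonoid.subset_closure
      (Set.mem_image_of_mem _ (hj.trans_lt hi).ne)) _

theorem constantCoeff_z (j : Fin (g + 1)) : MvPowerSeries.constantCoeff (E.z j) = 0 := by
  by_contra h
  have hu : IsUnit (E.z j) := MvPowerSeries.isUnit_iff_constantCoeff.mpr (isUnit_iff_ne_zero.mpr h)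
  have h1 : Ideal.span {f, E.z j} = ⊤ := Ideal.eq_top_of_isUnit_mem _
    (Ideal.subset_span (Set.mem_insert_of_mem _ rfl)) hu
  have h2 := E.intersectionMult_z j
  have : Subsingleton (MvPowerSeries (Fin 2) ℂ ⧸ Ideal.span {f, E.z j}) :=
    Ideal.Quotient.subsingleton_iff.mpr h1
  rw [intersectionMult, Module.finrank_zero_of_subsingleton] at h2
  exact (E.β_pos j).ne h2

/-- Every term on the right of the identity for `z_{k+2}` has multiplicity at least `n_k β_{k+1}`,
hence so does `z_{k+2}`. Equality is excluded because `n_k β_{k+1}` is a combination of earlier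
generators, while the generators are minimal. -/
theorem lt_next (hf : Irreducible f) (k k' : Fin g) (hk : (k' : ℕ) = k + 1) :
    ratioSeq E.β k * E.β k.succ < E.β k'.succ := by
  have hlt : k.castSucc < k'.succ := by
    rw [Fin.lt_def, Fin.val_succ, Fin.val_castSucc]
    omega
  refine lt_of_le_of_ne ?_ fun h => E.isMinimalGenerators.notMem_closure k'.succ ?_
  swap
  · rw [← h, E.b_sum]
    exact E.sum_b_mem_closure k hlt
  have hfin : Module.Finite ℂ (MvPowerSeries (Fin 2) ℂ ⧸ Ideal.span {f, MvPowerSeries.X 0}) := by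
    refine Module.finite_of_finrank_pos ?_
    have h1 := E.intersectionMult_z 0
    rw [E.z_zero 0 rfl, intersectionMult] at h1
    rw [h1]
    exact E.β_pos 0
  obtain ⟨hprime, hmul, hzero, hideal⟩ := exists_ideal_mem_iff_intersection hf hfin
  change ∀ a b, ¬ f ∣ a → ¬ f ∣ b → intersectionMult f (a * b) =
    intersectionMult f a + intersectionMult f b at hmul
  change ∀ b, ¬ f ∣ b → ∃ I : Ideal (MvPowerSeries (Fin 2) ℂ), f ∈ I ∧ ∀ a, ¬ f ∣ a → (a ∈ I ↔
      intersectionMult f b ≤ intersectionMult f a) at hideal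
  have hz : ∀ j, ¬ f ∣ E.z j := fun j hj => (E.β_pos j).ne'
    ((E.intersectionMult_z j).symm.trans (hzero _ hj))
  have hone : intersectionMult f 1 = 0 := by
    have h1 := hmul 1 1 (fun h => hf.not_isUnit (isUnit_of_dvd_one h))
      (fun h => hf.not_isUnit (isUnit_of_dvd_one h))
    rw [mul_one] at h1
    omega
  have hpow : ∀ j n, ¬ f ∣ E.z j ^ n ∧ intersectionMult f (E.z j ^ n) = n * E.β j := by
    intro j n
    induction n with
    | zero =>
      rw [pow_zero, zero_mul]
      exact ⟨fun h => hf.not_isUnit (isUnit_of_dvd_one h), hone⟩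
    | succ n ih =>
      rw [pow_succ]
      refine ⟨fun h => (hprime.dvd_or_dvd h).elim ih.1 (hz j), ?_⟩
      rw [hmul _ _ ih.1 (hz j), ih.2, E.intersectionMult_z]
      ring
  have hmon : ∀ γ : Fin (g + 1) → ℕ, ¬ f ∣ monomialEval E.z γ ∧
      intersectionMult f (monomialEval E.z γ) = ∑ j, γ j * E.β j := by
    intro γ
    unfold monomialEval
    induction (Finset.univ : Finset (Fin (g + 1))) using Finset.induction_on with
    | empty => exact ⟨fun h => hf.not_isUnit (isUnit_of_dvd_one h), hone⟩
    | insert a s ha ih =>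
      rw [Finset.prod_insert ha, Finset.sum_insert ha]
      refine ⟨fun h => (hprime.dvd_or_dvd h).elim (hpow a _).1 ih.1, ?_⟩
      rw [hmul _ _ (hpow a _).1 ih.1, ih.2, (hpow a _).2]
  obtain ⟨I, hfI, hI⟩ := hideal (E.z k.succ ^ ratioSeq E.β k) (hpow _ _).1
  rw [(hpow _ _).2] at hI
  have hmonI : ∀ γ : Fin (g + 1) → ℕ, ratioSeq E.β k * E.β k.succ ≤ ∑ j, γ j * E.β j →
      monomialEval E.z γ ∈ I := fun γ hγ => by
    rw [hI _ (hmon γ).1, (hmon γ).2]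
    exact hγ
  have hsubst : MvPowerSeries.HasSubst E.z :=
    MvPowerSeries.hasSubst_of_constantCoeff_zero E.constantCoeff_z
  have hP : MvPowerSeries.subst E.z (E.P k) ∈ I := by
    obtain ⟨Γ, H, h1, -, h3⟩ := MvPowerSeries.exists_weight_decomposition E.β (E.β_pos 0)
      (ratioSeq E.β k * E.β k.succ)
      (fun j => if k.succ < j then 1 else Fin.cases 0 (fun i => ratioSeq E.β i) j) (E.P k)
      (fun γ hγ => by
        obtain ⟨h1, h2, h3⟩ := E.P_support k γ hγ
        refine ⟨fun j hj => ?_, h3⟩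
        split_ifs with hkj
        · rw [h1 j hkj]; exact one_pos
        · obtain ⟨i, rfl⟩ := Fin.exists_succ_eq.mpr hj
          exact h2 i (by simpa using hkj))
    rw [h3, ← MvPowerSeries.coe_substAlgHom hsubst, map_sum]
    refine I.sum_mem fun γ hγ => ?_
    rw [map_mul]
    refine I.mul_mem_left _ ?_
    have h4 : MvPowerSeries.substAlgHom hsubst
        (monomialEval (fun i => (MvPowerSeries.X i : MvPowerSeries (Fin (g + 1)) ℂ)) γ) =
        monomialEval E.z γ := by
      rw [monomialEval, map_prod]
      exact Finset.prod_congr rfl fun j _ => by rw [map_pow, MvPowerSeries.substAlgHom_X]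
    rw [h4]
    exact hmonI γ (h1 γ hγ).2.le
  have hnext : nextEntry E.z k ∈ I := by
    have h1 : nextEntry E.z k - (E.z k.succ ^ ratioSeq E.β k - MvPowerSeries.C (E.c k) *
        ∏ j, E.z j ^ E.b k j - MvPowerSeries.subst E.z (E.P k)) ∈ I :=
      (Ideal.span_singleton_le_iff_mem I).mpr hfI (E.identity k)
    refine (I.sub_mem_iff_left ?_).mp h1
    refine I.sub_mem (I.sub_mem ?_ (I.mul_mem_left _ ?_)) hP
    · rw [hI _ (hpow _ _).1, (hpow _ _).2]
    · exact hmonI (E.b k) (E.b_sum k).le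
  have h2 : nextEntry E.z k = E.z k'.succ := by
    rw [nextEntry, dif_pos (by omega)]
    exact congrArg E.z (Fin.ext (by simp only [Fin.val_succ]; omega))
  rwa [h2, hI _ (hz _), E.intersectionMult_z] at hnext

end BranchExpansion

namespace BranchExpansion

variable {f : MvPowerSeries (Fin 2) ℂ} {g : ℕ} (E : BranchExpansion f g)

/-- A ratio equal to `1` would express `β_{k+1}` through the previous generators. -/
theorem two_le_ratioSeq (k : Fin g) : 2 ≤ ratioSeq E.β k := by
  have hpos : ∀ i, 0 < gcdSeq E.β i := fun i => by
    refine Nat.pos_of_ne_zero fun h => ?_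
    have h1 := Finset.gcd_eq_zero_iff.mp h i (by simp)
    exact (E.β_pos i).ne' h1
  have hdvd : gcdSeq E.β k.succ ∣ gcdSeq E.β k.castSucc := by
    refine Finset.gcd_mono fun j hj => ?_
    simp only [Finset.mem_filter, Finset.mem_univ, true_and] at hj ⊢
    exact hj.trans (Fin.castSucc_lt_succ).le
  have h1 : 0 < ratioSeq E.β k := Nat.div_pos (Nat.le_of_dvd (hpos _) hdvd) (hpos _)
  by_contra hlt
  have h2 : ratioSeq E.β k = 1 := by omega
  have h3 := E.b_sum k
  rw [h2, one_mul] at h3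
  have h4 := E.sum_b_mem_closure k (i := k.succ) Fin.castSucc_lt_succ
  rw [← h3] at h4
  exact E.isMinimalGenerators.notMem_closure _ h4

/-- The numerical data of a plane branch. -/
def weightData (hf : Irreducible f) : WeightData g where
  β := E.β
  n := ratioSeq E.β
  b := E.b
  pos := E.β_pos
  two_le := E.two_le_ratioSeq
  b_eq_zero := E.b_eq_zero
  b_sum := E.b_sum
  lt_next := E.lt_next hf

/-! ### Equations and tangent vectors along a prime of the jet space -/

section Jets

variable {m : ℕ} (P : Ideal (MvPowerSeries (Fin (g + 1) × Fin (m + 1)) (PowerSeries ℂ)))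

/-- The coordinates of the universal jet modulo `P`. -/
noncomputable def jet (i : Fin (g + 1)) : PowerSeries
    (MvPowerSeries (Fin (g + 1) × Fin (m + 1)) (PowerSeries ℂ) ⧸ P) :=
  jetSeries (fun s => Ideal.Quotient.mk P (MvPowerSeries.X s)) i

/-- The constants `ℂ⟦v⟧` in the power series ring over the coordinate ring of jets modulo `P`. -/
noncomputable def constHom : PowerSeries ℂ →+* PowerSeries
    (MvPowerSeries (Fin (g + 1) × Fin (m + 1)) (PowerSeries ℂ) ⧸ P) :=
  PowerSeries.C.comp ((Ideal.Quotient.mk P).comp MvPowerSeries.C)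

/-- The tangent vectors at `P`. -/
def IsTangent (ξ : Fin (g + 1) × Fin (m + 1) →
    MvPowerSeries (Fin (g + 1) × Fin (m + 1)) (PowerSeries ℂ) ⧸ P) : Prop :=
  ∀ f ∈ P, ∑ s, ξ s * Ideal.Quotient.mk P (MvPowerSeries.pderiv (PowerSeries ℂ) s f) = 0

instance isLocalRing_quotient [P.IsPrime] : IsLocalRing
    (MvPowerSeries (Fin (g + 1) × Fin (m + 1)) (PowerSeries ℂ) ⧸ P) :=
  IsLocalRing.of_surjective' (Ideal.Quotient.mk P) Ideal.Quotient.mk_surjective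

theorem constantCoeff_jet [P.IsPrime] (i : Fin (g + 1)) :
    PowerSeries.constantCoeff (jet P i) ∈ IsLocalRing.maximalIdeal _ := by
  have h1 : PowerSeries.constantCoeff (jet P i) =
      Ideal.Quotient.mk P (MvPowerSeries.X (i, 0)) := by
    rw [← PowerSeries.coeff_zero_eq_constantCoeff_apply, jet, coeff_jetSeries,
      dif_pos (Nat.succ_pos m)]
    rfl
  rw [h1, IsLocalRing.mem_maximalIdeal, mem_nonunits_iff]
  intro hu
  have hloc : IsLocalHom (Ideal.Quotient.mk P) :=
    IsLocalHom.of_surjective _ Ideal.Quotient.mk_surjective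
  have h2 := (hloc.map_nonunit _ hu).map MvPowerSeries.constantCoeff
  rw [MvPowerSeries.constantCoeff_X] at h2
  exact not_isUnit_zero h2

/-- The equations of the family and their linearisation along a prime ideal containing the equations
of the jets. -/
theorem exists_equations (hf : Irreducible f) [P.IsPrime]
    (hP : ∀ (k : Fin g) (l : ℕ), l < m + 1 → jetCoeff m (E.familyEquation k) l ∈ P) :
    ∃ (Γ : Fin g → Finset (Fin (g + 1) → ℕ)) (h : Fin g → (Fin (g + 1) → ℕ) → PowerSeries
      (MvPowerSeries (Fin (g + 1) × Fin (m + 1)) (PowerSeries ℂ) ⧸ P)),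
      (∀ k, ∀ γ ∈ Γ k, (∀ j, k.succ < j → γ j = 0) ∧
        ratioSeq E.β k * E.β k.succ < (E.weightData hf).wt γ) ∧
      (∀ k, PowerSeries.X ^ (m + 1) ∣ (E.weightData hf).eqn (jet P)
        (fun k => constHom P (PowerSeries.C (E.c k))) (constHom P PowerSeries.X) Γ h k) ∧
      ∀ ξ, IsTangent P ξ → jetSeries ξ 0 = 0 →
        ∀ k, PowerSeries.X ^ (m + 1) ∣ (E.weightData hf).linearEqn (jet P) (jetSeries ξ)
          (fun k => constHom P (PowerSeries.C (E.c k))) (constHom P PowerSeries.X) Γ h k := by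
  classical
  let A := MvPowerSeries (Fin (g + 1) × Fin (m + 1)) (PowerSeries ℂ)
  let π : PowerSeries A →+* PowerSeries (A ⧸ P) := PowerSeries.map (Ideal.Quotient.mk P)
  let Φ : MvPowerSeries (Fin (g + 1)) (PowerSeries ℂ) →+* PowerSeries A :=
    jetHom (PowerSeries ℂ) m
  let ψ : MvPowerSeries (Fin (g + 1)) ℂ →+* PowerSeries (A ⧸ P) :=
    (π.comp Φ).comp (MvPowerSeries.map (PowerSeries.C (R := ℂ)))
  have hΦX : ∀ i, Φ (MvPowerSeries.X i) = jetSeries MvPowerSeries.X i := jetHom_X m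
  have hΦC : ∀ r, Φ (MvPowerSeries.C r) = PowerSeries.C (MvPowerSeries.C r) := jetHom_C m
  have hπX : ∀ i, π (jetSeries MvPowerSeries.X i) = jet P i := fun i =>
    PowerSeries.map_jetSeries _ _ _
  have hψX : ∀ i, ψ (MvPowerSeries.X i) = jet P i := fun i => by
    simp only [ψ, RingHom.comp_apply, MvPowerSeries.map_X, hΦX, hπX]
  have hπC : ∀ r, π (PowerSeries.C (MvPowerSeries.C r)) = constHom P r := fun r => by
    simp [π, constHom]
  have hdec : ∀ k, ∃ (Γ : Finset (Fin (g + 1) → ℕ))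
      (H : (Fin (g + 1) → ℕ) → MvPowerSeries (Fin (g + 1)) ℂ),
      (∀ γ ∈ Γ, (∀ j, k.succ < j → γ j = 0) ∧
        ratioSeq E.β k * E.β k.succ < (E.weightData hf).wt γ) ∧
      (∀ γ δ, MvPowerSeries.coeff δ (H γ) ≠ 0 → ∀ j, j ≠ 0 → δ j = 0) ∧
      E.P k = ∑ γ ∈ Γ, H γ * monomialEval MvPowerSeries.X γ := by
    intro k
    obtain ⟨Γ, H, h1, h2, h3⟩ := MvPowerSeries.exists_weight_decomposition E.β (E.β_pos 0)
      (ratioSeq E.β k * E.β k.succ)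
      (fun j => if k.succ < j then 1 else Fin.cases 0 (fun i => ratioSeq E.β i) j) (E.P k)
      (fun γ hγ => by
        obtain ⟨h1, h2, h3⟩ := E.P_support k γ hγ
        refine ⟨fun j hj => ?_, h3⟩
        split_ifs with hkj
        · rw [h1 j hkj]; exact one_pos
        · obtain ⟨i, rfl⟩ := Fin.exists_succ_eq.mpr hj
          exact h2 i (by simpa using hkj))
    refine ⟨Γ, H, fun γ hγ => ⟨fun j hj => ?_, (h1 γ hγ).2⟩, h2, h3⟩
    have h4 := (h1 γ hγ).1 j (by rintro rfl; exact not_lt_zero hj)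
    rw [if_pos hj] at h4
    omega
  choose Γ H hΓ hH hdecP using hdec
  have hFam : ∀ k, E.familyEquation k = MvPowerSeries.X k.succ ^ ratioSeq E.β k
      - MvPowerSeries.C (PowerSeries.C (E.c k)) * monomialEval MvPowerSeries.X (E.b k)
      - (∑ γ ∈ Γ k, (MvPowerSeries.C PowerSeries.X * MvPowerSeries.map (PowerSeries.C (R := ℂ)) (H k γ)) *
          monomialEval MvPowerSeries.X γ + MvPowerSeries.C PowerSeries.X * nextEntry MvPowerSeries.X k) := by
    intro k
    rw [familyEquation, hdecP, map_sum, Finset.mul_sum, ← sub_sub]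
    simp only [map_mul, map_monomialEval, MvPowerSeries.map_X, mul_assoc]
    rfl
  have hmem : ∀ k, ∀ l < m + 1, PowerSeries.coeff l (Φ (E.familyEquation k)) ∈ P := by
    intro k l hl
    have h1 := hP k l hl
    rwa [jetCoeff_eq] at h1
  -- The factor `v` of the higher terms is absorbed into their coefficients.
  refine ⟨Γ, fun k γ => constHom P PowerSeries.X * ψ (H k γ), hΓ, fun k => ?_, fun ξ hξ hξ0 k => ?_⟩
  · have h1 : (E.weightData hf).eqn (jet P)
        (fun k => constHom P (PowerSeries.C (E.c k))) (constHom P PowerSeries.X) Γ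
        (fun k γ => constHom P PowerSeries.X * ψ (H k γ)) k = π (Φ (E.familyEquation k)) := by
      rw [hFam]
      simp only [map_sub, map_add, map_mul, map_pow, map_sum, map_monomialEval, map_nextEntry,
        hΦX, hΦC, hπX, hπC]
      rfl
    rw [h1, PowerSeries.X_pow_dvd_iff]
    intro l hl
    rw [PowerSeries.coeff_map]
    exact Ideal.Quotient.eq_zero_iff_mem.mpr (hmem k l hl)
  -- The tangent vector is lifted to a derivation `D` of the ambient ring, which maps `P` into `P`;
  -- applied to the coefficients of the jet equations it yields the linearised equations modulo `P`.
  · choose ξ' hξ' using fun s => Ideal.Quotient.mk_surjective (ξ s)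
    let D := Derivation.intCombination ξ' fun s => MvPowerSeries.pderiv (PowerSeries ℂ) s
    have hDa : ∀ a, D a = ∑ s, ξ' s * MvPowerSeries.pderiv (PowerSeries ℂ) s a := by
      exact Derivation.intCombination_apply _ _
    have hDX : ∀ s, D (MvPowerSeries.X s) = ξ' s := by
      intro s
      rw [hDa, Finset.sum_eq_single s]
      · simp
      · intro t _ ht
        rw [MvPowerSeries.pderiv_X_of_ne ht.symm, mul_zero]
      · simp
    have hDC : ∀ r, D (MvPowerSeries.C r) = 0 := by
      intro r
      rw [hDa]
      simp
    have hDP : ∀ a ∈ P, Ideal.Quotient.mk P (D a) = 0 := by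
      intro a ha
      rw [hDa, map_sum, ← hξ a ha]
      simp only [map_mul, hξ']
    let Δ := D.mapPowerSeries
    have hΔX : ∀ i, π (Δ (Φ (MvPowerSeries.X i))) = jetSeries ξ i := by
      intro i
      rw [hΦX, Derivation.mapPowerSeries_jetSeries]
      simp only [hDX]
      rw [PowerSeries.map_jetSeries]
      simp only [hξ']
    have hΔC : ∀ r, Δ (Φ (MvPowerSeries.C r)) = 0 := by
      intro r
      rw [hΦC]
      ext1 l
      rw [Derivation.coeff_mapPowerSeries, PowerSeries.coeff_C, apply_ite D, hDC]
      simp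
    -- The coefficients `H k γ` involve only `x_0`, so they behave as constants in a direction with
    -- `ξ_0 = 0`.
    have hΔH : ∀ k γ, π (Δ (Φ (MvPowerSeries.map (PowerSeries.C (R := ℂ)) (H k γ)))) = 0 := by
      intro k γ
      refine MvPowerSeries.derivation_eq_zero ψ (((π : PowerSeries A →+ PowerSeries (A ⧸ P)).comp
        (Δ : PowerSeries A →+ PowerSeries A)).comp ((Φ.comp (MvPowerSeries.map
          (PowerSeries.C (R := ℂ)))) : MvPowerSeries (Fin (g + 1)) ℂ →+ PowerSeries A))
        (fun F G => ?_) (fun a => ?_) 0 ?_ ?_ (H k γ) (hH k γ)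
      · simp [ψ, Derivation.leibniz]
      · simp [hΔC]
      · simpa [hΔX] using hξ0
      · rw [hψX, PowerSeries.isUnit_iff_constantCoeff]
        exact (IsLocalRing.mem_maximalIdeal _).mp (constantCoeff_jet P 0)
    have hΔmon : ∀ γ, π (Δ (Φ (monomialEval MvPowerSeries.X γ))) =
        monomialDirDeriv (jet P) (jetSeries ξ) γ := by
      intro γ
      rw [map_monomialEval Φ]
      refine (congrArg π (D.mapPowerSeries_monomialEval _ _)).trans ?_
      rw [map_monomialDirDeriv]
      congr 1
      · ext1 i; rw [hΦX, hπX]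
      · ext1 i; exact hΔX i
    have hΔnext : π (Δ (Φ (nextEntry MvPowerSeries.X k))) = nextEntry (jetSeries ξ) k := by
      unfold nextEntry
      split_ifs
      · exact hΔX _
      · simp
    have hΔp : π (ratioSeq E.β k • (Φ (MvPowerSeries.X k.succ) ^ (ratioSeq E.β k - 1) *
        Δ (Φ (MvPowerSeries.X k.succ)))) = (ratioSeq E.β k : PowerSeries (A ⧸ P)) *
          jet P k.succ ^ (ratioSeq E.β k - 1) * jetSeries ξ k.succ := by
      rw [map_nsmul, map_mul, map_pow, hΔX, hΦX, hπX, nsmul_eq_mul, mul_assoc]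
    have hΦπC : ∀ r, π (Φ (MvPowerSeries.C r)) = constHom P r := fun r => by rw [hΦC, hπC]
    have h1 : (E.weightData hf).linearEqn (jet P) (jetSeries ξ)
        (fun k => constHom P (PowerSeries.C (E.c k))) (constHom P PowerSeries.X) Γ
        (fun k γ => constHom P PowerSeries.X * ψ (H k γ)) k = π (Δ (Φ (E.familyEquation k))) := by
      rw [hFam]
      simp only [map_sub, map_add, map_mul, map_pow, map_sum, Derivation.leibniz, hΔC, smul_eq_mul,
        Derivation.leibniz_pow, mul_zero, add_zero, hΔmon, hΔnext, hΔH, hΔp, hΦπC]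
      rfl
    rw [h1, PowerSeries.X_pow_dvd_iff]
    intro l hl
    rw [PowerSeries.coeff_map, Derivation.coeff_mapPowerSeries]
    exact hDP _ (hmem k l hl)

end Jets

end BranchExpansion

/-! ### Codimension bounds in the jet space -/

/-- The Jacobian criterion for a finite set of derivations over a base ring. -/
theorem Ideal.card_le_height_of_tangent {R A S : Type*} [CommRing R] [CommRing A] [Algebra R A]
    [Algebra ℚ A] [Fintype S] [DecidableEq S] (P : Ideal A) [P.IsPrime] (D : S → Derivation R A A) (U : Finset S)
    (h : ∀ ξ : S → A ⧸ P, (∀ s, s ∉ U → ξ s = 0) →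
      (∀ f ∈ P, ∑ s, ξ s * Ideal.Quotient.mk P (D s f) = 0) → ξ = 0) :
    (U.card : ℕ∞) ≤ P.height := by
  have h1 := Ideal.card_le_height_of_derivations (S := U) P
    (fun s => Derivation.intCombination (fun _ : Unit => 1) fun _ => D s) fun ξ hξ => by
      have h2 := h (fun s => if hs : s ∈ U then ξ ⟨s, hs⟩ else 0)
        (fun s hs => dif_neg hs) fun f hf => by
          refine Eq.trans ?_ (hξ f hf)
          rw [← Finset.sum_subset (Finset.subset_univ U) fun s _ hs => by
            rw [dif_neg hs, zero_mul], ← Finset.sum_coe_sort]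
          refine Finset.sum_congr rfl fun s _ => ?_
          rw [dif_pos s.2, Derivation.intCombination_apply]
          simp
      ext1 s
      have h3 := congrFun h2 s
      simpa using h3
  simpa using h1

namespace BranchExpansion

variable {f : MvPowerSeries (Fin 2) ℂ} {g : ℕ} (E : BranchExpansion f g)

/-- The jet coordinates `x_i^(j)` with `j < a_i`. -/
def initialCoords (g m : ℕ) (a : Fin (g + 1) → ℕ) : Finset (Fin (g + 1) × Fin (m + 1)) :=
  Finset.univ.filter fun s => (s.2 : ℕ) < a s.1

theorem mem_initialCoords {g m : ℕ} {a : Fin (g + 1) → ℕ} {s : Fin (g + 1) × Fin (m + 1)} :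
    s ∈ initialCoords g m a ↔ (s.2 : ℕ) < a s.1 := by
  simp [initialCoords]

theorem card_initialCoords (g m : ℕ) (a : Fin (g + 1) → ℕ) :
    (initialCoords g m a).card = ∑ i, min (a i) (m + 1) := by
  rw [initialCoords, Finset.card_filter, Fintype.sum_prod_type]
  refine Finset.sum_congr rfl fun i _ => ?_
  rw [← Finset.card_filter]
  have h1 : (Finset.univ.filter fun j : Fin (m + 1) => (j : ℕ) < a i).map Fin.valEmbedding =
      Finset.range (min (a i) (m + 1)) := by
    ext j
    simp only [Finset.mem_map, Finset.mem_filter, Finset.mem_univ, true_and, Fin.valEmbedding_apply,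
      Finset.mem_range, lt_min_iff]
    constructor
    · rintro ⟨j, hj, rfl⟩
      exact ⟨hj, j.2⟩
    · rintro ⟨h1, h2⟩
      exact ⟨⟨j, h2⟩, h1, rfl⟩
  rw [← Finset.card_map Fin.valEmbedding, h1, Finset.card_range]

/-- The tangency condition for the coordinate `X s` itself. -/
theorem IsTangent.eq_zero_of_mem {m : ℕ}
    {P : Ideal (MvPowerSeries (Fin (g + 1) × Fin (m + 1)) (PowerSeries ℂ))}
    {ξ : Fin (g + 1) × Fin (m + 1) →
      MvPowerSeries (Fin (g + 1) × Fin (m + 1)) (PowerSeries ℂ) ⧸ P} (hξ : IsTangent P ξ)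
    {s : Fin (g + 1) × Fin (m + 1)} (hs : MvPowerSeries.X s ∈ P) : ξ s = 0 := by
  classical
  have h1 := hξ _ hs
  rw [Finset.sum_eq_single s] at h1
  · simpa using h1
  · intro t _ ht
    rw [MvPowerSeries.pderiv_X_of_ne ht.symm, map_zero, mul_zero]
  · simp

theorem card_initialCoords_le_height {m : ℕ}
    (P : Ideal (MvPowerSeries (Fin (g + 1) × Fin (m + 1)) (PowerSeries ℂ))) [P.IsPrime]
    (a : Fin (g + 1) → ℕ)
    (h : ∀ ξ, IsTangent P ξ → (∀ s, s ∉ initialCoords g m a → ξ s = 0) → ξ = 0) :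
    ((∑ i, min (a i) (m + 1) : ℕ) : ℕ∞) ≤ P.height := by
  rw [← card_initialCoords]
  exact Ideal.card_le_height_of_tangent P (fun s => MvPowerSeries.pderiv (PowerSeries ℂ) s) _
    fun ξ h1 h2 => h ξ h2 h1

/-- The ideal of the power series ring vanishing on the jets with orders at least `a` in the special
fibre. -/
noncomputable def specialIdeal (g m : ℕ) (a : Fin (g + 1) → ℕ) :
    Ideal (MvPowerSeries (Fin (g + 1) × Fin (m + 1)) (PowerSeries ℂ)) :=
  Ideal.span (insert (MvPowerSeries.C PowerSeries.X) (MvPowerSeries.X '' (initialCoords g m a : Set _)))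

theorem specialIdeal_ne_top (g m : ℕ) (a : Fin (g + 1) → ℕ) : specialIdeal g m a ≠ ⊤ := by
  let φ : MvPowerSeries (Fin (g + 1) × Fin (m + 1)) (PowerSeries ℂ) →+* ℂ :=
    (PowerSeries.constantCoeff (R := ℂ)).comp MvPowerSeries.constantCoeff
  intro h
  have h1 : specialIdeal g m a ≤ RingHom.ker φ := by
    rw [specialIdeal, Ideal.span_le]
    intro x hx
    rcases hx with rfl | hx
    · simp [φ]
    · obtain ⟨s, -, rfl⟩ := hx
      simp [φ]
  rw [h, top_le_iff] at h1
  exact RingHom.ker_ne_top φ h1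

/-- Modulo `v` only the binomial remains, and `h1`, `h2` say that each of its monomials has order at
least `m + 1` on jets with `ord x_i ≥ a_i`. -/
theorem jetCoeff_mem_specialIdeal (m : ℕ) (a : Fin (g + 1) → ℕ)
    (h1 : ∀ k, m + 1 ≤ ratioSeq E.β k * a k.succ) (h2 : ∀ k, m + 1 ≤ ∑ j, E.b k j * a j)
    (k : Fin g) (l : ℕ) (hl : l < m + 1) :
    jetCoeff m (E.familyEquation k) l ∈ specialIdeal g m a := by
  set J := specialIdeal g m a with hJ
  let A := MvPowerSeries (Fin (g + 1) × Fin (m + 1)) (PowerSeries ℂ)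
  let ψ : MvPowerSeries (Fin (g + 1)) (PowerSeries ℂ) →+* PowerSeries (A ⧸ J) :=
    (PowerSeries.map (Ideal.Quotient.mk J)).comp (jetHom (PowerSeries ℂ) m)
  have hv : ψ (MvPowerSeries.C PowerSeries.X) = 0 := by
    simp only [ψ, RingHom.comp_apply, jetHom_C, PowerSeries.map_C]
    have h0 : (MvPowerSeries.C PowerSeries.X : A) ∈ J := Ideal.subset_span (Set.mem_insert _ _)
    rw [Ideal.Quotient.eq_zero_iff_mem.mpr h0, map_zero]
  have hX : ∀ i, PowerSeries.X ^ (min (a i) (m + 1)) ∣ ψ (MvPowerSeries.X i) := by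
    intro i
    rw [PowerSeries.X_pow_dvd_iff]
    intro j hj
    simp only [ψ, RingHom.comp_apply, jetHom_X, PowerSeries.map_jetSeries]
    rw [coeff_jetSeries, dif_pos (lt_min_iff.mp hj).2]
    refine Ideal.Quotient.eq_zero_iff_mem.mpr ?_
    rw [hJ, specialIdeal]
    exact Ideal.subset_span (Set.mem_insert_of_mem _ (Set.mem_image_of_mem _
      (mem_initialCoords.mpr (lt_min_iff.mp hj).1)))
  have hX' : ∀ i (n : ℕ), PowerSeries.X ^ (min (a i) (m + 1) * n) ∣ ψ (MvPowerSeries.X i) ^ n := by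
    intro i n
    rw [pow_mul]
    exact pow_dvd_pow_of_dvd (hX i) n
  -- Truncating `a i` at `m + 1` loses nothing: a single factor of order `m + 1` already suffices.
  have hmin : ∀ (n : ℕ) (i : Fin (g + 1)), n ≠ 0 → m + 1 ≤ min (a i) (m + 1) * n ∨
      min (a i) (m + 1) = a i := by
    intro n i hn
    rcases le_total (a i) (m + 1) with h | h
    · exact Or.inr (min_eq_left h)
    · rw [min_eq_right h]
      exact Or.inl (Nat.le_mul_of_pos_right _ (Nat.pos_of_ne_zero hn))
  have hdvd : PowerSeries.X ^ (m + 1) ∣ ψ (E.familyEquation k) := by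
    rw [familyEquation]
    simp only [map_sub, map_mul, hv, zero_mul, sub_zero, map_pow]
    refine dvd_sub ?_ (Dvd.dvd.mul_left ?_ _)
    · refine (pow_dvd_pow _ ?_).trans (hX' _ _)
      rcases hmin (ratioSeq E.β k) k.succ (by have := E.two_le_ratioSeq k; omega) with h | h
      · exact h
      · rw [h, mul_comm]; exact h1 k
    · simp only [map_prod, map_pow]
      refine (pow_dvd_pow _ ?_).trans (b := PowerSeries.X ^ ∑ j, min (a j) (m + 1) * E.b k j) ?_
      · by_cases hall : ∀ j, E.b k j ≠ 0 → min (a j) (m + 1) = a j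
        · refine (h2 k).trans (Finset.sum_le_sum fun j _ => ?_)
          rcases eq_or_ne (E.b k j) 0 with h0 | h0
          · simp [h0]
          · rw [hall j h0, mul_comm]
        · push Not at hall
          obtain ⟨j, hj, hj2⟩ := hall
          refine ((hmin _ j hj).resolve_right hj2).trans ?_
          exact Finset.single_le_sum (f := fun j => min (a j) (m + 1) * E.b k j)
            (fun _ _ => Nat.zero_le _) (Finset.mem_univ j)
      · rw [← Finset.prod_pow_eq_pow_sum]
        exact Finset.prod_dvd_prod_of_dvd _ _ fun j _ => hX' j _
  rw [jetCoeff_eq, ← Ideal.Quotient.eq_zero_iff_mem]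
  have h3 := PowerSeries.X_pow_dvd_iff.mp hdvd l hl
  simpa [ψ] using h3

/-- If the relative jet scheme is flat, then below every family of jets in the special fibre there
is a component meeting the generic fibre, of at most the expected codimension. -/
theorem exists_isPrime_of_flat (m : ℕ) (hflat : Module.Flat (PowerSeries ℂ) (E.FamilyJetRing m))
    (a : Fin (g + 1) → ℕ) (h1 : ∀ k, m + 1 ≤ ratioSeq E.β k * a k.succ)
    (h2 : ∀ k, m + 1 ≤ ∑ j, E.b k j * a j) :
    ∃ P : Ideal (MvPowerSeries (Fin (g + 1) × Fin (m + 1)) (PowerSeries ℂ)), P.IsPrime ∧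
      (∀ (k : Fin g) (l : ℕ), l < m + 1 → jetCoeff m (E.familyEquation k) l ∈ P) ∧
      MvPowerSeries.C PowerSeries.X ∉ P ∧ P.height ≤ (∑ i, min (a i) (m + 1) : ℕ) := by
  classical
  obtain ⟨P, hP, hIP, hv, hht⟩ := Ideal.exists_isPrime_height_le_card
    (Ideal.span (Set.range (fun p : Fin g × Fin (m + 1) =>
      jetCoeff m (E.familyEquation p.1) (p.2 : ℕ)))) (MvPowerSeries.C PowerSeries.X)
    (fun x hx => by
      have hreg : IsSMulRegular (E.FamilyJetRing m) (PowerSeries.X : PowerSeries ℂ) :=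
        Module.Flat.isSMulRegular_of_nonZeroDivisors
          (mem_nonZeroDivisors_of_ne_zero PowerSeries.X_ne_zero)
      rw [← Ideal.Quotient.eq_zero_iff_mem] at hx ⊢
      refine hreg ?_
      dsimp only
      rw [smul_zero, ← hx, map_mul]
      exact Algebra.smul_def (A := E.FamilyJetRing m) _ _)
    ((initialCoords g m a).image MvPowerSeries.X)
    (by rw [Finset.coe_image]; exact specialIdeal_ne_top g m a) (by
      rw [Ideal.span_le, Finset.coe_image]
      rintro _ ⟨p, rfl⟩
      exact E.jetCoeff_mem_specialIdeal m a h1 h2 p.1 p.2 p.2.2)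
  refine ⟨P, hP, fun k l hl => hIP (Ideal.subset_span ⟨(k, ⟨l, hl⟩), rfl⟩), hv, hht.trans ?_⟩
  rw [← card_initialCoords]
  exact_mod_cast Finset.card_image_le

end BranchExpansion

/-! ### Lower bounds on the generic fibre in terms of orders -/

namespace PowerSeries

variable {T : Type*} [CommRing T]

theorem X_pow_dvd_iff_le_order {n : ℕ} {p : PowerSeries T} : X ^ n ∣ p ↔ (n : ℕ∞) ≤ p.order := by
  rw [order_eq_emultiplicity_X, pow_dvd_iff_le_emultiplicity]

theorem X_pow_dvd_pow_iff [IsDomain T] {p : PowerSeries T} {w n r : ℕ} (hw : p.order = w) :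
    X ^ r ∣ p ^ n ↔ r ≤ n * w := by
  rw [X_pow_dvd_iff_le_order, order_pow, hw, nsmul_eq_mul]
  exact_mod_cast Iff.rfl

theorem X_pow_dvd_of_dvd_mul [IsDomain T] {p q : PowerSeries T} {w r s : ℕ} (hw : p.order = w)
    (h : X ^ r ∣ p * q) (hs : s + w ≤ r) : X ^ s ∣ q := by
  rw [X_pow_dvd_iff_le_order, order_mul, hw] at h
  rw [X_pow_dvd_iff_le_order]
  have h1 : ((s : ℕ∞) + w) ≤ w + q.order := le_trans (by exact_mod_cast hs) h
  rw [add_comm] at h1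
  exact (ENat.add_le_add_iff_left (ENat.natCast_ne_top w)).mp h1

theorem exists_order_eq {p : PowerSeries T} (hp : p ≠ 0) : ∃ w : ℕ, p.order = w :=
  ⟨_, (coe_toNat_order hp).symm⟩

end PowerSeries

namespace WeightData

variable {g : ℕ} {W : WeightData g} {T : Type} [CommRing T] {N : ℕ}
  {x ξ : Fin (g + 1) → PowerSeries T} {c : Fin g → PowerSeries T} {v : PowerSeries T}
  {Γ : Fin g → Finset (Fin (g + 1) → ℕ)} {h : Fin g → (Fin (g + 1) → ℕ) → PowerSeries T}

theorem linearEqn_eq_of_eq_zero (hΓ : ∀ k, ∀ γ ∈ Γ k, ∀ j, k.succ < j → γ j = 0) {k : Fin g}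
    (hξ : ∀ j, j ≤ k.succ → ξ j = 0) : W.linearEqn x ξ c v Γ h k = -(v * nextEntry ξ k) := by
  have h1 : monomialDirDeriv x ξ (W.b k) = 0 := monomialDirDeriv_eq_zero _ _ _ fun j hj => by
    refine hξ j (not_lt.mp fun hlt => hj (W.b_eq_zero k j (Fin.castSucc_lt_succ.trans hlt)))
  have h2 : ∀ γ ∈ Γ k, h k γ * monomialDirDeriv x ξ γ = 0 := fun γ hγ => by
    rw [monomialDirDeriv_eq_zero _ _ _ fun j hj => hξ j (not_lt.mp fun hlt => hj (hΓ k γ hγ j hlt)),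
      mul_zero]
  rw [linearEqn, h1, Finset.sum_eq_zero h2, hξ _ le_rfl]
  ring

/-- Once `ξ_0 = ξ_1 = 0`, the equations kill the other `ξ_i` successively: with all earlier entries
zero, row `k` reads `-v ξ_{k+2} ≡ 0`, and `v` is cancellable. Thus `x_0, x_1` are local coordinates
for the generic fibre. -/
theorem eq_zero_of_linearEqn (hΓ : ∀ k, ∀ γ ∈ Γ k, ∀ j, k.succ < j → γ j = 0)
    (hv : ∀ p, PowerSeries.X ^ N ∣ v * p → PowerSeries.X ^ N ∣ p)
    (hlin : ∀ k, PowerSeries.X ^ N ∣ W.linearEqn x ξ c v Γ h k)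
    (h01 : ∀ i : Fin (g + 1), (i : ℕ) < 2 → ξ i = 0)
    (h2 : ∀ i : Fin (g + 1), 2 ≤ (i : ℕ) → PowerSeries.X ^ N ∣ ξ i → ξ i = 0) : ξ = 0 := by
  have key : ∀ n : ℕ, ∀ i : Fin (g + 1), (i : ℕ) = n → ξ i = 0 := by
    intro n
    induction n using Nat.strong_induction_on with
    | _ n ih =>
      intro i hi
      rcases Nat.lt_or_ge n 2 with hn | hn
      · exact h01 i (hi ▸ hn)
      · have hk : n - 2 < g := by omega
        have h3 := hlin ⟨n - 2, hk⟩
        rw [linearEqn_eq_of_eq_zero hΓ fun j hj => ih j (by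
          rw [Fin.le_def] at hj
          simp only [Fin.val_succ] at hj
          omega) j rfl, dvd_neg] at h3
        have h4 : nextEntry ξ ⟨n - 2, hk⟩ = ξ i := by
          rw [nextEntry, dif_pos (by simp only; omega)]
          exact congrArg ξ (Fin.ext (by simp only; omega))
        rw [h4] at h3
        exact h2 i (hi ▸ hn) (hv _ h3)
  ext1 i
  exact key i i rfl

/-- Power series `x` over a local domain satisfying the equations of the family modulo `X ^ N`. -/
structure IsTruncatedSolution [IsLocalRing T] (W : WeightData g) (N : ℕ)
    (x : Fin (g + 1) → PowerSeries T)
    (c : Fin g → PowerSeries T) (v : PowerSeries T) (Γ : Fin g → Finset (Fin (g + 1) → ℕ))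
    (h : Fin g → (Fin (g + 1) → ℕ) → PowerSeries T) : Prop where
  mem_maximalIdeal : ∀ i, PowerSeries.constantCoeff (x i) ∈ IsLocalRing.maximalIdeal T
  isUnit : ∀ k, IsUnit (c k)
  dvd_of_dvd_mul : ∀ p, PowerSeries.X ^ N ∣ v * p → PowerSeries.X ^ N ∣ p
  eq_zero : ∀ k, ∀ γ ∈ Γ k, ∀ j, k.succ < j → γ j = 0
  lt_wt : ∀ k, ∀ γ ∈ Γ k, W.n k * W.β k.succ < W.wt γ
  dvd_eqn : ∀ k, PowerSeries.X ^ N ∣ W.eqn x c v Γ h k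

/-- Vectors `ξ` killed by the linearised equations, and by all coordinates which vanish along `x`. -/
structure IsTruncatedTangent (W : WeightData g) (N : ℕ)
    (x : Fin (g + 1) → PowerSeries T)
    (c : Fin g → PowerSeries T) (v : PowerSeries T) (Γ : Fin g → Finset (Fin (g + 1) → ℕ))
    (h : Fin g → (Fin (g + 1) → ℕ) → PowerSeries T) (ξ : Fin (g + 1) → PowerSeries T) : Prop where
  dvd_of_dvd : ∀ i r, r ≤ N → PowerSeries.X ^ r ∣ x i → PowerSeries.X ^ r ∣ ξ i
  dvd_linearEqn : ξ 0 = 0 → ∀ k, PowerSeries.X ^ N ∣ W.linearEqn x ξ c v Γ h k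

section

variable [IsLocalRing T] [IsDomain T]

/-- Where the orders of the coordinates are proportional to the weights, the linearised equations
determine the coordinates of high degree. -/
theorem exists_orders_of_balanced (hx : ∀ i, x i ≠ 0)
    (hbal : ∀ i j r, PowerSeries.X ^ r ∣ x i ^ W.β j → PowerSeries.X ^ r ∣ x j ^ W.β i)
    (hN : ∀ k, ¬ PowerSeries.X ^ N ∣ x k.succ ^ W.n k)
    (hker : ∀ ξ : Fin (g + 1) → PowerSeries T, ξ 0 = 0 → ξ ≠ 0 →
        (∀ k, PowerSeries.X ^ N ∣ W.linearEqn x ξ c v Γ h k) →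
        ∃ k, ξ k.succ ≠ 0 ∧ PowerSeries.X ^ N ∣ x k.succ ^ (W.n k - 1) * ξ k.succ) :
    ∃ w : Fin (g + 1) → ℕ, (∀ i, (x i).order = w i) ∧ (∀ i j, w i * W.β j = w j * W.β i) ∧
      (∀ k, W.n k * w k.succ < N) ∧ ∀ ξ : Fin (g + 1) → PowerSeries T, ξ 0 = 0 →
        (∀ k, PowerSeries.X ^ N ∣ W.linearEqn x ξ c v Γ h k) →
        (∀ k : Fin g, PowerSeries.X ^ (w k.succ + (N - W.n k * w k.succ)) ∣ ξ k.succ →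
          ξ k.succ = 0) → ξ = 0 := by
  choose w hw using fun i => PowerSeries.exists_order_eq (hx i)
  have hle : ∀ i j, w i * W.β j ≤ w j * W.β i := fun i j => by
    have h1 := hbal i j (W.β j * w i) ((PowerSeries.X_pow_dvd_pow_iff (hw i)).mpr le_rfl)
    rw [PowerSeries.X_pow_dvd_pow_iff (hw j)] at h1
    linarith [mul_comm (w i) (W.β j), mul_comm (w j) (W.β i)]
  have hlt : ∀ k, W.n k * w k.succ < N := fun k => by
    have h1 := hN k
    rwa [PowerSeries.X_pow_dvd_pow_iff (hw _), not_le] at h1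
  refine ⟨w, hw, fun i j => le_antisymm (hle i j) (hle j i), hlt, fun ξ h0 hlin hdeg => ?_⟩
  by_contra hne
  obtain ⟨k, hk, hdvd⟩ := hker ξ h0 hne hlin
  -- Cancelling `x_{k+1} ^ (n_k - 1)`, of order `(n_k - 1) w`, from a multiple of `X ^ N` leaves
  -- exactly the exponent `w + (N - n_k w)`.
  refine hk (hdeg k (PowerSeries.X_pow_dvd_of_dvd_mul (w := (W.n k - 1) * w k.succ) ?_ hdvd ?_))
  · rw [PowerSeries.order_pow, hw, nsmul_eq_mul]
    push_cast
    rfl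
  · have h2 := W.two_le k
    obtain ⟨n, hn⟩ : ∃ n, W.n k = n + 1 := ⟨W.n k - 1, by omega⟩
    have h3 := hlt k
    rw [hn] at h3 ⊢
    simp only [Nat.add_sub_cancel]
    have h4 : (n + 1) * w k.succ = n * w k.succ + w k.succ := by ring
    omega

variable [Algebra ℚ T]

/-- The codimension bound used when there are at least three equations. -/
theorem exists_orders_of_lt (hs : W.IsTruncatedSolution N x c v Γ h) (hg : 0 < g) (hN : 2 ≤ N) :
    ∃ a : Fin (g + 1) → ℕ, (∀ ξ, W.IsTruncatedTangent N x c v Γ h ξ →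
      (∀ i, PowerSeries.X ^ a i ∣ ξ i → ξ i = 0) → ξ = 0) ∧
      (g - 1) * N + 2 ≤ ∑ i, min (a i) N := by
  -- If the constant terms of `x_0` and `x_1` vanish, so do those of `ξ_0` and `ξ_1`, and
  -- elimination handles the rest: `a = (1, 1, N, …, N)`.
  by_cases h01 : ∀ i : Fin (g + 1), (i : ℕ) < 2 → PowerSeries.X ^ 1 ∣ x i
  · refine ⟨fun i => if (i : ℕ) < 2 then 1 else N, fun ξ hξ ha => ?_, ?_⟩
    · have h0 : ∀ i : Fin (g + 1), (i : ℕ) < 2 → ξ i = 0 := fun i hi => by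
        refine ha i ?_
        dsimp only
        rw [if_pos hi]
        exact hξ.dvd_of_dvd i 1 (by omega) (h01 i hi)
      refine eq_zero_of_linearEqn hs.eq_zero hs.dvd_of_dvd_mul
        (hξ.dvd_linearEqn (h0 0 (by simp))) h0 fun i hi hdvd => ha i ?_
      dsimp only
      rwa [if_neg (by omega)]
    · obtain ⟨g, rfl⟩ : ∃ g', g = g' + 1 := ⟨g - 1, by omega⟩
      rw [Fin.sum_univ_succ, Fin.sum_univ_succ]
      simp
      omega
  · rcases W.jet_alternative hg N x hs.mem_maximalIdeal c hs.isUnit v Γ hs.lt_wt h hs.dvd_eqn with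
      ⟨k, hk⟩ | ⟨hx, hbal, hNk, hker⟩
    · refine absurd (fun i _ => ?_) h01
      have h1 : PowerSeries.X ∣ x i ^ (W.n k * W.β k.succ) :=
        (dvd_pow_self _ (Nat.mul_pos (by omega) (W.pos i)).ne').trans (hk i)
      rw [pow_one]
      exact PowerSeries.X_prime.dvd_of_dvd_pow h1
    · obtain ⟨w, hw, hprop, hlt, hker'⟩ := exists_orders_of_balanced hx hbal hNk hker
      -- One vanishing order forces all to vanish, by proportionality. Then the kernel statement
      -- applies with `a = (0, N, …, N)`, of sum `g N ≥ (g - 1) N + 2` because `N ≥ 2`.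
      have hw0 : ∀ i, w i = 0 := by
        push Not at h01
        obtain ⟨i, hi, hi2⟩ := h01
        have h1 : w i = 0 := by
          rw [PowerSeries.X_pow_dvd_iff_le_order, hw, not_le] at hi2
          have : w i < 1 := by exact_mod_cast hi2
          omega
        intro j
        have h2 := hprop j i
        rw [h1, zero_mul] at h2
        exact (Nat.mul_eq_zero.mp h2).resolve_right (W.pos i).ne'
      refine ⟨fun i => if i = 0 then 0 else N, fun ξ hξ ha => ?_, ?_⟩
      · have h0 : ξ 0 = 0 := ha 0 (by simp)
        refine hker' ξ h0 (hξ.dvd_linearEqn h0) fun k hk => ha k.succ ?_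
        dsimp only
        rw [if_neg (Fin.succ_ne_zero k)]
        simpa [hw0] using hk
      · obtain ⟨g, rfl⟩ : ∃ g', g = g' + 1 := ⟨g - 1, by omega⟩
        rw [Fin.sum_univ_succ]
        simp
        nlinarith

end

end WeightData

/-! ### Forgetting the last coordinate -/

namespace WeightData

variable {g : ℕ} {W : WeightData (g + 1)} {R : Type*} [CommRing R]

/-- The numerical data without the last generator. -/
def truncate (W : WeightData (g + 1)) : WeightData g where
  β i := W.β i.castSucc
  n k := W.n k.castSucc
  b k j := W.b k.castSucc j.castSucc
  pos i := W.pos _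
  two_le k := W.two_le _
  b_eq_zero k j hj := W.b_eq_zero _ _ (by simpa using hj)
  b_sum k := by
    have h1 := W.b_sum k.castSucc
    rw [Fin.sum_univ_castSucc, W.b_eq_zero k.castSucc (Fin.last _) (by simp [Fin.lt_def]), zero_mul,
      add_zero] at h1
    exact h1
  lt_next k k' hk := W.lt_next k.castSucc k'.castSucc (by simpa using hk)

theorem monomialEval_castSucc (x : Fin (g + 2) → R) {γ : Fin (g + 2) → ℕ}
    (hγ : γ (Fin.last _) = 0) :
    monomialEval (fun i : Fin (g + 1) => x i.castSucc) (fun i => γ i.castSucc) = monomialEval x γ := by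
  simp [monomialEval, Fin.prod_univ_castSucc (n := g + 1), hγ]

theorem monomialDirDeriv_castSucc (x ξ : Fin (g + 2) → R) {γ : Fin (g + 2) → ℕ}
    (hγ : γ (Fin.last _) = 0) :
    monomialDirDeriv (fun i : Fin (g + 1) => x i.castSucc) (fun i => ξ i.castSucc)
      (fun i => γ i.castSucc) = monomialDirDeriv x ξ γ := by
  rw [monomialDirDeriv, monomialDirDeriv, Fin.sum_univ_castSucc (n := g + 1), hγ]
  simp only [Nat.cast_zero, zero_mul, add_zero]
  refine Finset.sum_congr rfl fun i _ => ?_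
  congr 1
  congr 1
  rw [← monomialEval_castSucc]
  · congr 1
    ext j
    rcases eq_or_ne j i with rfl | hj
    · simp
    · rw [Function.update_of_ne hj, Function.update_of_ne (by simpa using hj)]
  · rw [Function.update_of_ne (Fin.castSucc_lt_last i).ne', hγ]

/-- The last coordinate enters the truncated system only through the term `v x_{k+2}` of its last
row, so dropping it is harmless modulo anything dividing that coordinate. -/
theorem dvd_sub_nextEntry_castSucc (y : Fin (g + 2) → R) (a : R) (ha : a ∣ y (Fin.last _)) (k : Fin g) :
    a ∣ nextEntry y k.castSucc - nextEntry (fun i : Fin (g + 1) => y i.castSucc) k := by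
  unfold nextEntry
  split_ifs with h1 h2 h2
  · simp
  · have h3 : (⟨(k.castSucc : ℕ) + 2, h1⟩ : Fin (g + 2)) = Fin.last _ := by
      ext
      simp only [Fin.val_castSucc, Fin.val_last] at h1 ⊢
      omega
    rw [h3, sub_zero]
    exact ha
  · simp only [Fin.val_castSucc] at h1
    omega
  · simp

/-- The higher order terms in the first equations, as functions of the first coordinates. -/
def truncateSupport (Γ : Fin (g + 1) → Finset (Fin (g + 2) → ℕ)) (k : Fin g) :
    Finset (Fin (g + 1) → ℕ) :=
  (Γ k.castSucc).image fun γ i => γ i.castSucc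

variable {x ξ : Fin (g + 2) → R} {c : Fin (g + 1) → R} {v : R}
  {Γ : Fin (g + 1) → Finset (Fin (g + 2) → ℕ)} {h : Fin (g + 1) → (Fin (g + 2) → ℕ) → R}

theorem sum_truncateSupport {M : Type*} [AddCommMonoid M] {k : Fin g}
    (hΓ : ∀ γ ∈ Γ k.castSucc, γ (Fin.last _) = 0)
    (F : (Fin (g + 2) → ℕ) → M) (G : (Fin (g + 1) → ℕ) → M)
    (hFG : ∀ γ ∈ Γ k.castSucc, G (fun i => γ i.castSucc) = F γ) :
    ∑ γ ∈ truncateSupport Γ k, G γ = ∑ γ ∈ Γ k.castSucc, F γ := by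
  rw [truncateSupport, Finset.sum_image]
  · exact Finset.sum_congr rfl hFG
  · intro γ hγ δ hδ hγδ
    ext i
    refine Fin.lastCases ?_ (fun j => ?_) i
    · rw [hΓ γ hγ, hΓ δ hδ]
    · exact congrFun hγδ j

theorem snoc_castSucc_eq {γ : Fin (g + 2) → ℕ} (hγ : γ (Fin.last _) = 0) :
    (Fin.snoc (α := fun _ => ℕ) (fun i : Fin (g + 1) => γ i.castSucc) 0) = γ := by
  ext i
  refine Fin.lastCases ?_ (fun j => ?_) i
  · simp [hγ]
  · simp

/-- Allows `jet_alternative` to be applied again to the shorter system, modulo a power of `X`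
dividing the last coordinate. -/
theorem dvd_truncate_eqn {k : Fin g} (hΓ : ∀ γ ∈ Γ k.castSucc, γ (Fin.last _) = 0) {a : R}
    (ha : a ∣ x (Fin.last _)) (hk : a ∣ W.eqn x c v Γ h k.castSucc) :
    a ∣ W.truncate.eqn (fun i => x i.castSucc) (fun k => c k.castSucc) v (truncateSupport Γ)
      (fun k γ => h k.castSucc (Fin.snoc (α := fun _ => ℕ) γ 0)) k := by
  have h1 := sum_truncateSupport hΓ (fun γ => h k.castSucc γ * monomialEval x γ)
    (fun γ => h k.castSucc (Fin.snoc (α := fun _ => ℕ) γ 0) * monomialEval (fun i => x i.castSucc) γ)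
    fun γ hγ => by rw [snoc_castSucc_eq (hΓ γ hγ), monomialEval_castSucc x (hΓ γ hγ)]
  have h2 : monomialEval (fun i => x i.castSucc) (W.truncate.b k) = monomialEval x (W.b k.castSucc) :=
    monomialEval_castSucc x (W.b_eq_zero _ _ (by simp [Fin.lt_def]))
  have h3 := dvd_add hk ((dvd_sub_nextEntry_castSucc x a ha k).mul_left v)
  convert h3 using 1
  rw [eqn, eqn, higherTerms, higherTerms, h1, h2]
  have h4 : W.truncate.n k = W.n k.castSucc := rfl
  rw [h4, Fin.succ_castSucc]
  ring

theorem dvd_truncate_linearEqn {k : Fin g} (hΓ : ∀ γ ∈ Γ k.castSucc, γ (Fin.last _) = 0) {a : R}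
    (ha : a ∣ ξ (Fin.last _)) (hk : a ∣ W.linearEqn x ξ c v Γ h k.castSucc) :
    a ∣ W.truncate.linearEqn (fun i => x i.castSucc) (fun i => ξ i.castSucc)
      (fun k => c k.castSucc) v (truncateSupport Γ)
      (fun k γ => h k.castSucc (Fin.snoc (α := fun _ => ℕ) γ 0)) k := by
  have h1 := sum_truncateSupport hΓ (fun γ => h k.castSucc γ * monomialDirDeriv x ξ γ)
    (fun γ => h k.castSucc (Fin.snoc (α := fun _ => ℕ) γ 0) *
      monomialDirDeriv (fun i => x i.castSucc) (fun i => ξ i.castSucc) γ)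
    fun γ hγ => by rw [snoc_castSucc_eq (hΓ γ hγ), monomialDirDeriv_castSucc x ξ (hΓ γ hγ)]
  have h2 : monomialDirDeriv (fun i => x i.castSucc) (fun i => ξ i.castSucc) (W.truncate.b k) =
      monomialDirDeriv x ξ (W.b k.castSucc) :=
    monomialDirDeriv_castSucc x ξ (W.b_eq_zero _ _ (by simp [Fin.lt_def]))
  have h3 := dvd_add hk ((dvd_sub_nextEntry_castSucc ξ a ha k).mul_left v)
  convert h3 using 1
  rw [linearEqn, linearEqn, h1, h2]
  have h4 : W.truncate.n k = W.n k.castSucc := rfl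
  rw [h4, Fin.succ_castSucc]
  ring

theorem truncate_wt {γ : Fin (g + 2) → ℕ} (hγ : γ (Fin.last _) = 0) :
    W.truncate.wt (fun i => γ i.castSucc) = W.wt γ := by
  rw [wt, wt, Fin.sum_univ_castSucc (n := g + 1), hγ]
  simp [truncate]

end WeightData

/-! ### Order estimates for two equations -/

namespace WeightData

variable {W : WeightData 2} {T : Type} [CommRing T] {N : ℕ}
  {x : Fin 3 → PowerSeries T} {c : Fin 2 → PowerSeries T} {v : PowerSeries T}
  {Γ : Fin 2 → Finset (Fin 3 → ℕ)} {h : Fin 2 → (Fin 3 → ℕ) → PowerSeries T}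

theorem first_relation (W : WeightData 2) : W.n 0 * W.β 1 = W.b 0 0 * W.β 0 := by
  have h1 := W.b_sum 0
  rw [Fin.sum_univ_three, W.b_eq_zero 0 1 (by decide), W.b_eq_zero 0 2 (by decide)] at h1
  simpa using h1

/-- With `D = w₂ - n w₁` and `B = N - n' w₂`, the right side minus the left is `(q n - n - q) n' D +
(q n n' - n - q) B`, nonnegative since `q ≥ 3` and `n, n' ≥ 2`. -/
theorem orders_inequality_balanced {N n n' q w₀ w₁ w₂ : ℕ} (hn : 2 ≤ n) (hn' : 2 ≤ n') (hq : 3 ≤ q)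
    (h01 : n * w₁ = q * w₀) (h12 : n * w₁ ≤ w₂) (h2 : n' * w₂ < N) :
    N * (q * n * n' + n + q) ≤
      q * n * n' * (w₀ + (w₁ + (N - n * w₁)) + (w₂ + (N - n' * w₂))) := by
  have h3 : n * w₁ ≤ N := by nlinarith
  obtain ⟨A, hA⟩ := Nat.exists_eq_add_of_le h3
  obtain ⟨B, hB⟩ := Nat.exists_eq_add_of_le h2.le
  obtain ⟨D, hD⟩ := Nat.exists_eq_add_of_le h12
  have hA' : N - n * w₁ = A := by omega
  have hB' : N - n' * w₂ = B := by omega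
  rw [hA', hB']
  zify at *
  have hS : (0 : ℤ) ≤ q * n - n - q := by nlinarith
  have hS' : (0 : ℤ) ≤ q * n * n' - n - q := by nlinarith
  have e1 : (A : ℤ) = N - n * w₁ := by linarith
  have e2 : (B : ℤ) = N - n' * w₂ := by linarith
  have e3 : (q * n * n' * (w₀ + (w₁ + A) + (w₂ + B)) - N * (q * n * n' + n + q) : ℤ) =
      (q * n - n - q) * n' * D + B * (q * n * n' - n - q) := by
    rw [e1, e2]
    have e4 : (D : ℤ) = w₂ - n * w₁ := by linarith
    rw [e4]
    linear_combination (-(n : ℤ) * n') * h01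
  have h4 : (0 : ℤ) ≤ (q * n - n - q) * n' * D + B * (q * n * n' - n - q) := by positivity
  linarith

/-- With `D = L - n w₁`, the plane part satisfies `q n (w₀ + w₁ + D) - L (n + q) = D (q n - n - q) ≥
0`; then `N ≤ n' L` is inserted. -/
theorem orders_inequality_partial {N L n n' q w₀ w₁ : ℕ} (hn : 2 ≤ n) (hq : 3 ≤ q)
    (h01 : n * w₁ = q * w₀) (h1 : n * w₁ < L) (hL : N ≤ n' * L) :
    N * (q * n * n' + n + q) ≤ q * n * n' * (w₀ + (w₁ + (L - n * w₁)) + N) := by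
  obtain ⟨D, hD⟩ := Nat.exists_eq_add_of_le h1.le
  have hD' : L - n * w₁ = D := by omega
  rw [hD']
  have h2 : N * (n + q) ≤ (n' * L) * (n + q) := Nat.mul_le_mul_right _ hL
  have h3 : L * (n + q) ≤ q * n * (w₀ + (w₁ + D)) := by
    rw [hD]
    zify at *
    have hS : (0 : ℤ) ≤ q * n - n - q := by nlinarith
    have h5 : (q * n * (w₀ + (w₁ + D)) - (n * w₁ + D) * (n + q) : ℤ) = D * (q * n - n - q) := by
      linear_combination (-(n : ℤ)) * h01
    have h6 : (0 : ℤ) ≤ D * (q * n - n - q) := by positivity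
    linarith
  have h4 := Nat.mul_le_mul_left n' h3
  nlinarith

/-- The case where the bound can be sharp: equality holds when `q w₀ = n w₁ = L` and `n' L = N`. -/
theorem orders_inequality_small {N L n n' q w₀ w₁ : ℕ} (h0 : L ≤ q * w₀) (h1 : L ≤ n * w₁)
    (hL : N ≤ n' * L) : N * (q * n * n' + n + q) ≤ q * n * n' * (w₀ + w₁ + N) := by
  have h2 : N * (n + q) ≤ (n' * L) * (n + q) := Nat.mul_le_mul_right _ hL
  have h3 : L * (n + q) ≤ q * n * (w₀ + w₁) := by nlinarith
  have h4 := Nat.mul_le_mul_left n' h3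
  nlinarith

variable [IsLocalRing T] [IsDomain T] [Algebra ℚ T]

/-- The codimension bound for two equations. -/
theorem exists_orders_two (hs : W.IsTruncatedSolution N x c v Γ h) (hq : 3 ≤ W.b 0 0) :
    ∃ a : Fin 3 → ℕ, (∀ ξ, W.IsTruncatedTangent N x c v Γ h ξ →
      (∀ i, PowerSeries.X ^ a i ∣ ξ i → ξ i = 0) → ξ = 0) ∧ (∀ i, a i ≤ N) ∧
      N * (W.b 0 0 * W.n 0 * W.n 1 + W.n 0 + W.b 0 0) ≤
        W.b 0 0 * W.n 0 * W.n 1 * ∑ i, a i := by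
  have hrel := W.first_relation
  have hlt : W.n 0 * W.β 1 < W.β 2 := W.lt_next 0 1 rfl
  have hn0 := W.two_le 0
  have hn1 := W.two_le 1
  have hβ0 := W.pos 0
  have hβ1 := W.pos 1
  rcases W.jet_alternative two_pos N x hs.mem_maximalIdeal c hs.isUnit v Γ hs.lt_wt h hs.dvd_eqn with
    ⟨k, hk⟩ | ⟨hx, hbal, hNk, hker⟩
  -- All coordinates are small: `L` is the order of `x_2` capped at `N`, and `n_1 β_1 < β_2` makes
  -- both possible conclusions imply `N ≤ n_2 L`.
  · obtain ⟨L, hLN, hL2, hNL⟩ : ∃ L, L ≤ N ∧ PowerSeries.X ^ L ∣ x 2 ∧ N ≤ W.n 1 * L := by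
      by_cases hN : PowerSeries.X ^ N ∣ x 2
      · exact ⟨N, le_rfl, hN, Nat.le_mul_of_pos_left _ (by omega)⟩
      · obtain ⟨w, hw⟩ := PowerSeries.exists_order_eq (p := x 2) fun h0 => hN (by simp [h0])
        have h1 : w < N := by
          rw [PowerSeries.X_pow_dvd_iff_le_order, hw, not_le] at hN
          exact_mod_cast hN
        refine ⟨w, h1.le, by rw [PowerSeries.X_pow_dvd_iff_le_order, hw], ?_⟩
        have h2 := hk 2
        rw [PowerSeries.X_pow_dvd_pow_iff hw] at h2
        have h3 : W.n k * W.β k.succ ≤ W.n 1 * W.β 2 := by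
          fin_cases k
          · exact hlt.le.trans (Nat.le_mul_of_pos_left _ (by omega))
          · exact le_rfl
        refine Nat.le_of_mul_le_mul_right (c := W.β 2) ?_ (W.pos 2)
        nlinarith
    have hΓ0 : ∀ k : Fin 1, ∀ γ ∈ Γ k.castSucc, γ (Fin.last _) = 0 := fun k γ hγ =>
      hs.eq_zero k.castSucc γ hγ _ (by simp [Fin.lt_def])
    -- Modulo `X ^ L` the first equation no longer involves `x_2`, so the alternative is applied
    -- once more to `x_0, x_1` alone. In both outcomes `x_2` contributes the full `N` coordinates,
    -- since `ξ_2` is eliminated through `v`.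
    rcases W.truncate.jet_alternative one_pos L (fun i => x i.castSucc)
      (fun i => hs.mem_maximalIdeal _) (fun k => c k.castSucc) (fun k => hs.isUnit _) v
      (truncateSupport Γ) (fun k γ hγ => by
        obtain ⟨γ, hγ₂, rfl⟩ := Finset.mem_image.mp hγ
        rw [truncate_wt (hΓ0 k γ hγ₂)]
        exact hs.lt_wt _ γ hγ₂)
      (fun k γ => h k.castSucc (Fin.snoc (α := fun _ => ℕ) γ 0)) (fun k =>
        dvd_truncate_eqn (hΓ0 k) hL2 ((pow_dvd_pow _ hLN).trans (hs.dvd_eqn _))) with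
      ⟨k', hk'⟩ | ⟨hx, hbal, hNk, hker⟩
    · have key : ∀ (i : Fin 2) (r : ℕ), r * W.β i.castSucc = W.n 0 * W.β 1 → 0 < r →
          ∃ w, w ≤ N ∧ PowerSeries.X ^ w ∣ x i.castSucc ∧ L ≤ r * w := by
        intro i r hr hr0
        by_cases hN : PowerSeries.X ^ N ∣ x i.castSucc
        · exact ⟨N, le_rfl, hN, hLN.trans (Nat.le_mul_of_pos_left _ hr0)⟩
        · obtain ⟨w, hw⟩ := PowerSeries.exists_order_eq (p := x i.castSucc)
            fun h0 => hN (by simp [h0])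
          have h1 : w < N := by
            rw [PowerSeries.X_pow_dvd_iff_le_order, hw, not_le] at hN
            exact_mod_cast hN
          refine ⟨w, h1.le, by rw [PowerSeries.X_pow_dvd_iff_le_order, hw], ?_⟩
          have h2 := hk' i
          rw [PowerSeries.X_pow_dvd_pow_iff hw] at h2
          have h3 : W.truncate.n k' * W.truncate.β k'.succ = W.n 0 * W.β 1 := by
            obtain rfl := Subsingleton.elim k' 0
            rfl
          rw [h3, ← hr] at h2
          refine Nat.le_of_mul_le_mul_right (c := W.β i.castSucc) ?_ (W.pos _)
          have h4 : W.truncate.β i = W.β i.castSucc := rfl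
          rw [h4] at h2
          nlinarith
      obtain ⟨w₀, hw₀N, hw₀, hL₀⟩ := key 0 (W.b 0 0) hrel.symm (by omega)
      obtain ⟨w₁, hw₁N, hw₁, hL₁⟩ := key 1 (W.n 0) rfl (by omega)
      refine ⟨![w₀, w₁, N], fun ξ hξ ha => ?_, fun i => ?_, ?_⟩
      · have h0 : ξ 0 = 0 := ha 0 (hξ.dvd_of_dvd 0 _ hw₀N hw₀)
        have h1 : ξ 1 = 0 := ha 1 (hξ.dvd_of_dvd 1 _ hw₁N hw₁)
        refine eq_zero_of_linearEqn hs.eq_zero hs.dvd_of_dvd_mul (hξ.dvd_linearEqn h0) ?_ ?_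
        · intro i hi
          fin_cases i
          · exact h0
          · exact h1
          · simp at hi
        · intro i hi hdvd
          fin_cases i
          · simp at hi
          · simp at hi
          · exact ha 2 hdvd
      · fin_cases i
        exacts [hw₀N, hw₁N, le_rfl]
      · rw [Fin.sum_univ_three]
        exact orders_inequality_small hL₀ hL₁ hNL
    · obtain ⟨w, hw, hprop, hlt', hker'⟩ := exists_orders_of_balanced hx hbal hNk hker
      have hp : w 0 * W.β 1 = w 1 * W.β 0 := hprop 0 1
      have h01 : W.n 0 * w 1 = W.b 0 0 * w 0 := by
        refine Nat.eq_of_mul_eq_mul_right hβ0 ?_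
        calc W.n 0 * w 1 * W.β 0 = w 0 * (W.n 0 * W.β 1) := by rw [mul_assoc, ← hp]; ring
          _ = W.b 0 0 * w 0 * W.β 0 := by rw [hrel]; ring
      have hw1 : W.n 0 * w 1 < L := hlt' 0
      have hw0N : w 0 ≤ N := by nlinarith
      have hw1L : w 1 ≤ W.n 0 * w 1 := Nat.le_mul_of_pos_left _ (by omega)
      refine ⟨![w 0, w 1 + (L - W.n 0 * w 1), N], fun ξ hξ ha => ?_, fun i => ?_, ?_⟩
      · have h0 : ξ 0 = 0 := ha 0 (hξ.dvd_of_dvd 0 _ hw0N (by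
          rw [PowerSeries.X_pow_dvd_iff_le_order]
          exact (hw 0).ge))
        have hlin := hξ.dvd_linearEqn h0
        have h2 := hker' (fun i => ξ i.castSucc) h0 (fun k => dvd_truncate_linearEqn (hΓ0 k)
          (hξ.dvd_of_dvd 2 L hLN hL2) ((pow_dvd_pow _ hLN).trans (hlin _))) (fun k hk => by
            obtain rfl := Subsingleton.elim k 0
            exact ha 1 hk)
        refine eq_zero_of_linearEqn hs.eq_zero hs.dvd_of_dvd_mul hlin ?_ ?_
        · intro i hi
          fin_cases i
          · exact h0
          · exact congrFun h2 1
          · simp at hi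
        · intro i hi hdvd
          fin_cases i
          · simp at hi
          · simp at hi
          · exact ha 2 hdvd
      · fin_cases i
        · exact hw0N
        · change w 1 + (L - W.n 0 * w 1) ≤ N
          omega
        · exact le_rfl
      · rw [Fin.sum_univ_three]
        exact orders_inequality_partial hn0 hq h01 hw1 hNL
  -- All three orders are proportional to the weights, and both equations determine high
  -- coefficients.
  · obtain ⟨w, hw, hprop, hlt', hker'⟩ := exists_orders_of_balanced hx hbal hNk hker
    have hp : w 0 * W.β 1 = w 1 * W.β 0 := hprop 0 1
    have hp' : w 1 * W.β 2 = w 2 * W.β 1 := hprop 1 2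
    have h01 : W.n 0 * w 1 = W.b 0 0 * w 0 := by
      refine Nat.eq_of_mul_eq_mul_right hβ0 ?_
      calc W.n 0 * w 1 * W.β 0 = w 0 * (W.n 0 * W.β 1) := by rw [mul_assoc, ← hp]; ring
        _ = W.b 0 0 * w 0 * W.β 0 := by rw [hrel]; ring
    have h12 : W.n 0 * w 1 ≤ w 2 := by
      refine Nat.le_of_mul_le_mul_right (c := W.β 2) ?_ (W.pos 2)
      calc W.n 0 * w 1 * W.β 2 = w 2 * (W.n 0 * W.β 1) := by rw [mul_assoc, hp']; ring
        _ ≤ w 2 * W.β 2 := Nat.mul_le_mul_left _ hlt.le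
    have hw1 : W.n 0 * w 1 < N := hlt' 0
    have hw2 : W.n 1 * w 2 < N := hlt' 1
    have hw0N : w 0 ≤ N := by nlinarith
    have hw1L : w 1 ≤ W.n 0 * w 1 := Nat.le_mul_of_pos_left _ (by omega)
    have hw2L : w 2 ≤ W.n 1 * w 2 := Nat.le_mul_of_pos_left _ (by omega)
    refine ⟨![w 0, w 1 + (N - W.n 0 * w 1), w 2 + (N - W.n 1 * w 2)], fun ξ hξ ha => ?_,
      fun i => ?_, ?_⟩
    · have h0 : ξ 0 = 0 := ha 0 (hξ.dvd_of_dvd 0 _ hw0N (by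
        rw [PowerSeries.X_pow_dvd_iff_le_order]
        exact (hw 0).ge))
      refine hker' ξ h0 (hξ.dvd_linearEqn h0) fun k hk => ?_
      fin_cases k
      · exact ha 1 hk
      · exact ha 2 hk
    · fin_cases i
      · exact hw0N
      · change w 1 + (N - W.n 0 * w 1) ≤ N
        omega
      · change w 2 + (N - W.n 1 * w 2) ≤ N
        omega
    · rw [Fin.sum_univ_three]
      exact orders_inequality_balanced hn0 hn1 hq h01 h12 hw2

end WeightData

/-! ### Comparison of the two codimensions -/

namespace BranchExpansion

variable {f : MvPowerSeries (Fin 2) ℂ} {g : ℕ} (E : BranchExpansion f g)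

theorem jetSeries_eq_zero {σ T : Type*} [CommRing T] {m : ℕ} {ξ : σ × Fin (m + 1) → T} {i : σ}
    {a : ℕ} (hξ : ∀ j : Fin (m + 1), a ≤ (j : ℕ) → ξ (i, j) = 0)
    (h : PowerSeries.X ^ a ∣ jetSeries ξ i) : jetSeries ξ i = 0 := by
  ext1 l
  rcases lt_or_ge l a with hl | hl
  · exact PowerSeries.X_pow_dvd_iff.mp h l hl
  · rw [coeff_jetSeries]
    split_ifs with hm
    · exact hξ _ hl
    · rfl

variable {m : ℕ} (P : Ideal (MvPowerSeries (Fin (g + 1) × Fin (m + 1)) (PowerSeries ℂ)))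

theorem exists_isTruncatedSolution (hf : Irreducible f) [P.IsPrime]
    (hP : ∀ (k : Fin g) (l : ℕ), l < m + 1 → jetCoeff m (E.familyEquation k) l ∈ P)
    (hv : MvPowerSeries.C PowerSeries.X ∉ P) :
    ∃ c v Γ h, (E.weightData hf).IsTruncatedSolution (m + 1) (jet P) c v Γ h ∧
      ∀ ξ, IsTangent P ξ →
        (E.weightData hf).IsTruncatedTangent (m + 1) (jet P) c v Γ h (jetSeries ξ) := by
  obtain ⟨Γ, h, hΓ, heq, hlin⟩ := E.exists_equations P hf hP
  refine ⟨_, _, Γ, h, ⟨constantCoeff_jet P, fun k => ?_, fun p hp => ?_, fun k γ hγ => (hΓ k γ hγ).1,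
    fun k γ hγ => (hΓ k γ hγ).2, heq⟩, fun ξ hξ => ⟨fun i r hr hdvd => ?_, hlin ξ hξ⟩⟩
  · exact ((E.c_ne_zero k).isUnit.map PowerSeries.C).map (constHom P)
  -- Here `v` is a nonzero constant of the domain `A / P`, so it cancels coefficientwise.
  · rw [PowerSeries.X_pow_dvd_iff] at hp ⊢
    intro l hl
    have h1 := hp l hl
    simp only [constHom, RingHom.comp_apply] at h1
    rw [PowerSeries.coeff_C_mul] at h1
    exact (mul_eq_zero.mp h1).resolve_left fun h0 => hv (Ideal.Quotient.eq_zero_iff_mem.mp h0)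
  · rw [PowerSeries.X_pow_dvd_iff] at hdvd ⊢
    intro l hl
    have h1 := hdvd l hl
    rw [jet, coeff_jetSeries, dif_pos (by omega)] at h1
    rw [coeff_jetSeries, dif_pos (by omega)]
    exact hξ.eq_zero_of_mem (Ideal.Quotient.eq_zero_iff_mem.mp h1)

/-- A tangent vector supported on the coordinates `x_i^(j)` with `j < a_i` has series of degree
below `a_i`, so divisibility by `X ^ a_i` kills each entry; this is the implication required by
`ha`. -/
theorem sum_orders_le_height {hf : Irreducible f} [P.IsPrime] {c : Fin g → PowerSeries
      (MvPowerSeries (Fin (g + 1) × Fin (m + 1)) (PowerSeries ℂ) ⧸ P)} {v : PowerSeries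
      (MvPowerSeries (Fin (g + 1) × Fin (m + 1)) (PowerSeries ℂ) ⧸ P)}
    {Γ : Fin g → Finset (Fin (g + 1) → ℕ)} {h : Fin g → (Fin (g + 1) → ℕ) → PowerSeries
      (MvPowerSeries (Fin (g + 1) × Fin (m + 1)) (PowerSeries ℂ) ⧸ P)}
    (htan : ∀ ξ, IsTangent P ξ →
        (E.weightData hf).IsTruncatedTangent (m + 1) (jet P) c v Γ h (jetSeries ξ))
    (a : Fin (g + 1) → ℕ)
    (ha : ∀ ξ, (E.weightData hf).IsTruncatedTangent (m + 1) (jet P) c v Γ h ξ →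
      (∀ i, PowerSeries.X ^ a i ∣ ξ i → ξ i = 0) → ξ = 0) :
    ((∑ i, min (a i) (m + 1) : ℕ) : ℕ∞) ≤ P.height := by
  refine card_initialCoords_le_height P a fun ξ hξ hsupp => ?_
  have h1 := ha (jetSeries ξ) (htan ξ hξ) fun i hi => jetSeries_eq_zero (fun j hj =>
    hsupp (i, j) fun hmem => absurd (mem_initialCoords.mp hmem) (not_lt.mpr hj)) hi
  ext1 ⟨i, j⟩
  have h2 := congrArg (PowerSeries.coeff (j : ℕ)) (congrFun h1 i)
  rw [coeff_jetSeries, dif_pos j.2] at h2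
  simpa using h2

/-- The generators increase, so at most two factors from `β_0, …, β_k` cannot reach `n_k β_{k+1} ≥ 2
β_{k+1}`. For `k = 0` this gives `b 0 0 ≥ 3`. -/
theorem two_lt_sum_b (k : Fin g) : 2 < ∑ j, E.b k j := by
  have hlt : E.β k.castSucc < E.β k.succ := E.isMinimalGenerators.strictMono Fin.castSucc_lt_succ
  have h1 := E.b_sum k
  have h2 : ∑ j, E.b k j * E.β j ≤ (∑ j, E.b k j) * E.β k.castSucc := by
    rw [Finset.sum_mul]
    refine Finset.sum_le_sum fun j _ => ?_
    rcases lt_or_ge k.castSucc j with hj | hj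
    · simp [E.b_eq_zero k j hj]
    · exact Nat.mul_le_mul_left _ (E.isMinimalGenerators.strictMono.monotone hj)
  have h3 := E.two_le_ratioSeq k
  have h4 := E.β_pos k.castSucc
  by_contra hle
  have h5 : 2 * E.β k.succ ≤ 2 * E.β k.castSucc := by
    calc 2 * E.β k.succ ≤ ratioSeq E.β k * E.β k.succ := Nat.mul_le_mul_right _ h3
      _ ≤ (∑ j, E.b k j) * E.β k.castSucc := h1 ▸ h2
      _ ≤ 2 * E.β k.castSucc := Nat.mul_le_mul_right _ (by omega)
  omega

theorem not_flat_of_three_le (hf : Irreducible f) (hg : 3 ≤ g) (m : ℕ) (hm : 1 ≤ m) :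
    ¬ Module.Flat (PowerSeries ℂ) (E.FamilyJetRing m) := by
  intro hflat
  obtain ⟨P, hP, hIP, hv, hht⟩ := E.exists_isPrime_of_flat m hflat
    -- Orders `⌊N/2⌋` for `x_0` and `⌈N/2⌉` for the others: `n_k ≥ 2` handles the pure powers, and
    -- `3 ⌊N/2⌋ ≥ N` for `N ≥ 2` handles the monomials `b k`. Rounding down at `x_0` is needed for
    -- even `m` when `g = 3`.
    (fun i => if i = 0 then (m + 1) / 2 else (m + 2) / 2) (fun k => by
      rw [if_neg (Fin.succ_ne_zero k)]
      have h1 := Nat.mul_le_mul_right ((m + 2) / 2) (E.two_le_ratioSeq k)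
      omega) (fun k => by
      have h1 : (∑ j, E.b k j) * ((m + 1) / 2) ≤
          ∑ j, E.b k j * (if j = 0 then (m + 1) / 2 else (m + 2) / 2) := by
        rw [Finset.sum_mul]
        refine Finset.sum_le_sum fun j _ => Nat.mul_le_mul_left _ ?_
        split_ifs <;> omega
      have h2 := Nat.mul_le_mul_right ((m + 1) / 2) (E.two_lt_sum_b k)
      omega)
  obtain ⟨c, v, Γ, h, hs, htan⟩ := E.exists_isTruncatedSolution P hf hIP hv
  obtain ⟨a, ha, hcard⟩ := WeightData.exists_orders_of_lt hs (by omega) (by omega)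
  have h1 := (E.sum_orders_le_height P htan a ha).trans hht
  have h2 := hcard.trans (by exact_mod_cast h1)
  obtain ⟨d, rfl⟩ : ∃ d, g = d + 3 := ⟨g - 3, by omega⟩
  rw [Fin.sum_univ_succ] at h2
  simp only [if_true, Fin.succ_ne_zero, if_false, Finset.sum_const, Finset.card_univ, Fintype.card_fin,
    smul_eq_mul] at h2
  have h3 : min ((m + 2) / 2) (m + 1) ≤ (m + 2) / 2 := min_le_left _ _
  have h4 : min ((m + 1) / 2) (m + 1) ≤ (m + 1) / 2 := min_le_left _ _
  have h5 := Nat.mul_le_mul_left (d + 3) h3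
  have h6 : (d + 3 - 1) * (m + 1) = d * (m + 1) + 2 * (m + 1) := by
    rw [show d + 3 - 1 = d + 2 from rfl]; ring
  have h7 : (d + 3) * ((m + 2) / 2) = d * ((m + 2) / 2) + 3 * ((m + 2) / 2) := by ring
  have h8 : d * ((m + 2) / 2) ≤ d * (m + 1) := Nat.mul_le_mul_left _ (by omega)
  omega

theorem not_flat_of_two (hf : Irreducible f) (E : BranchExpansion f 2) (m : ℕ) (hm : 36 ≤ m) :
    ¬ Module.Flat (PowerSeries ℂ) (E.FamilyJetRing m) := by
  intro hflat
  have hq : 3 ≤ E.b 0 0 := by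
    have h1 := E.two_lt_sum_b 0
    rw [Fin.sum_univ_three, E.b_eq_zero 0 1 (by decide), E.b_eq_zero 0 2 (by decide)] at h1
    exact h1
  have hn := E.two_le_ratioSeq 0
  have hn' := E.two_le_ratioSeq 1
  have hrel : ratioSeq E.β 0 * E.β 1 = E.b 0 0 * E.β 0 := (E.weightData hf).first_relation
  have hlt : ratioSeq E.β 0 * E.β 1 < E.β 2 := E.lt_next hf 0 1 rfl
  have hceil : ∀ r, 2 ≤ r → m + 1 ≤ r * (m / r + 1) := fun r hr => by
    rw [mul_comm]
    exact Nat.succ_le_of_lt (Nat.lt_mul_of_div_lt (Nat.lt_succ_self _) (by omega))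
  have hb1 : ratioSeq E.β 1 * E.β 2 = E.b 1 0 * E.β 0 + E.b 1 1 * E.β 1 := by
    have h1 := E.b_sum 1
    rw [Fin.sum_univ_three, E.b_eq_zero 1 2 (by decide)] at h1
    simpa using h1
  obtain ⟨P, hP, hIP, hv, hht⟩ := E.exists_isPrime_of_flat m hflat
    -- These are the ceilings of `N/q`, `N/n_1`, `N/n_2`.
    ![m / E.b 0 0 + 1, m / ratioSeq E.β 0 + 1, m / ratioSeq E.β 1 + 1] (fun k => by
      fin_cases k
      · exact hceil _ hn
      · exact hceil _ hn') (fun k => by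
      fin_cases k
      · rw [Fin.sum_univ_three]
        refine le_trans (hceil (E.b 0 0) (by omega)) ?_
        exact (Nat.le_add_right _ _).trans (Nat.le_add_right _ _)
      · rw [Fin.sum_univ_three]
        refine le_trans ?_ (Nat.le_add_right _ _)
        change m + 1 ≤ E.b 1 0 * (m / E.b 0 0 + 1) + E.b 1 1 * (m / ratioSeq E.β 0 + 1)
        have h0 := hceil (E.b 0 0) (by omega)
        have h1 := hceil _ hn
        generalize m / E.b 0 0 + 1 = u at h0
        generalize m / ratioSeq E.β 0 + 1 = w at h1
        have hd : 0 < ratioSeq E.β 0 * E.β 1 := Nat.mul_pos (by omega) (E.β_pos 1)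
        -- The chosen orders of `x_0, x_1` are at least `N β_i / d` with `d = n_1 β_1 = q β_0`.
        -- Hence the monomial `b 1` has order at least `N n_2 β_2 / d ≥ N`.
        refine Nat.le_of_mul_le_mul_right (c := ratioSeq E.β 0 * E.β 1) ?_ hd
        have e1 : (m + 1) * (E.b 1 0 * E.β 0) ≤ E.b 1 0 * u * (ratioSeq E.β 0 * E.β 1) := by
          rw [hrel]
          calc (m + 1) * (E.b 1 0 * E.β 0) ≤ E.b 0 0 * u * (E.b 1 0 * E.β 0) :=
              Nat.mul_le_mul_right _ h0
            _ = _ := by ring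
        have e2 : (m + 1) * (E.b 1 1 * E.β 1) ≤ E.b 1 1 * w * (ratioSeq E.β 0 * E.β 1) := by
          calc (m + 1) * (E.b 1 1 * E.β 1) ≤ ratioSeq E.β 0 * w * (E.b 1 1 * E.β 1) :=
              Nat.mul_le_mul_right _ h1
            _ = _ := by ring
        have e3 : (m + 1) * (ratioSeq E.β 0 * E.β 1) ≤ (m + 1) * (ratioSeq E.β 1 * E.β 2) := by
          refine Nat.mul_le_mul_left _ (hlt.le.trans ?_)
          exact Nat.le_mul_of_pos_left _ (by omega)
        calc (m + 1) * (ratioSeq E.β 0 * E.β 1) ≤ (m + 1) * (ratioSeq E.β 1 * E.β 2) := e3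
          _ = (m + 1) * (E.b 1 0 * E.β 0) + (m + 1) * (E.b 1 1 * E.β 1) := by rw [hb1]; ring
          _ ≤ _ := (add_le_add e1 e2).trans (add_mul _ _ _).ge)
  obtain ⟨c, v, Γ, h, hs, htan⟩ := E.exists_isTruncatedSolution P hf hIP hv
  obtain ⟨a, ha, haN, hcard⟩ := WeightData.exists_orders_two hs hq
  have h1 := (E.sum_orders_le_height P htan a ha).trans hht
  have h2 := Nat.cast_le.mp h1
  rw [Finset.sum_congr rfl fun i _ => min_eq_left (haN i)] at h2
  have h3 : ∑ i, a i ≤ (m / E.b 0 0 + 1) + (m / ratioSeq E.β 0 + 1) + (m / ratioSeq E.β 1 + 1) := by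
    refine h2.trans ?_
    rw [Fin.sum_univ_three]
    exact add_le_add (add_le_add (min_le_left _ _) (min_le_left _ _)) (min_le_left _ _)
  change (m + 1) * (E.b 0 0 * ratioSeq E.β 0 * ratioSeq E.β 1 + ratioSeq E.β 0 + E.b 0 0) ≤
    E.b 0 0 * ratioSeq E.β 0 * ratioSeq E.β 1 * ∑ i, a i at hcard
  generalize E.b 0 0 = q at *
  generalize ratioSeq E.β 0 = n at *
  generalize ratioSeq E.β 1 = n' at *
  have hq' := Nat.div_mul_le_self m q
  have hn0 := Nat.div_mul_le_self m n
  have hn1 := Nat.div_mul_le_self m n'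
  have h4 : q * n * n' * ∑ i, a i ≤ m * (n * n' + q * n' + q * n) + 3 * (q * n * n') := by
    calc q * n * n' * ∑ i, a i ≤ q * n * n' * ((m / q + 1) + (m / n + 1) + (m / n' + 1)) :=
          Nat.mul_le_mul_left _ h3
      _ = (m / q * q) * (n * n') + (m / n * n) * (q * n') + (m / n' * n') * (q * n)
          + 3 * (q * n * n') := by ring
      _ ≤ m * (n * n') + m * (q * n') + m * (q * n) + 3 * (q * n * n') := by gcongr
      _ = _ := by ring
  have h5 := hcard.trans h4
  obtain ⟨q, rfl⟩ := Nat.exists_eq_add_of_le hq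
  obtain ⟨n, rfl⟩ := Nat.exists_eq_add_of_le hn
  obtain ⟨n', rfl⟩ := Nat.exists_eq_add_of_le hn'
  obtain ⟨m, rfl⟩ := Nat.exists_eq_add_of_le hm
  ring_nf at h5
  -- After division by `q n n'` the gap of leading coefficients is at least `1/12`, so `m ≥ 36`
  -- absorbs the rounding error `3`; using `m + 1` on the left makes the contradiction strict.
  nlinarith [Nat.zero_le (q * n * n'), Nat.zero_le (m * q * n * n'), Nat.zero_le (m * q * n),
    Nat.zero_le (m * q * n'), Nat.zero_le (m * n * n'), Nat.zero_le (m * q), Nat.zero_le (m * n),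
    Nat.zero_le (m * n'), Nat.zero_le (q * n), Nat.zero_le (q * n'), Nat.zero_le (n * n')]

end BranchExpansion

theorem mainTheorem5 (g : ℕ) (f : MvPowerSeries (Fin 2) ℂ) (hf : Irreducible f)
    (E : BranchExpansion f g) :
    (3 ≤ g → ∀ m : ℕ, 1 ≤ m → ¬ Module.Flat (PowerSeries ℂ) (E.FamilyJetRing m)) ∧
    (g = 2 → ∃ M : ℕ, ∀ m : ℕ, M ≤ m →
      ¬ Module.Flat (PowerSeries ℂ) (E.FamilyJetRing m)) := by
  refine ⟨fun hg m hm => E.not_flat_of_three_le hf hg m hm, ?_⟩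
  rintro rfl
  exact ⟨36, fun m hm => BranchExpansion.not_flat_of_two hf E m hm⟩
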